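/- **Setting.** Let $(\Omega,\Sigma,\mu)$ be a measure space with finite measure. $L^0(\Omega)$ is the algebra of a.e.-classes of complex measurable functions and $L^\infty(\Omega)$ its subalgebra of essentially bounded classes. Let $E\subseteq L^0(\Omega)$ be a faithful solid subalgebra with $L^\infty(\Omega)\subseteq E$, i.e. $|x|\le|y|$, $y\in E$ imply $x\in E$, and $E^\perp=\{0\}$. A *Banach–Kantorovich algebra* over $E$ is a complex associative algebra $\mathcal U$ which is a unitary $E$-module, compatibly with the complex scalars, with $(au)v=a(uv)=u(av)$, and carries an $E$-valued norm $\|\cdot\|$ such that: $\|u\|\ge 0$; $\|u\|=0\iff u=0$; $\|u+v\|\le\|u\|+\|v\|$; $\|\lambda u\|=|\lambda|\|u\|$ for $\lambda\in\mathbb C$; $\|au\|=|a|\,\|u\|$ for $a\in E$; $\|uv\|\le\|u\|\|v\|$; if $\|u\|=s+t$ with $0\le s,t$ and $st=0$, then $u=y+z$ with $\|y\|=s$, $\|z\|=t$; and every (bo)-Cauchy net (bo)-converges, where $(u_\alpha)$ (bo)-converges to $u$ if $\|u-u_\alpha\|$ order converges to $0$ in $E$. It is *unital* if it has a unit $e$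 with $\|e\|=\mathbf 1$, and *full* if no $A\in\Sigma$ with $\mu(A)>0$ satisfies $\chi_A\|u\|=0$ for all $u\in\mathcal U$. A *lifting* $p$ assigns to each $f\in L^\infty(\Omega)$ an everywhere defined bounded measurable representative $p(f)$ of $f$ so that $p$ is a unital homomorphism of complex algebras. A *measurable bundle of Banach algebras* $(\mathcal X,L)$ consists of a complex Banach algebra $X(\omega)$ for each $\omega\in\Omega$ (possibly $\{0\}$) and a set $L$ of a.e. defined sections, closed under complex linear combinations and pointwise products (taken on intersections of domains), such that $\omega\mapsto\|c(\omega)\|$ agrees a.e. with a measurable function for all $c\in L$, and $\{c(\omega):c\in L,\ \omega\in\operatorname{dom}c\}$ is dense in $X(\omega)$ for every $\omega$. Simple sections are finite sums $\sum_i\chi_{A_i}c_i$ with $A_i\in\Sigma$, $c_i\in L$; $M(\Omega,\mathcal X)$ is the set of *measurable sections*, the a.e. defined sections $u$ such that $\|s_n(\omega)-u(\omega)\|\to0$ a.e. for some sequence $(s_n)$ of simple sections. $L^0(\Omega,\mathcal X)$ is the set of a.e.-classes of measurable sections, with pointwise operations and $\|\hat u\|$ the class of $\omega\mapsto\|u(\omega)\|$;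 $E(\Omega,\mathcal X)=\{x\in L^0(\Omega,\mathcal X):\|x\|\in E\}$, and $L^\infty(\Omega,\mathcal X)$ is the case $E=L^\infty(\Omega)$. A *vector-valued lifting* of $\mathcal X$ associated with $p$ assigns to each $x\in L^\infty(\Omega,\mathcal X)$ an everywhere defined representative $\ell(x)$ of $x$ such that, for all $x,y\in L^\infty(\Omega,\mathcal X)$, $a\in L^\infty(\Omega)$ and $\omega\in\Omega$: $\|\ell(x)(\omega)\|=p(\|x\|)(\omega)$, $\ell(x+y)=\ell(x)+\ell(y)$, $\ell(ax)=p(a)\ell(x)$, $\ell(xy)=\ell(x)\ell(y)$, and $\{\ell(z)(\omega):z\in L^\infty(\Omega,\mathcal X)\}$ is dense in $X(\omega)$. An *isometric isomorphism* $\mathcal U\to E(\Omega,\mathcal X)$ is an $E$-linear multiplicative bijection preserving the $E$-valued norms. An *isomorphism of bundles* $\mathcal X\to\mathcal Y$ is a family of injective algebra homomorphisms $H_\omega:X(\omega)\to Y(\omega)$, $\omega\in\Omega$, with $\{(H_\omega(u(\omega)))_\omega:u\in M(\Omega,\mathcal X)\}=M(\Omega,\mathcal Y)$. **Theorem.** If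 $\mu$ is complete and nonzero, then a lifting $p$ of $L^\infty(\Omega)$ exists. Let $\mathcal U$ be a Banach–Kantorovich algebra over $E$. For every lifting $p$ there is a measurable bundle of Banach algebras $(\mathcal X,L)$ with a vector-valued lifting $\ell_{\mathcal X}$ associated with $p$ such that 1. $\mathcal U$ is isometrically isomorphic to $E(\Omega,\mathcal X)$; 2. $\{\ell_{\mathcal X}(x)(\omega):x\in L^\infty(\Omega,\mathcal X)\}=X(\omega)$ for every $\omega\in\Omega$; 3. (uniqueness) if $\mathcal Y$ is any measurable bundle of Banach algebras which has a vector-valued lifting associated with $p$ and for which $E(\Omega,\mathcal Y)$ is isometrically isomorphic to $\mathcal U$, then there is an isomorphism of bundles from $\mathcal X$ to $\mathcal Y$ all of whose components $H_\omega$ are isometric; 4. if $\mathcal U$ is full, then $X(\omega)\ne\{0\}$ for every $\omega\in\Omega$; 5. if $\mathcal U$ is unital, then for every $\omega\in\Omega$ the algebra $X(\omega)$ has a unit, of norm $1$. -/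

import Mathlib

open MeasureTheory Filter Topology

universe u v w

namespace BKAlg

/-! ## The algebra of classes of measurable functions -/

section LZero

variable {Ω : Type u} [MeasurableSpace Ω] {μ : Measure Ω}

/-- `L⁰(Ω)`, the almost everywhere classes of complex measurable functions, is a commutative ring
for the pointwise operations. The additive group and the multiplicative monoid are those of
Mathlib. -/
noncomputable instance instCommRingLZero : CommRing (Ω →ₘ[μ] ℂ) :=
  { (inferInstance : AddCommGroup (Ω →ₘ[μ] ℂ)), (inferInstance : CommMonoid (Ω →ₘ[μ] ℂ)) with
    left_distrib := by
      intro a b c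
      apply AEEqFun.ext
      filter_upwards [AEEqFun.coeFn_mul a (b + c), AEEqFun.coeFn_add b c,
        AEEqFun.coeFn_add (a * b) (a * c), AEEqFun.coeFn_mul a b, AEEqFun.coeFn_mul a c]
        with x h1 h2 h3 h4 h5
      simp only [h1, h2, h3, h4, h5, Pi.mul_apply, Pi.add_apply, mul_add]
    right_distrib := by
      intro a b c
      apply AEEqFun.ext
      filter_upwards [AEEqFun.coeFn_mul (a + b) c, AEEqFun.coeFn_add a b,
        AEEqFun.coeFn_add (a * c) (b * c), AEEqFun.coeFn_mul a c, AEEqFun.coeFn_mul b c]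
        with x h1 h2 h3 h4 h5
      simp only [h1, h2, h3, h4, h5, Pi.mul_apply, Pi.add_apply, add_mul]
    zero_mul := by
      intro a
      apply AEEqFun.ext
      filter_upwards [AEEqFun.coeFn_mul 0 a, AEEqFun.coeFn_zero (μ := μ) (β := ℂ)] with x h1 h2
      simp only [h1, h2, Pi.mul_apply, Pi.zero_apply, zero_mul]
    mul_zero := by
      intro a
      apply AEEqFun.ext
      filter_upwards [AEEqFun.coeFn_mul a 0, AEEqFun.coeFn_zero (μ := μ) (β := ℂ)] with x h1 h2
      simp only [h1, h2, Pi.mul_apply, Pi.zero_apply, mul_zero] }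

noncomputable instance instAlgebraLZero : Algebra ℂ (Ω →ₘ[μ] ℂ) :=
  Algebra.ofModule
    (by
      intro r a b
      apply AEEqFun.ext
      filter_upwards [AEEqFun.coeFn_mul (r • a) b, AEEqFun.coeFn_smul r a,
        AEEqFun.coeFn_smul r (a * b), AEEqFun.coeFn_mul a b] with x h1 h2 h3 h4
      simp only [h1, h2, h3, h4, Pi.mul_apply, Pi.smul_apply, smul_mul_assoc])
    (by
      intro r a b
      apply AEEqFun.ext
      filter_upwards [AEEqFun.coeFn_mul a (r • b), AEEqFun.coeFn_smul r b,
        AEEqFun.coeFn_smul r (a * b), AEEqFun.coeFn_mul a b] with x h1 h2 h3 h4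
      simp only [h1, h2, h3, h4, Pi.mul_apply, Pi.smul_apply, mul_smul_comm])

/-- A real class seen as a complex class. -/
noncomputable def ofRealL (f : Ω →ₘ[μ] ℝ) : Ω →ₘ[μ] ℂ :=
  AEEqFun.comp (fun t : ℝ => (t : ℂ)) Complex.continuous_ofReal f

/-- The modulus `|f|` of a class `f` in `L⁰(Ω)`. -/
noncomputable def absL (f : Ω →ₘ[μ] ℂ) : Ω →ₘ[μ] ℝ :=
  AEEqFun.comp (fun z : ℂ => ‖z‖) continuous_norm f

variable (μ) in
/-- `L^∞(Ω)`, the algebra of classes of essentially bounded functions. -/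
noncomputable def Linf : Subalgebra ℂ (Ω →ₘ[μ] ℂ) where
  carrier := {f | ∃ C : ℝ, ∀ᵐ ω ∂μ, ‖f ω‖ ≤ C}
  mul_mem' := by
    rintro f g ⟨C, hC⟩ ⟨D, hD⟩
    refine ⟨|C| * |D|, ?_⟩
    filter_upwards [hC, hD, AEEqFun.coeFn_mul f g] with ω h1 h2 h3
    rw [h3, Pi.mul_apply, norm_mul]
    exact mul_le_mul (h1.trans (le_abs_self C)) (h2.trans (le_abs_self D)) (norm_nonneg _)
      (abs_nonneg C)
  add_mem' := by
    rintro f g ⟨C, hC⟩ ⟨D, hD⟩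
    refine ⟨C + D, ?_⟩
    filter_upwards [hC, hD, AEEqFun.coeFn_add f g] with ω h1 h2 h3
    rw [h3, Pi.add_apply]
    exact (norm_add_le _ _).trans (add_le_add h1 h2)
  algebraMap_mem' := by
    intro r
    refine ⟨‖r‖, ?_⟩
    rw [Algebra.algebraMap_eq_smul_one]
    filter_upwards [AEEqFun.coeFn_smul r (1 : Ω →ₘ[μ] ℂ),
      AEEqFun.coeFn_one (μ := μ) (β := ℂ)] with ω h1 h2
    rw [h1, Pi.smul_apply, h2]
    simp

/-- A unital subalgebra `E` of `L⁰(Ω)` is faithful and solid if `|x| ≤ |y|`, `y ∈ E` imply `x ∈ E`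
and the disjoint complement of `E` is zero. As `E` contains the constants, solidity gives
`L^∞(Ω) ⊆ E`. -/
structure IsFaithfulSolid (E : Subalgebra ℂ (Ω →ₘ[μ] ℂ)) : Prop where
  solid : ∀ x y : Ω →ₘ[μ] ℂ, y ∈ E → absL x ≤ absL y → x ∈ E
  faithful : ∀ x : Ω →ₘ[μ] ℂ, (∀ y ∈ E, absL x ⊓ absL y = 0) → x = 0

/-! ## Banach–Kantorovich algebras -/

/-- Order convergence to zero in `E` of a family of nonnegative elements along a filter: there is
a downward directed set `D` in `E` with infimum `0`, each of whose elements eventually dominates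
the family. -/
def OrderNull (E : Subalgebra ℂ (Ω →ₘ[μ] ℂ)) {ι : Type*} (l : Filter ι)
    (f : ι → (Ω →ₘ[μ] ℝ)) : Prop :=
  ∃ D : Set (Ω →ₘ[μ] ℝ), D.Nonempty ∧ DirectedOn (fun a b => b ≤ a) D ∧
    (∀ e ∈ D, ofRealL e ∈ E) ∧ IsGLB D 0 ∧ ∀ e ∈ D, ∀ᶠ i in l, f i ≤ e

/-- The algebra `U`, a module over `E`, is a Banach–Kantorovich algebra over `E` for the `E`-valued
norm `N`. Completeness for (bo)-Cauchy nets is phrased with proper filters on `U`: the tails of a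
net generate a proper filter and every proper filter arises in this way. -/
structure IsBanachKantorovichAlgebra (E : Subalgebra ℂ (Ω →ₘ[μ] ℂ)) {U : Type v}
    [NonUnitalRing U] [Module ℂ U] [Module E U] (N : U → (Ω →ₘ[μ] ℝ)) : Prop where
  mem : ∀ x, ofRealL (N x) ∈ E
  nonneg : ∀ x, 0 ≤ N x
  eq_zero_iff : ∀ x, N x = 0 ↔ x = 0
  smul : ∀ (c : ℂ) (x : U), N (c • x) = ‖c‖ • N x
  add_le : ∀ x y, N (x + y) ≤ N x + N y
  module_smul : ∀ (a : E) (x : U), N (a • x) = absL (a : Ω →ₘ[μ] ℂ) * N x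
  mul_le : ∀ x y, N (x * y) ≤ N x * N y
  decomposable : ∀ (x : U) (s t : Ω →ₘ[μ] ℝ), 0 ≤ s → 0 ≤ t → s * t = 0 → N x = s + t →
    ∃ y z : U, x = y + z ∧ N y = s ∧ N z = t
  complete : ∀ F : Filter U, F.NeBot → OrderNull E (F ×ˢ F) (fun q => N (q.1 - q.2)) →
    ∃ x, OrderNull E F (fun y => N (x - y))

/-- The algebra `U` with norm `N` has a unit of norm `1`. -/
def IsUnital {U : Type v} [NonUnitalRing U] (N : U → (Ω →ₘ[μ] ℝ)) : Prop :=
  ∃ e : U, (∀ x, e * x = x ∧ x * e = x) ∧ N e = 1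

/-- No set of positive measure annihilates all norms of elements. -/
def IsFull {U : Type v} (N : U → (Ω →ₘ[μ] ℝ)) : Prop :=
  ∀ A : Set Ω, MeasurableSet A → μ A ≠ 0 → ∃ x : U, ¬ ∀ᵐ ω ∂μ, ω ∈ A → N x ω = 0

/-! ## Liftings -/

variable (μ) in
/-- A lifting: a unital homomorphism from `L^∞(Ω)` into the bounded measurable functions defined
everywhere on `Ω`, which chooses a representative of each class (so that it preserves the essential
supremum norm). -/
structure Lifting where
  toHom : Linf μ →ₐ[ℂ] (Ω → ℂ)
  measurable : ∀ f, Measurable (toHom f)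
  bounded : ∀ f, ∃ C : ℝ, ∀ ω, ‖toHom f ω‖ ≤ C
  ae_eq : ∀ f, toHom f =ᵐ[μ] (f : Ω →ₘ[μ] ℂ)

end LZero

/-! ## Sections, defined almost everywhere -/

section Sections

variable {Ω : Type u} [MeasurableSpace Ω]

/-- A section of the family `X`, defined almost everywhere. -/
structure Sec (μ : Measure Ω) (X : Ω → Type v) where
  toFun : ∀ ω, Part (X ω)
  ae_dom : ∀ᵐ ω ∂μ, (toFun ω).Dom

variable {μ : Measure Ω} {X : Ω → Type v} {Y : Ω → Type w}

/-- An everywhere defined function as a section. -/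
def Sec.ofFun (f : ∀ ω, X ω) : Sec μ X := ⟨fun ω => Part.some (f ω), by simp⟩

/-- Apply a map fibrewise. -/
def Sec.map (h : ∀ ω, X ω → Y ω) (a : Sec μ X) : Sec μ Y where
  toFun ω := (a.toFun ω).map (h ω)
  ae_dom := a.ae_dom

/-- Apply a binary operation fibrewise, on the intersection of the domains. -/
def Sec.map₂ (h : ∀ ω, X ω → X ω → X ω) (a b : Sec μ X) : Sec μ X where
  toFun ω := ⟨(a.toFun ω).Dom ∧ (b.toFun ω).Dom,
    fun d => h ω ((a.toFun ω).get d.1) ((b.toFun ω).get d.2)⟩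
  ae_dom := a.ae_dom.and b.ae_dom

/-- The value of a section, or `0` outside of its domain. -/
noncomputable def Sec.val [∀ ω, Zero (X ω)] (a : Sec μ X) (ω : Ω) : X ω :=
  open Classical in if d : (a.toFun ω).Dom then (a.toFun ω).get d else 0

/-- Equality almost everywhere. -/
instance Sec.setoid (μ : Measure Ω) (X : Ω → Type v) : Setoid (Sec μ X) where
  r a b := ∀ᵐ ω ∂μ, a.toFun ω = b.toFun ω
  iseqv := ⟨fun _ => Eventually.of_forall fun _ => rfl, fun h => h.mono fun _ e => e.symm,
    fun h k => by filter_upwards [h, k] with _ e1 e2 using e1.trans e2⟩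

/-- Classes of (not necessarily measurable) sections modulo equality almost everywhere. -/
def SecClass (μ : Measure Ω) (X : Ω → Type v) : Type max u v := Quotient (Sec.setoid μ X)

/-- The class of a section. -/
def Sec.cls (a : Sec μ X) : SecClass μ X := Quotient.mk _ a

theorem Sec.map₂_congr (h : ∀ ω, X ω → X ω → X ω) {a a' b b' : Sec μ X} (ha : a ≈ a')
    (hb : b ≈ b') : Sec.map₂ h a b ≈ Sec.map₂ h a' b' := by
  change ∀ᵐ ω ∂μ, _
  filter_upwards [ha, hb] with ω h1 h2
  have key : ∀ p p' q q' : Part (X ω), p = p' → q = q' →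
      (⟨p.Dom ∧ q.Dom, fun d => h ω (p.get d.1) (q.get d.2)⟩ : Part (X ω)) =
        ⟨p'.Dom ∧ q'.Dom, fun d => h ω (p'.get d.1) (q'.get d.2)⟩ := by
    rintro p _ q _ rfl rfl
    rfl
  exact key _ _ _ _ h1 h2

theorem Sec.map_congr (h : ∀ ω, X ω → Y ω) {a a' : Sec μ X} (ha : a ≈ a') :
    Sec.map h a ≈ Sec.map h a' := by
  change ∀ᵐ ω ∂μ, _
  filter_upwards [ha] with ω h1
  simp only [Sec.map]
  rw [h1]

/-- Pointwise sum. -/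
instance [∀ ω, Add (X ω)] : Add (SecClass μ X) where
  add := Quotient.map₂ (Sec.map₂ fun _ x y => x + y) fun _ _ ha _ _ hb => Sec.map₂_congr _ ha hb

/-- Pointwise product. -/
instance [∀ ω, Mul (X ω)] : Mul (SecClass μ X) where
  mul := Quotient.map₂ (Sec.map₂ fun _ x y => x * y) fun _ _ ha _ _ hb => Sec.map₂_congr _ ha hb

/-- Pointwise product with a class of functions. -/
noncomputable instance [∀ ω, SMul ℂ (X ω)] : SMul (Ω →ₘ[μ] ℂ) (SecClass μ X) where
  smul f := Quotient.map (Sec.map fun ω x => f ω • x) fun _ _ ha => Sec.map_congr _ ha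

/-- The class of the function `ω ↦ ‖a(ω)‖`. The default value `0` is never used for classes of
measurable sections, see `MeasurableBundle.norm_cls`. -/
noncomputable def SecClass.norm [∀ ω, NonUnitalNormedRing (X ω)] :
    SecClass μ X → (Ω →ₘ[μ] ℝ) :=
  Quotient.lift
    (fun a => open Classical in
      if h : AEStronglyMeasurable (fun ω => ‖a.val ω‖) μ then AEEqFun.mk _ h else 0)
    (by
      intro a b hab
      have e : (fun ω => ‖a.val ω‖) =ᵐ[μ] fun ω => ‖b.val ω‖ := by
        filter_upwards [hab] with ω h
        simp only [Sec.val]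
        rw [h]
      by_cases h : AEStronglyMeasurable (fun ω => ‖a.val ω‖) μ
      · have h' : AEStronglyMeasurable (fun ω => ‖b.val ω‖) μ := h.congr e
        simp only [h, h', dif_pos]
        exact AEEqFun.mk_eq_mk.2 e
      · have h' : ¬ AEStronglyMeasurable (fun ω => ‖b.val ω‖) μ := fun k => h (k.congr e.symm)
        simp only [h, h', dif_neg, not_false_eq_true])

end Sections

/-! ## Measurable bundles of Banach algebras -/

section Bundles

variable {Ω : Type u} [MeasurableSpace Ω]

/-- A measurable bundle of Banach algebras: a complex Banach algebra over each point, with a set of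
sections which is closed under linear combinations and products, whose elements have measurable
norms, and whose values are dense in every fibre. A norm function, which is defined almost
everywhere only, is measurable in the sense that it agrees almost everywhere with a measurable
function on `Ω`; for a complete measure this is ordinary measurability. A fibre may be zero. -/
structure MeasurableBundle (μ : Measure Ω) where
  fiber : Ω → Type v
  [ring : ∀ ω, NonUnitalNormedRing (fiber ω)]
  [space : ∀ ω, NormedSpace ℂ (fiber ω)]
  [tower : ∀ ω, IsScalarTower ℂ (fiber ω) (fiber ω)]
  [comm : ∀ ω, SMulCommClass ℂ (fiber ω) (fiber ω)]
  [complete : ∀ ω, CompleteSpace (fiber ω)]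
  sections : Set (Sec μ fiber)
  lincomb_mem : ∀ (r s : ℂ), ∀ a ∈ sections, ∀ b ∈ sections,
    Sec.map₂ (fun _ x y => r • x + s • y) a b ∈ sections
  norm_measurable : ∀ a ∈ sections, AEMeasurable (fun ω => ‖a.val ω‖) μ
  dense : ∀ ω, Dense {x : fiber ω | ∃ a ∈ sections, x ∈ a.toFun ω}
  mul_mem : ∀ a ∈ sections, ∀ b ∈ sections, Sec.map₂ (fun _ x y => x * y) a b ∈ sections

attribute [instance] MeasurableBundle.ring MeasurableBundle.space MeasurableBundle.tower
  MeasurableBundle.comm MeasurableBundle.complete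

namespace MeasurableBundle

variable {μ : Measure Ω} (𝒳 : MeasurableBundle.{u, v} μ)

/-- The section `∑ i, χ_{A i} • c i`, defined on the intersection of the domains of the `c i`. -/
noncomputable def simpleSec {n : ℕ} (A : Fin n → Set Ω) (c : Fin n → Sec μ 𝒳.fiber) :
    Sec μ 𝒳.fiber where
  toFun ω := ⟨∀ i, ((c i).toFun ω).Dom,
    fun d => ∑ i, open Classical in if ω ∈ A i then ((c i).toFun ω).get (d i) else 0⟩
  ae_dom := ae_all_iff.2 fun i => (c i).ae_dom

/-- Simple sections. -/
def IsSimple (s : Sec μ 𝒳.fiber) : Prop :=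
  ∃ (n : ℕ) (A : Fin n → Set Ω) (c : Fin n → Sec μ 𝒳.fiber),
    (∀ i, MeasurableSet (A i)) ∧ (∀ i, c i ∈ 𝒳.sections) ∧ s = 𝒳.simpleSec A c

/-- `M(Ω, 𝒳)`: the measurable sections, almost everywhere limits of sequences of simple sections. -/
def measurableSections : Set (Sec μ 𝒳.fiber) :=
  {a | ∃ s : ℕ → Sec μ 𝒳.fiber, (∀ n, 𝒳.IsSimple (s n)) ∧
    ∀ᵐ ω ∂μ, Tendsto (fun n => ‖(s n).val ω - a.val ω‖) atTop (𝓝 0)}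

/-- `L⁰(Ω, 𝒳)`: the classes of measurable sections. -/
def LZero : Set (SecClass μ 𝒳.fiber) := Sec.cls '' 𝒳.measurableSections

/-- `E(Ω, 𝒳)`: the classes `x` of measurable sections with `‖x‖ ∈ E`. -/
def bkSpace (E : Subalgebra ℂ (Ω →ₘ[μ] ℂ)) : Set (SecClass μ 𝒳.fiber) :=
  {x | x ∈ 𝒳.LZero ∧ ofRealL x.norm ∈ E}

variable {𝒳} in
theorem exists_section_sum {n : ℕ} {c : Fin n → Sec μ 𝒳.fiber} (hc : ∀ i, c i ∈ 𝒳.sections)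
    {S : Finset (Fin n)} (hS : S.Nonempty) :
    ∃ b ∈ 𝒳.sections, ∀ᵐ ω ∂μ, b.val ω = ∑ i ∈ S, (c i).val ω := by
  induction hS using Finset.Nonempty.cons_induction with
  | singleton i => exact ⟨c i, hc i, by simp⟩
  | cons i S hi hS ih =>
    obtain ⟨b, hb, hbS⟩ := ih
    refine ⟨_, 𝒳.lincomb_mem 1 1 (c i) (hc i) b hb, ?_⟩
    filter_upwards [hbS, (c i).ae_dom, b.ae_dom] with ω h1 h2 h3
    rw [Finset.sum_cons, ← h1]
    simp [Sec.val, Sec.map₂, h2, h3]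

variable {𝒳} in
theorem aemeasurable_norm_of_isSimple {s : Sec μ 𝒳.fiber} (hs : 𝒳.IsSimple s) :
    AEMeasurable (fun ω => ‖s.val ω‖) μ := by
  classical
  obtain ⟨n, A, c, hA, hc, rfl⟩ := hs
  have hB : ∀ S : Finset (Fin n), MeasurableSet {ω | ∀ i, ω ∈ A i ↔ i ∈ S} := by
    intro S
    have e : {ω | ∀ i, ω ∈ A i ↔ i ∈ S} = ⋂ i, if i ∈ S then A i else (A i)ᶜ := by
      ext ω
      simp only [Set.mem_ofPred_eq, Set.mem_iInter]
      refine forall_congr' fun i => ?_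
      by_cases h : i ∈ S <;> simp [h]
    rw [e]
    refine MeasurableSet.iInter fun i => ?_
    by_cases h : i ∈ S
    · simpa only [h, if_true] using hA i
    · simpa only [h, if_false] using (hA i).compl
  have hm : ∀ S : Finset (Fin n), AEMeasurable (fun ω => ‖∑ i ∈ S, (c i).val ω‖) μ := by
    intro S
    rcases S.eq_empty_or_nonempty with rfl | hS
    · simp
    · obtain ⟨b, hb, hbS⟩ := exists_section_sum hc hS
      refine (𝒳.norm_measurable b hb).congr ?_
      filter_upwards [hbS] with ω h
      rw [h]
  have hsum : AEMeasurable (fun ω => ∑ S : Finset (Fin n),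
      Set.indicator {ω | ∀ i, ω ∈ A i ↔ i ∈ S} (fun ω => ‖∑ i ∈ S, (c i).val ω‖) ω) μ :=
    Finset.aemeasurable_fun_sum _ fun S _ => (hm S).indicator (hB S)
  refine hsum.congr ?_
  filter_upwards [ae_all_iff.2 fun i => (c i).ae_dom] with ω hω
  rw [Finset.sum_eq_single (Finset.univ.filter fun i => ω ∈ A i)]
  · rw [Set.indicator_of_mem (by simp)]
    simp [Sec.val, simpleSec, hω, Finset.sum_filter]
  · intro S _ hS
    refine Set.indicator_of_notMem (fun h => hS ?_) _
    ext i
    simpa using (h i).symm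
  · simp

variable {𝒳} in
/-- The norm function of a measurable section is measurable. -/
theorem aemeasurable_norm {a : Sec μ 𝒳.fiber} (ha : a ∈ 𝒳.measurableSections) :
    AEMeasurable (fun ω => ‖a.val ω‖) μ := by
  obtain ⟨s, hs, hlim⟩ := ha
  refine aemeasurable_of_tendsto_metrizable_ae atTop
    (fun n => aemeasurable_norm_of_isSimple (hs n)) ?_
  filter_upwards [hlim] with ω h
  exact (tendsto_iff_norm_sub_tendsto_zero.2 h).norm

variable {𝒳} in
/-- The norm of the class of a measurable section is the class of its norm function. -/
theorem norm_cls {a : Sec μ 𝒳.fiber} (ha : a ∈ 𝒳.measurableSections) :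
    a.cls.norm =ᵐ[μ] fun ω => ‖a.val ω‖ := by
  have h := (aemeasurable_norm ha).aestronglyMeasurable
  have e : a.cls.norm = AEEqFun.mk _ h := dif_pos h
  rw [e]
  exact AEEqFun.coeFn_mk _ h

end MeasurableBundle

/-- A vector-valued lifting of the bundle `𝒳`, associated with the lifting `p`. It assigns to each
class in `L^∞(Ω, 𝒳)` an everywhere defined representative; values outside of `L^∞(Ω, 𝒳)` are
irrelevant. -/
structure VectorLifting {μ : Measure Ω} (p : Lifting μ) (𝒳 : MeasurableBundle.{u, v} μ) where
  toFun : SecClass μ 𝒳.fiber → ∀ ω, 𝒳.fiber ω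
  cls_eq : ∀ x ∈ 𝒳.bkSpace (Linf μ), (Sec.ofFun (toFun x) : Sec μ 𝒳.fiber).cls = x
  norm_eq : ∀ x (hx : x ∈ 𝒳.bkSpace (Linf μ)), ∀ ω,
    (‖toFun x ω‖ : ℂ) = p.toHom ⟨ofRealL x.norm, hx.2⟩ ω
  map_add : ∀ x ∈ 𝒳.bkSpace (Linf μ), ∀ y ∈ 𝒳.bkSpace (Linf μ), ∀ ω,
    toFun (x + y) ω = toFun x ω + toFun y ω
  map_smul : ∀ (f : Linf μ), ∀ x ∈ 𝒳.bkSpace (Linf μ), ∀ ω,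
    toFun ((f : Ω →ₘ[μ] ℂ) • x) ω = p.toHom f ω • toFun x ω
  map_mul : ∀ x ∈ 𝒳.bkSpace (Linf μ), ∀ y ∈ 𝒳.bkSpace (Linf μ), ∀ ω,
    toFun (x * y) ω = toFun x ω * toFun y ω
  dense : ∀ ω, Dense {z : 𝒳.fiber ω | ∃ x ∈ 𝒳.bkSpace (Linf μ), toFun x ω = z}

/-- An isometric isomorphism from `U`, with `E`-valued norm `N`, onto `E(Ω, 𝒳)`. -/
structure IsometricIso {μ : Measure Ω} (E : Subalgebra ℂ (Ω →ₘ[μ] ℂ)) {U : Type w}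
    [NonUnitalRing U] [Module E U] (N : U → (Ω →ₘ[μ] ℝ)) (𝒳 : MeasurableBundle.{u, v} μ) where
  toFun : U → SecClass μ 𝒳.fiber
  bijOn : Set.BijOn toFun Set.univ (𝒳.bkSpace E)
  map_add : ∀ x y, toFun (x + y) = toFun x + toFun y
  map_smul : ∀ (a : E) (x : U), toFun (a • x) = (a : Ω →ₘ[μ] ℂ) • toFun x
  map_mul : ∀ x y, toFun (x * y) = toFun x * toFun y
  norm_eq : ∀ x, (toFun x).norm = N x

/-- A family of injective homomorphisms between the fibres of two bundles is an isomorphism of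
bundles if it carries the measurable sections of the first onto those of the second. -/
def IsBundleIsomorphism {μ : Measure Ω} {𝒳 : MeasurableBundle.{u, v} μ}
    {𝒴 : MeasurableBundle.{u, w} μ} (H : ∀ ω, 𝒳.fiber ω →ₙₐ[ℂ] 𝒴.fiber ω) : Prop :=
  (∀ ω, Function.Injective (H ω)) ∧
    Sec.map (fun ω => H ω) '' 𝒳.measurableSections = 𝒴.measurableSections

end Bundles

end BKAlg

namespace BKAlg

/-! The fibre over `ω` arises by evaluating norms at `ω` through the lifting. On the bounded part of
`U` the map `x ↦ p(‖x‖)(ω)` is a submultiplicative seminorm for every single `ω`, because `p` is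
multiplicative, additive and monotone everywhere and not just almost everywhere. The fibre is the
Hausdorff quotient, an element becomes the section of its germs, and a bounded function `a` acts on
the fibre as the scalar `p(a)(ω)` (`germ_bsmul`).

Two points carry the construction. The quotient must already be complete, since a completion could
add vectors that no bounded section attains. Truncating an element where its norm is large does not
change its germ at `ω` (`exists_equiv_norm_le`), so a fast Cauchy sequence in the fibre lifts to a
series converging in the norm of `U` (`completeSpace`). Next, every bounded measurable section must
be a section of germs (`exists_sec_of_meas`): simple sections are, and almost everywhere limits are
reached by (bo)-completeness, with the suprema of the tails as modulus (`exists_ae_limit`). Division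
by `1 + ‖x‖` passes from bounded to arbitrary elements (`IsRep`).

For uniqueness, a vector-valued lifting of another bundle gives each bounded `x` a lifted section
whose norm at `ω` is again `p(‖x‖)(ω)`. Sending germs to lifted values is therefore well defined and
isometric; its range is closed and dense, hence everything. For the last two claims an element of
norm `1` suffices, because `p(1) = 1` at every point. A unit is such an element, and a full algebra
contains one by exhaustion (`exists_norm_eq_one`).

The lifting itself comes from a lower density on all measurable sets. Zorn's lemma produces it: a
density extends by one set, countable chains are bounded by martingale convergence, and other chains
by their union. Each point then carries an ultrafilter refining its density filter, and the limit
along it is the lifting. -/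

/-! ## Lower densities on complete sub-σ-algebras -/

/-- The σ-algebra generated by `m` and one more set `A`. -/
@[reducible] def adjoinSet {Ω : Type u} (m : MeasurableSpace Ω) (A : Set Ω) : MeasurableSpace Ω where
  MeasurableSet' D := ∃ B C, MeasurableSet[m] B ∧ MeasurableSet[m] C ∧
    ∀ x, x ∈ D ↔ (x ∈ A ∧ x ∈ B) ∨ (x ∉ A ∧ x ∈ C)
  measurableSet_empty := ⟨∅, ∅, MeasurableSet.empty, MeasurableSet.empty, by simp⟩
  measurableSet_compl := by
    rintro D ⟨B, C, hB, hC, h⟩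
    refine ⟨Bᶜ, Cᶜ, hB.compl, hC.compl, fun x => ?_⟩
    rw [Set.mem_compl_iff, h]
    simp only [Set.mem_compl_iff]
    tauto
  measurableSet_iUnion := by
    intro f hf
    choose B C hB hC h using hf
    refine ⟨⋃ n, B n, ⋃ n, C n, MeasurableSet.iUnion hB, MeasurableSet.iUnion hC, fun x => ?_⟩
    simp only [Set.mem_iUnion, h]
    by_cases hx : x ∈ A <;> simp [hx]

theorem le_adjoinSet {Ω : Type u} (m : MeasurableSpace Ω) (A : Set Ω) : m ≤ adjoinSet m A :=
  fun D hD => ⟨D, D, hD, hD, fun x => by tauto⟩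

theorem mem_adjoinSet {Ω : Type u} (m : MeasurableSpace Ω) (A : Set Ω) :
    MeasurableSet[adjoinSet m A] A :=
  ⟨Set.univ, ∅, MeasurableSet.univ, MeasurableSet.empty, fun x => by simp⟩

section LowerDensity

variable {Ω : Type u} [m0 : MeasurableSpace Ω] {μ : Measure Ω}

variable (μ) in
/-- A lower density defined on a sub-σ-algebra `alg` which contains all null sets. -/
structure LowerDensity where
  alg : MeasurableSpace Ω
  le : alg ≤ m0
  null_mem : ∀ A, μ A = 0 → MeasurableSet[alg] A
  toFun : Set Ω → Set Ω
  ae_eq : ∀ A, MeasurableSet[alg] A → toFun A =ᵐ[μ] A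
  congr : ∀ A B, MeasurableSet[alg] A → MeasurableSet[alg] B → A =ᵐ[μ] B → toFun A = toFun B
  inter : ∀ A B, MeasurableSet[alg] A → MeasurableSet[alg] B →
    toFun (A ∩ B) = toFun A ∩ toFun B
  empty : toFun ∅ = ∅
  univ : toFun Set.univ = Set.univ

namespace LowerDensity

/-- The order by extension. -/
instance : Preorder (LowerDensity μ) where
  le s t := s.alg ≤ t.alg ∧ ∀ A, MeasurableSet[s.alg] A → t.toFun A = s.toFun A
  le_refl s := ⟨le_rfl, fun _ _ => rfl⟩
  le_trans s t r h k := ⟨h.1.trans k.1, fun A hA => (k.2 A (h.1 A hA)).trans (h.2 A hA)⟩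

theorem mono_ae (s : LowerDensity μ) {A B : Set Ω} (hA : MeasurableSet[s.alg] A)
    (hB : MeasurableSet[s.alg] B) (h : A ≤ᵐ[μ] B) : s.toFun A ⊆ s.toFun B := by
  have e : (A ∩ B : Set Ω) =ᵐ[μ] A := by
    filter_upwards [h] with x hx
    exact propext ⟨fun h => h.1, fun h => ⟨h, hx h⟩⟩
  rw [← s.congr _ _ (MeasurableSet.inter hA hB) hA e, s.inter _ _ hA hB]
  exact Set.inter_subset_right

/-- A measurable hull with respect to a sub-σ-algebra. -/
theorem exists_hull {m : MeasurableSpace Ω} (hm : m ≤ m0) [IsFiniteMeasure μ] (S : Set Ω)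
    (hnull : ∀ A, μ A = 0 → MeasurableSet[m] A) :
    ∃ H, MeasurableSet[m] H ∧ S ⊆ H ∧
      ∀ B, MeasurableSet[m] B → μ (B ∩ S) = 0 → μ (B ∩ H) = 0 := by
  refine ⟨@toMeasurable Ω m (μ.trim hm) S, @measurableSet_toMeasurable Ω m (μ.trim hm) S,
    @subset_toMeasurable Ω m (μ.trim hm) S, fun B hB h => ?_⟩
  have h1 := @Measure.measure_toMeasurable_inter_of_sFinite Ω m (μ.trim hm) inferInstance B hB S
  rw [Set.inter_comm] at h1
  -- A null set belongs to `m`, so `μ.trim` agrees with `μ` on it although `S` itself may lie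
  -- outside `m`.
  have h2 : MeasurableSet[m] (S ∩ B) := hnull _ (by rwa [Set.inter_comm])
  rw [trim_measurableSet_eq hm h2, Set.inter_comm S B, h, trim_measurableSet_eq hm] at h1
  · exact h1
  · exact MeasurableSet.inter hB (@measurableSet_toMeasurable Ω m (μ.trim hm) S)

/-- A lower density extends to the σ-algebra with one more set. -/
theorem exists_extension [IsFiniteMeasure μ] (s : LowerDensity μ) {A : Set Ω}
    (hA : MeasurableSet A) : ∃ t : LowerDensity μ, s ≤ t ∧ MeasurableSet[t.alg] A := by
  classical
  obtain ⟨H, hH, hAH, hHull⟩ := exists_hull s.le A s.null_mem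
  obtain ⟨K, hK, hAK, hKull⟩ := exists_hull s.le Aᶜ s.null_mem
  -- `T x` is the side of `A` to be added to the density filter of `x`. It is added only if the
  -- density of its hull contains `x`, which keeps that filter proper at every point; the remaining
  -- points form a null set and get `Set.univ`.
  let T : Ω → Set Ω := fun x => if x ∈ A ∧ x ∈ s.toFun H then A else
    if x ∉ A ∧ x ∈ s.toFun K then Aᶜ else Set.univ
  let φ : Set Ω → Set Ω := fun D =>
    {x | ∃ B, MeasurableSet[s.alg] B ∧ x ∈ s.toFun B ∧ ∀ᵐ y ∂μ, y ∈ B → y ∈ T x → y ∈ D}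
  -- On old sets the enlarged filter says nothing new: if `B ∩ A` lies in `D` up to a null set, the
  -- hull property gives the same for `B ∩ H`, and `x` is in the density of `B ∩ H`.
  have key : ∀ x D B, MeasurableSet[s.alg] D → MeasurableSet[s.alg] B → x ∈ s.toFun B →
      (∀ᵐ y ∂μ, y ∈ B → y ∈ T x → y ∈ D) → x ∈ s.toFun D := by
    intro x D B hD hB hx h
    have gen : ∀ S G : Set Ω, MeasurableSet[s.alg] G →
        (∀ B, MeasurableSet[s.alg] B → μ (B ∩ S) = 0 → μ (B ∩ G) = 0) → x ∈ s.toFun G →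
        (∀ᵐ y ∂μ, y ∈ B → y ∈ S → y ∈ D) → x ∈ s.toFun D := by
      intro S G hG hGull hxG h
      have h1 : μ ((B \ D) ∩ S) = 0 := by
        refine measure_mono_null ?_ h
        intro y h h4
        exact h.1.2 (h4 h.1.1 h.2)
      have h2 := hGull _ (MeasurableSet.inter hB (MeasurableSet.compl hD)) h1
      have h3 : (B ∩ G : Set Ω) ≤ᵐ[μ] D := by
        filter_upwards [measure_eq_zero_iff_ae_notMem.1 h2] with y hy hyB
        by_contra hyD
        exact hy ⟨⟨hyB.1, hyD⟩, hyB.2⟩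
      refine s.mono_ae (MeasurableSet.inter hB hG) hD h3 ?_
      rw [s.inter _ _ hB hG]
      exact ⟨hx, hxG⟩
    by_cases h1 : x ∈ A ∧ x ∈ s.toFun H
    · simp only [T, if_pos h1] at h
      exact gen A H hH hHull h1.2 h
    · by_cases h2 : x ∉ A ∧ x ∈ s.toFun K
      · simp only [T, if_neg h1, if_pos h2] at h
        exact gen Aᶜ K hK hKull h2.2 h
      · simp only [T, if_neg h1, if_neg h2] at h
        exact s.mono_ae hB hD (h.mono fun y hy hyB => hy hyB trivial) hx
  have cons : ∀ D, MeasurableSet[s.alg] D → φ D = s.toFun D := by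
    intro D hD
    refine Set.Subset.antisymm ?_ fun x hx => ⟨D, hD, hx, Eventually.of_forall fun _ h _ => h⟩
    rintro x ⟨B, hB, hx, h⟩
    exact key x D B hD hB hx h
  refine ⟨{ alg := adjoinSet s.alg A
            le := ?_
            null_mem := fun D hD => le_adjoinSet _ _ _ (s.null_mem D hD)
            toFun := φ
            ae_eq := ?_
            congr := ?_
            inter := ?_
            empty := (cons _ (@MeasurableSet.empty Ω s.alg)).trans s.empty
            univ := (cons _ (@MeasurableSet.univ Ω s.alg)).trans s.univ },
    ⟨le_adjoinSet _ _, cons⟩, mem_adjoinSet _ _⟩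
  · rintro D ⟨B, C, hB, hC, h⟩
    have : D = (A ∩ B) ∪ (Aᶜ ∩ C) := by ext x; rw [h]; rfl
    rw [this]
    exact (hA.inter (s.le _ hB)).union (hA.compl.inter (s.le _ hC))
  · rintro D ⟨B, C, hB, hC, h⟩
    -- Almost everywhere the old density is faithful on `H`, `K`, `B` and `C`. As `A ⊆ H` and `Aᶜ ⊆
    -- K`, the third case of `T` does not occur at such points.
    have e1 := fun S (hS : MeasurableSet[s.alg] S) => (s.ae_eq S hS).mem_iff
    filter_upwards [e1 H hH, e1 K hK, e1 B hB, e1 C hC] with x hxH hxK hxB hxC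
    refine propext ?_
    change x ∈ φ D ↔ x ∈ D
    rw [h]
    by_cases hxA : x ∈ A
    · have hT : T x = A := if_pos ⟨hxA, hxH.2 (hAH hxA)⟩
      simp only [hxA, true_and, not_true, false_and, or_false]
      rw [← hxB]
      constructor
      · rintro ⟨B', hB', hx, h'⟩
        refine key x B B' hB hB' hx ?_
        rw [hT] at h' ⊢
        filter_upwards [h'] with y hy h1 h2
        have := (h y).1 (hy h1 h2)
        tauto
      · intro hx
        refine ⟨B, hB, hx, Eventually.of_forall fun y h1 h2 => ?_⟩
        rw [hT] at h2
        exact (h y).2 (Or.inl ⟨h2, h1⟩)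
    · have hT : T x = Aᶜ := by
        simp only [T]
        rw [if_neg (fun h => hxA h.1), if_pos ⟨hxA, hxK.2 (hAK hxA)⟩]
      simp only [hxA, false_and, not_false_eq_true, true_and, false_or]
      rw [← hxC]
      constructor
      · rintro ⟨B', hB', hx, h'⟩
        refine key x C B' hC hB' hx ?_
        rw [hT] at h' ⊢
        filter_upwards [h'] with y hy h1 h2
        have := (h y).1 (hy h1 h2)
        simp only [Set.mem_compl_iff] at h2
        tauto
      · intro hx
        refine ⟨C, hC, hx, Eventually.of_forall fun y h1 h2 => ?_⟩
        rw [hT] at h2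
        exact (h y).2 (Or.inr ⟨h2, h1⟩)
  · intro D D' _ _ hDD
    have : ∀ D D' : Set Ω, D =ᵐ[μ] D' → φ D ⊆ φ D' := by
      rintro D D' hDD x ⟨B, hB, hx, h⟩
      refine ⟨B, hB, hx, ?_⟩
      filter_upwards [h, hDD.mem_iff] with y h1 h2 h3 h4
      exact h2.1 (h1 h3 h4)
    exact Set.Subset.antisymm (this _ _ hDD) (this _ _ hDD.symm)
  · intro D D' _ _
    ext x
    constructor
    · rintro ⟨B, hB, hx, h⟩
      exact ⟨⟨B, hB, hx, h.mono fun y hy h1 h2 => (hy h1 h2).1⟩,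
        ⟨B, hB, hx, h.mono fun y hy h1 h2 => (hy h1 h2).2⟩⟩
    · rintro ⟨⟨B, hB, hx, h⟩, ⟨B', hB', hx', h'⟩⟩
      refine ⟨B ∩ B', MeasurableSet.inter hB hB', ?_, ?_⟩
      · rw [s.inter _ _ hB hB']
        exact ⟨hx, hx'⟩
      · filter_upwards [h, h'] with y h1 h2 h3 h4
        exact ⟨h1 h3.1 h4, h2 h3.2 h4⟩

/-- The trivial lower density on the σ-algebra of null sets and their complements. -/
theorem nonempty_of_ne_zero [IsFiniteMeasure μ] [μ.IsComplete] (h0 : μ ≠ 0) :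
    Nonempty (LowerDensity μ) := by
  classical
  -- Without this a set could be both null and conull, and the density of `∅` would be everything.
  have hne : μ Set.univ ≠ 0 := by rwa [Ne, Measure.measure_univ_eq_zero]
  refine ⟨{ alg :=
            { MeasurableSet' := fun A => μ A = 0 ∨ μ Aᶜ = 0
              measurableSet_empty := Or.inl measure_empty
              measurableSet_compl := fun A hA => by rw [compl_compl]; exact hA.symm
              measurableSet_iUnion := ?_ }
            le := ?_
            null_mem := fun A hA => Or.inl hA
            toFun := fun A => if μ Aᶜ = 0 then Set.univ else ∅
            ae_eq := ?_
            congr := ?_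
            inter := ?_
            empty := by simp [hne]
            univ := by simp }⟩
  · intro f hf
    by_cases h : ∀ n, μ (f n) = 0
    · exact Or.inl (measure_iUnion_null h)
    · push Not at h
      obtain ⟨n, hn⟩ := h
      refine Or.inr (measure_mono_null ?_ ((hf n).resolve_left hn))
      exact Set.compl_subset_compl.2 (Set.subset_iUnion f n)
  · rintro A (hA | hA)
    · exact Measure.IsComplete.out' A hA
    · simpa using (Measure.IsComplete.out' _ hA).compl
  · rintro A (hA | hA)
    · have h : ¬ μ Aᶜ = 0 := fun h => hne (by
        rw [← Set.union_compl_self A]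
        exact measure_union_null hA h)
      rw [if_neg h]
      exact (ae_eq_empty.2 hA).symm
    · rw [if_pos hA]
      exact (ae_eq_univ.2 hA).symm
  · intro A B _ _ h
    simp only [measure_congr h.compl]
  · intro A B _ _
    simp only [Set.compl_inter, measure_union_null_iff]
    by_cases h1 : μ Aᶜ = 0 <;> by_cases h2 : μ Bᶜ = 0 <;> simp [h1, h2]

end LowerDensity

end LowerDensity

/-! ### Upper bounds for chains of lower densities, and Zorn's lemma -/

section LowerDensity

variable {Ω : Type u} [m0 : MeasurableSpace Ω] {μ : Measure Ω}

namespace LowerDensity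

/-- The conditional probability of `A` given the domain of `s`. -/
noncomputable def condProb (s : LowerDensity μ) (A : Set Ω) : Ω → ℝ :=
  μ[A.indicator (fun _ => (1 : ℝ)) | s.alg]

/-- The points at which the conditional probability of `A` exceeds `c`. -/
def superlevel (s : LowerDensity μ) (A : Set Ω) (c : ℝ) : Set Ω := {x | c < s.condProb A x}

theorem measurableSet_superlevel (s : LowerDensity μ) (A : Set Ω) (c : ℝ) :
    MeasurableSet[s.alg] (s.superlevel A c) :=
  stronglyMeasurable_condExp.measurable (measurableSet_Ioi (a := c))

theorem condProb_congr (s : LowerDensity μ) {A B : Set Ω} (h : A =ᵐ[μ] B) :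
    s.condProb A =ᵐ[μ] s.condProb B :=
  condExp_congr_ae (indicator_ae_eq_of_ae_eq_set h)

theorem condProb_eq [IsFiniteMeasure μ] (s : LowerDensity μ) {A : Set Ω}
    (hA : MeasurableSet[s.alg] A) : s.condProb A = A.indicator (fun _ => (1 : ℝ)) := by
  refine condExp_of_stronglyMeasurable s.le ?_ ?_
  · exact (@stronglyMeasurable_const _ _ s.alg _ (1 : ℝ)).indicator hA
  · exact (integrable_const 1).indicator (s.le _ hA)

theorem condProb_mono [IsFiniteMeasure μ] (s : LowerDensity μ) {A B : Set Ω}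
    (hA : MeasurableSet A) (hB : MeasurableSet B) (h : A ⊆ B) :
    s.condProb A ≤ᵐ[μ] s.condProb B := by
  refine condExp_mono ((integrable_const 1).indicator hA) ((integrable_const 1).indicator hB) ?_
  exact Eventually.of_forall fun x =>
    Set.indicator_le_indicator_of_subset h (fun _ => zero_le_one) x

/-- The indicators satisfy the inequality pointwise, and conditional expectation is linear and
monotone. It makes the limit density below multiplicative on intersections. -/
theorem condProb_inter [IsFiniteMeasure μ] (s : LowerDensity μ) {A B : Set Ω}
    (hA : MeasurableSet A) (hB : MeasurableSet B) :
    ∀ᵐ x ∂μ, s.condProb A x + s.condProb B x - 1 ≤ s.condProb (A ∩ B) x := by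
  have iA : Integrable (A.indicator (fun _ => (1 : ℝ))) μ := (integrable_const 1).indicator hA
  have iB : Integrable (B.indicator (fun _ => (1 : ℝ))) μ := (integrable_const 1).indicator hB
  have iAB : Integrable ((A ∩ B).indicator (fun _ => (1 : ℝ))) μ :=
    (integrable_const 1).indicator (hA.inter hB)
  have h1 := condExp_add iA iB s.alg
  have h2 := condExp_sub (iA.add iB) (integrable_const (1 : ℝ)) s.alg
  have h3 := condExp_mono (m := s.alg) ((iA.add iB).sub (integrable_const (1 : ℝ))) iAB
    (Eventually.of_forall fun x => by
      by_cases h1 : x ∈ A <;> by_cases h2 : x ∈ B <;> simp [h1, h2])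
  rw [condExp_const s.le] at h2
  filter_upwards [h1, h2, h3] with x h1 h2 h3
  rw [h2, Pi.sub_apply, h1] at h3
  exact h3

/-- A sequence of extensions of lower densities has an upper bound. -/
theorem exists_upperBound_of_monotone [IsFiniteMeasure μ] (t : ℕ → LowerDensity μ)
    (ht : Monotone t) : ∃ u : LowerDensity μ, ∀ n, t n ≤ u := by
  let ℱ : Filtration ℕ m0 :=
    { seq := fun n => (t n).alg
      mono' := fun i j h => (ht h).1
      le' := fun n => (t n).le }
  have hM : (⨆ n, (t n).alg) ≤ m0 := iSup_le fun n => (t n).le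
  have hMle : ∀ n, (t n).alg ≤ ⨆ n, (t n).alg := fun n => le_iSup (fun n => (t n).alg) n
  -- The levels `c k` increase to `1`. A point has density in `A` if, for every level, it eventually
  -- lies in the density of the set where the conditional probability of `A` exceeds that level.
  -- Applying the old densities to these sets makes the definition exact at each point.
  let c : ℕ → ℝ := fun k => 1 - 1 / ((k : ℝ) + 1)
  let φ : Set Ω → Set Ω := fun A =>
    {x | ∀ k : ℕ, ∃ n, ∀ j ≥ n, x ∈ (t j).toFun ((t j).superlevel A (c k))}
  have hms := fun j A k => (t j).measurableSet_superlevel A (c k)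
  have cons : ∀ n A, MeasurableSet[(t n).alg] A → φ A = (t n).toFun A := by
    intro n A hA
    have h : ∀ j ≥ n, ∀ k, (t j).toFun ((t j).superlevel A (c k)) = (t n).toFun A := by
      intro j hj k
      have hA' : MeasurableSet[(t j).alg] A := (ht hj).1 A hA
      rw [← (ht hj).2 A hA]
      congr 1
      ext x
      have h1 : (0 : ℝ) < 1 / ((k : ℝ) + 1) := by positivity
      have h2 : 1 / ((k : ℝ) + 1) ≤ 1 := by
        rw [div_le_one (by positivity)]
        linarith [(Nat.cast_nonneg k : (0 : ℝ) ≤ k)]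
      simp only [superlevel, condProb_eq _ hA', Set.mem_ofPred_eq, c]
      by_cases hx : x ∈ A
      · simp only [Set.indicator_of_mem hx, hx, iff_true]
        linarith
      · simp only [Set.indicator_of_notMem hx, hx, iff_false]
        linarith
    ext x
    constructor
    · intro hx
      obtain ⟨m, hm⟩ := hx 0
      have := hm (max m n) (le_max_left _ _)
      rwa [h _ (le_max_right _ _)] at this
    · intro hx k
      exact ⟨n, fun j hj => by rwa [h j hj]⟩
  have hmono : ∀ A B, MeasurableSet[⨆ n, (t n).alg] A → MeasurableSet[⨆ n, (t n).alg] B → A ⊆ B → φ A ⊆ φ B := by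
    intro A B hA hB hAB x hx k
    obtain ⟨n, hn⟩ := hx k
    refine ⟨n, fun j hj => (t j).mono_ae (hms j A k) (hms j B k) ?_ (hn j hj)⟩
    filter_upwards [(t j).condProb_mono (hM _ hA) (hM _ hB) hAB] with y hy h
    exact lt_of_lt_of_le h hy
  refine ⟨{ alg := ⨆ n, (t n).alg
            le := hM
            null_mem := fun A hA => hMle 0 A ((t 0).null_mem A hA)
            toFun := φ
            ae_eq := ?_
            congr := ?_
            inter := ?_
            empty := (cons 0 _ (@MeasurableSet.empty Ω (t 0).alg)).trans (t 0).empty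
            univ := (cons 0 _ (@MeasurableSet.univ Ω (t 0).alg)).trans (t 0).univ },
    fun n => ⟨hMle n, cons n⟩⟩
  · intro A hA
    -- Lévy's upward theorem: the conditional probabilities converge almost everywhere to the
    -- indicator of `A`, since `A` belongs to the σ-algebra generated by the domains.
    have hlim := tendsto_ae_condExp (μ := μ) (ℱ := ℱ) (A.indicator (fun _ => (1 : ℝ)))
    have hMA : μ[A.indicator (fun _ => (1 : ℝ)) | ⨆ n, ℱ n] = A.indicator (fun _ => (1 : ℝ)) :=
      condExp_of_stronglyMeasurable hM
        ((@stronglyMeasurable_const _ _ (⨆ n, (t n).alg) _ (1 : ℝ)).indicator hA)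
        ((integrable_const 1).indicator (hM _ hA))
    rw [hMA] at hlim
    have hae : ∀ᵐ x ∂μ, ∀ j k, x ∈ (t j).toFun ((t j).superlevel A (c k)) ↔
        x ∈ (t j).superlevel A (c k) :=
      ae_all_iff.2 fun j => ae_all_iff.2 fun k => ((t j).ae_eq _ (hms j A k)).mem_iff
    filter_upwards [hlim, hae] with x hx hae
    refine propext ?_
    change x ∈ φ A ↔ x ∈ A
    constructor
    · intro h
      by_contra hxA
      rw [Set.indicator_of_notMem hxA] at hx
      -- Level `1` is `c 1 = 1/2`, already incompatible with convergence to `0`.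
      obtain ⟨n, hn⟩ := h 1
      have h1 := hx.eventually (gt_mem_nhds (show (0 : ℝ) < 1 / 2 by norm_num))
      obtain ⟨j, hj1, hj2⟩ := (h1.and (eventually_ge_atTop n)).exists
      have h2 := (hae j 1).1 (hn j hj2)
      change c 1 < (t j).condProb A x at h2
      change (t j).condProb A x < 1 / 2 at hj1
      norm_num [c] at h2
      linarith
    · intro hxA k
      rw [Set.indicator_of_mem hxA] at hx
      have h1 : c k < 1 := by
        have : (0 : ℝ) < 1 / ((k : ℝ) + 1) := by positivity
        simp only [c]
        linarith
      obtain ⟨n, hn⟩ := eventually_atTop.1 (hx.eventually (lt_mem_nhds h1))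
      exact ⟨n, fun j hj => (hae j k).2 (hn j hj)⟩
  · intro A B hA hB h
    have : ∀ j k, (t j).toFun ((t j).superlevel A (c k)) =
        (t j).toFun ((t j).superlevel B (c k)) := by
      intro j k
      refine (t j).congr _ _ (hms j A k) (hms j B k) ?_
      filter_upwards [(t j).condProb_congr h] with x hx
      change (c k < _) = (c k < _)
      rw [hx]
    simp only [φ, this]
  · intro A B hA hB
    refine Set.Subset.antisymm (Set.subset_inter
      (hmono _ _ (MeasurableSet.inter hA hB) hA Set.inter_subset_left)
      (hmono _ _ (MeasurableSet.inter hA hB) hB Set.inter_subset_right)) ?_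
    rintro x ⟨hxA, hxB⟩ k
    -- `1 - c (2k+1)` is half of `1 - c k`, so the two deficits add up to exactly the one allowed
    -- for the intersection.
    obtain ⟨n, hn⟩ := hxA (2 * k + 1)
    obtain ⟨m, hm⟩ := hxB (2 * k + 1)
    refine ⟨max n m, fun j hj => ?_⟩
    have h1 : x ∈ (t j).toFun ((t j).superlevel A (c (2 * k + 1)) ∩
        (t j).superlevel B (c (2 * k + 1))) := by
      rw [(t j).inter _ _ (hms _ _ _) (hms _ _ _)]
      exact ⟨hn j ((le_max_left _ _).trans hj), hm j ((le_max_right _ _).trans hj)⟩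
    refine (t j).mono_ae (MeasurableSet.inter (hms _ _ _) (hms _ _ _)) (hms _ _ _) ?_ h1
    filter_upwards [(t j).condProb_inter (hM _ hA) (hM _ hB)] with y hy h
    have h3 : c (2 * k + 1) < (t j).condProb A y := h.1
    have h4 : c (2 * k + 1) < (t j).condProb B y := h.2
    have h5 : c (2 * k + 1) + c (2 * k + 1) - 1 = c k := by
      simp only [c]
      push_cast
      field_simp
      ring
    change c k < _
    linarith

/-- The union of the domains of a family of lower densities which is directed for countable
subfamilies. -/
@[reducible] def unionAlg (C : Set (LowerDensity μ)) (hne : C.Nonempty)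
    (h : ∀ s : ℕ → LowerDensity μ, (∀ n, s n ∈ C) → ∃ c ∈ C, ∀ n, s n ≤ c) :
    MeasurableSpace Ω where
  MeasurableSet' A := ∃ c ∈ C, MeasurableSet[c.alg] A
  measurableSet_empty := ⟨hne.some, hne.some_mem, @MeasurableSet.empty Ω hne.some.alg⟩
  measurableSet_compl := fun A ⟨c, hc, hA⟩ => ⟨c, hc, hA.compl⟩
  measurableSet_iUnion := by
    intro f hf
    choose s hs hfs using hf
    obtain ⟨c, hc, hsc⟩ := h s hs
    exact ⟨c, hc, MeasurableSet.iUnion fun n => (hsc n).1 _ (hfs n)⟩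

/-- A chain of lower densities without countable cofinal subset has an upper bound. -/
theorem exists_upperBound_of_forall_countable {C : Set (LowerDensity μ)} (hC : IsChain (· ≤ ·) C)
    (hne : C.Nonempty)
    (h : ∀ s : ℕ → LowerDensity μ, (∀ n, s n ∈ C) → ∃ c ∈ C, ∀ n, s n ≤ c) :
    BddAbove C := by
  classical
  obtain ⟨c0, hc0⟩ := id hne
  let φ : Set Ω → Set Ω := fun A =>
    if h : ∃ c ∈ C, MeasurableSet[c.alg] A then h.choose.toFun A else ∅
  have cons : ∀ c ∈ C, ∀ A, MeasurableSet[c.alg] A → φ A = c.toFun A := by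
    intro c hc A hA
    have h : ∃ c ∈ C, MeasurableSet[c.alg] A := ⟨c, hc, hA⟩
    have e : φ A = h.choose.toFun A := dif_pos h
    rw [e]
    rcases hC.total h.choose_spec.1 hc with h1 | h1
    · exact (h1.2 A h.choose_spec.2).symm
    · exact h1.2 A hA
  have pair : ∀ A B, MeasurableSet[unionAlg C hne h] A → MeasurableSet[unionAlg C hne h] B →
      ∃ c ∈ C, MeasurableSet[c.alg] A ∧ MeasurableSet[c.alg] B := by
    rintro A B ⟨c, hc, hA⟩ ⟨d, hd, hB⟩
    rcases hC.total hc hd with h1 | h1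
    · exact ⟨d, hd, h1.1 _ hA, hB⟩
    · exact ⟨c, hc, hA, h1.1 _ hB⟩
  refine ⟨{ alg := unionAlg C hne h
            le := fun A ⟨c, _, hA⟩ => c.le A hA
            null_mem := fun A hA => ⟨c0, hc0, c0.null_mem A hA⟩
            toFun := φ
            ae_eq := ?_
            congr := ?_
            inter := ?_
            empty := (cons c0 hc0 _ (@MeasurableSet.empty Ω c0.alg)).trans c0.empty
            univ := (cons c0 hc0 _ (@MeasurableSet.univ Ω c0.alg)).trans c0.univ },
    fun c hc => ⟨fun A hA => ⟨c, hc, hA⟩, cons c hc⟩⟩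
  · rintro A ⟨c, hc, hA⟩
    rw [cons c hc A hA]
    exact c.ae_eq A hA
  · intro A B hA hB hAB
    obtain ⟨c, hc, h1, h2⟩ := pair A B hA hB
    rw [cons c hc A h1, cons c hc B h2]
    exact c.congr A B h1 h2 hAB
  · intro A B hA hB
    obtain ⟨c, hc, h1, h2⟩ := pair A B hA hB
    rw [cons c hc A h1, cons c hc B h2, cons c hc _ (MeasurableSet.inter h1 h2)]
    exact c.inter A B h1 h2

/-- Either every sequence in the chain is bounded within it, so that the union of the domains is a
σ-algebra, or some sequence is cofinal and the martingale argument applies. -/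
theorem bddAbove_of_isChain [IsFiniteMeasure μ] {C : Set (LowerDensity μ)}
    (hC : IsChain (· ≤ ·) C) (hne : C.Nonempty) : BddAbove C := by
  classical
  by_cases h : ∀ s : ℕ → LowerDensity μ, (∀ n, s n ∈ C) → ∃ c ∈ C, ∀ n, s n ≤ c
  · exact exists_upperBound_of_forall_countable hC hne h
  · push Not at h
    obtain ⟨s, hs, hcof⟩ := h
    have hstep : ∀ a ∈ C, ∀ b ∈ C, ∃ d ∈ C, a ≤ d ∧ b ≤ d := by
      intro a ha b hb
      rcases hC.total ha hb with h | h
      · exact ⟨b, hb, h, le_rfl⟩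
      · exact ⟨a, ha, le_rfl, h⟩
    choose! g hg hga hgb using hstep
    -- Running upper bounds turn the cofinal sequence into a monotone one.
    let t : ℕ → LowerDensity μ := fun n => Nat.rec (s 0) (fun k a => g a (s (k + 1))) n
    have htC : ∀ n, t n ∈ C := by
      intro n
      induction n with
      | zero => exact hs 0
      | succ k ih => exact hg _ ih _ (hs (k + 1))
    have hmono : Monotone t := monotone_nat_of_le_succ fun n => hga _ (htC n) _ (hs (n + 1))
    have hst : ∀ n, s n ≤ t n := by
      intro n
      cases n with
      | zero => exact le_rfl
      | succ k => exact hgb _ (htC k) _ (hs (k + 1))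
    obtain ⟨u, hu⟩ := exists_upperBound_of_monotone t hmono
    refine ⟨u, fun c hc => ?_⟩
    obtain ⟨n, hn⟩ := hcof c hc
    exact ((hC.total hc (hs n)).resolve_right hn).trans ((hst n).trans (hu n))

/-- On a complete finite measure space there is a lower density for all measurable sets. -/
theorem exists_alg_eq [IsFiniteMeasure μ] [μ.IsComplete] (h0 : μ ≠ 0) :
    ∃ s : LowerDensity μ, s.alg = m0 := by
  have := nonempty_of_ne_zero h0
  obtain ⟨s, hs⟩ := zorn_le_nonempty (α := LowerDensity μ) fun C hC hne =>
    bddAbove_of_isChain hC hne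
  refine ⟨s, le_antisymm s.le fun A hA => ?_⟩
  obtain ⟨t, hst, htA⟩ := s.exists_extension hA
  exact (hs hst).1 A htA

end LowerDensity

end LowerDensity

/-! ## Existence of a lifting -/

section Lifting

variable {Ω : Type u} [m0 : MeasurableSpace Ω] {μ : Measure Ω}

/-- On a complete finite measure space, ultrafilters can be chosen at all points so that every
measurable set belongs to the ultrafilters of almost all of its points. -/
theorem exists_ultrafilter [IsFiniteMeasure μ] [μ.IsComplete] (h0 : μ ≠ 0) :
    ∃ 𝒰 : Ω → Ultrafilter Ω, (∀ ω, (𝒰 ω : Filter Ω) ≤ ae μ) ∧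
      ∀ B, MeasurableSet B → ∀ᵐ ω ∂μ, ω ∈ B → B ∈ 𝒰 ω := by
  obtain ⟨s, hs⟩ := LowerDensity.exists_alg_eq h0
  have hm : ∀ B, MeasurableSet B → MeasurableSet[s.alg] B := fun B hB => by rwa [hs]
  -- The density filter of `ω`, saturated by null sets. It is proper because the density of a null
  -- set is empty.
  let F : Ω → Filter Ω := fun ω =>
    { sets := {S | ∃ B, MeasurableSet B ∧ ω ∈ s.toFun B ∧ B ≤ᵐ[μ] S}
      univ_sets := ⟨Set.univ, MeasurableSet.univ, by rw [s.univ]; trivial,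
        Eventually.of_forall fun _ _ => trivial⟩
      sets_of_superset := fun ⟨B, hB, hx, h⟩ hST =>
        ⟨B, hB, hx, h.mono fun y hy hyB => hST (hy hyB)⟩
      inter_sets := by
        rintro S T ⟨B, hB, hx, h⟩ ⟨B', hB', hx', h'⟩
        refine ⟨B ∩ B', hB.inter hB', ?_, ?_⟩
        · rw [s.inter _ _ (hm _ hB) (hm _ hB')]
          exact ⟨hx, hx'⟩
        · filter_upwards [h, h'] with y h1 h2 h3
          exact ⟨h1 h3.1, h2 h3.2⟩ }
  have hF : ∀ ω, (F ω).NeBot := by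
    intro ω
    refine ⟨fun h => ?_⟩
    have h1 : ∅ ∈ F ω := by rw [h]; trivial
    obtain ⟨B, hB, hx, h2⟩ := h1
    have h3 := s.mono_ae (hm _ hB) (hm _ MeasurableSet.empty) h2 hx
    rw [s.empty] at h3
    exact h3
  refine ⟨fun ω => Ultrafilter.of (F ω), fun ω => (Ultrafilter.of_le (F ω)).trans ?_, ?_⟩
  · intro S hS
    exact ⟨Set.univ, MeasurableSet.univ, by rw [s.univ]; trivial,
      Eventually.mono hS fun y hy _ => hy⟩
  · intro B hB
    filter_upwards [(s.ae_eq B (hm B hB)).mem_iff] with ω h hω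
    exact Ultrafilter.of_le (F ω) ⟨B, hB, h.2 hω, EventuallyLE.refl _ _⟩

/-- **The lifting theorem.** A nonzero complete finite measure has a lifting. -/
theorem nonempty_lifting [IsFiniteMeasure μ] [μ.IsComplete] (h0 : μ ≠ 0) :
    Nonempty (Lifting μ) := by
  obtain ⟨𝒰, h𝒰, hB⟩ := exists_ultrafilter h0
  have hlim : ∀ (f : Linf μ) ω, ∃ z, Tendsto (f : Ω →ₘ[μ] ℂ) (𝒰 ω) (𝓝 z) := by
    rintro ⟨f, C, hC⟩ ω
    -- An essentially bounded function has a limit along an ultrafilter finer than `ae μ`, by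
    -- compactness of the ball. Algebraic identities then pass to the limit at every point.
    obtain ⟨z, -, hz⟩ := (isCompact_closedBall (0 : ℂ) C).ultrafilter_le_nhds ((𝒰 ω).map f) (by
      rw [le_principal_iff]
      refine h𝒰 ω (hC.mono fun x hx => ?_)
      simpa using hx)
    exact ⟨z, hz⟩
  choose L hL using hlim
  have huniq : ∀ (f : Linf μ) ω z, Tendsto (f : Ω →ₘ[μ] ℂ) (𝒰 ω) (𝓝 z) → L f ω = z :=
    fun f ω z h => tendsto_nhds_unique (hL f ω) h
  have hae : ∀ f : Linf μ, L f =ᵐ[μ] (f : Ω →ₘ[μ] ℂ) := by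
    intro f
    -- Countably many preimages of small balls suffice. Off one null set, each of them that contains
    -- `ω` belongs to the ultrafilter of `ω`, so the limit and the value of `f` lie in a common
    -- small ball.
    let B : ℕ → ℕ → Set Ω := fun i n =>
      (f : Ω →ₘ[μ] ℂ) ⁻¹' Metric.closedBall (TopologicalSpace.denseSeq ℂ i) (1 / ((n : ℝ) + 1))
    have hmB : ∀ i n, MeasurableSet (B i n) := fun i n =>
      (f : Ω →ₘ[μ] ℂ).measurable Metric.isClosed_closedBall.measurableSet
    have hae : ∀ᵐ ω ∂μ, ∀ i n, ω ∈ B i n → B i n ∈ 𝒰 ω :=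
      ae_all_iff.2 fun i => ae_all_iff.2 fun n => hB _ (hmB i n)
    filter_upwards [hae] with ω hω
    refine eq_of_forall_dist_le fun ε hε => ?_
    obtain ⟨n, hn⟩ := exists_nat_one_div_lt (half_pos hε)
    obtain ⟨i, hi⟩ := (TopologicalSpace.denseRange_denseSeq ℂ).exists_dist_lt
      ((f : Ω →ₘ[μ] ℂ) ω) (show (0 : ℝ) < 1 / ((n : ℝ) + 1) by positivity)
    have h1 : B i n ∈ 𝒰 ω := hω i n hi.le
    have h2 := Metric.isClosed_closedBall.mem_of_tendsto (hL f ω)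
      (show ∀ᶠ x in (𝒰 ω : Filter Ω), (f : Ω →ₘ[μ] ℂ) x ∈
        Metric.closedBall (TopologicalSpace.denseSeq ℂ i) (1 / ((n : ℝ) + 1)) from h1)
    rw [Metric.mem_closedBall] at h2
    have h3 := dist_triangle_right (L f ω) ((f : Ω →ₘ[μ] ℂ) ω) (TopologicalSpace.denseSeq ℂ i)
    linarith
  have hmul : ∀ f g : Linf μ, L (f * g) = L f * L g := fun f g => funext fun ω =>
    huniq _ _ _ (((hL f ω).mul (hL g ω)).congr'
      (h𝒰 ω (AEEqFun.coeFn_mul (f : Ω →ₘ[μ] ℂ) g).symm))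
  have hadd : ∀ f g : Linf μ, L (f + g) = L f + L g := fun f g => funext fun ω =>
    huniq _ _ _ (((hL f ω).add (hL g ω)).congr'
      (h𝒰 ω (AEEqFun.coeFn_add (f : Ω →ₘ[μ] ℂ) g).symm))
  have hsmul : ∀ (c : ℂ) (f : Linf μ), L (c • f) = c • L f := fun c f => funext fun ω =>
    huniq _ _ _ (((hL f ω).const_smul c).congr'
      (h𝒰 ω (AEEqFun.coeFn_smul c (f : Ω →ₘ[μ] ℂ)).symm))
  have hone : L 1 = 1 := funext fun ω =>
    huniq _ _ _ ((tendsto_const_nhds (x := (1 : ℂ))).congr'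
      (h𝒰 ω (AEEqFun.coeFn_one (μ := μ) (β := ℂ)).symm))
  refine ⟨⟨AlgHom.ofLinearMap ⟨⟨L, hadd⟩, hsmul⟩ hone hmul, fun f => ?_, ?_, hae⟩⟩
  -- Completeness of `μ` enters: a function equal almost everywhere to a measurable one is
  -- measurable.
  · exact aemeasurable_iff_measurable.1 ((f : Ω →ₘ[μ] ℂ).aemeasurable.congr (hae f).symm)
  · rintro ⟨f, C, hC⟩
    refine ⟨C, fun ω => le_of_tendsto (hL _ ω).norm (h𝒰 ω hC)⟩

end Lifting

/-! ## Scalars -/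

section Scalars

variable {Ω : Type u} [MeasurableSpace Ω] {μ : Measure Ω}

theorem coeFn_ofRealL (f : Ω →ₘ[μ] ℝ) : ofRealL f =ᵐ[μ] fun ω => (f ω : ℂ) :=
  AEEqFun.coeFn_comp _ _ _

theorem coeFn_absL (f : Ω →ₘ[μ] ℂ) : absL f =ᵐ[μ] fun ω => ‖f ω‖ :=
  AEEqFun.coeFn_comp _ _ _

theorem ofRealL_mem_Linf {f : Ω →ₘ[μ] ℝ} :
    ofRealL f ∈ Linf μ ↔ ∃ C : ℝ, ∀ᵐ ω ∂μ, |f ω| ≤ C := by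
  refine exists_congr fun C => eventually_congr ?_
  filter_upwards [coeFn_ofRealL f] with ω h
  rw [h, Complex.norm_real, Real.norm_eq_abs]

theorem IsFaithfulSolid.mem_of_ae_le {E : Subalgebra ℂ (Ω →ₘ[μ] ℂ)} (hE : IsFaithfulSolid E)
    {f g : Ω →ₘ[μ] ℂ} (hg : g ∈ E) (h : ∀ᵐ ω ∂μ, ‖f ω‖ ≤ ‖g ω‖) : f ∈ E := by
  refine hE.solid f g hg (AEEqFun.coeFn_le.1 ?_)
  filter_upwards [h, coeFn_absL f, coeFn_absL g] with ω h h1 h2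
  rwa [h1, h2]

theorem IsFaithfulSolid.Linf_le {E : Subalgebra ℂ (Ω →ₘ[μ] ℂ)} (hE : IsFaithfulSolid E) :
    Linf μ ≤ E := by
  rintro f ⟨C, hC⟩
  refine hE.mem_of_ae_le (E.algebraMap_mem (C : ℂ)) ?_
  rw [Algebra.algebraMap_eq_smul_one]
  filter_upwards [hC, AEEqFun.coeFn_smul (C : ℂ) (1 : Ω →ₘ[μ] ℂ),
    AEEqFun.coeFn_one (μ := μ) (β := ℂ)] with ω h h1 h2
  rw [h1, Pi.smul_apply, h2]
  simpa using h.trans (le_abs_self C)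

/-- The class of a bounded measurable function. -/
noncomputable def mkLinf (f : Ω → ℂ) (hf : AEMeasurable f μ) (C : ℝ) (h : ∀ ω, ‖f ω‖ ≤ C) :
    Linf μ :=
  ⟨AEEqFun.mk f hf.aestronglyMeasurable, C, by
    filter_upwards [AEEqFun.coeFn_mk f hf.aestronglyMeasurable] with ω hω
    rw [hω]
    exact h ω⟩

theorem coeFn_mkLinf (f : Ω → ℂ) (hf : AEMeasurable f μ) (C : ℝ) (h : ∀ ω, ‖f ω‖ ≤ C) :
    (mkLinf f hf C h : Ω →ₘ[μ] ℂ) =ᵐ[μ] f :=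
  AEEqFun.coeFn_mk f hf.aestronglyMeasurable

theorem coeFn_Linf_mul (f g : Linf μ) :
    ((f * g : Linf μ) : Ω →ₘ[μ] ℂ) =ᵐ[μ] fun ω => (f : Ω →ₘ[μ] ℂ) ω * (g : Ω →ₘ[μ] ℂ) ω :=
  AEEqFun.coeFn_mul (f : Ω →ₘ[μ] ℂ) g

theorem coeFn_Linf_add (f g : Linf μ) :
    ((f + g : Linf μ) : Ω →ₘ[μ] ℂ) =ᵐ[μ] fun ω => (f : Ω →ₘ[μ] ℂ) ω + (g : Ω →ₘ[μ] ℂ) ω :=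
  AEEqFun.coeFn_add (f : Ω →ₘ[μ] ℂ) g

theorem coeFn_Linf_sub (f g : Linf μ) :
    ((f - g : Linf μ) : Ω →ₘ[μ] ℂ) =ᵐ[μ] fun ω => (f : Ω →ₘ[μ] ℂ) ω - (g : Ω →ₘ[μ] ℂ) ω :=
  AEEqFun.coeFn_sub (f : Ω →ₘ[μ] ℂ) g

theorem coeFn_Linf_one : ((1 : Linf μ) : Ω →ₘ[μ] ℂ) =ᵐ[μ] fun _ => 1 :=
  AEEqFun.coeFn_one (μ := μ) (β := ℂ)

theorem coeFn_Linf_algebraMap (c : ℂ) :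
    ((algebraMap ℂ (Linf μ) c : Linf μ) : Ω →ₘ[μ] ℂ) =ᵐ[μ] fun _ => c := by
  have : ((algebraMap ℂ (Linf μ) c : Linf μ) : Ω →ₘ[μ] ℂ) = c • (1 : Ω →ₘ[μ] ℂ) :=
    Algebra.algebraMap_eq_smul_one c
  rw [this]
  filter_upwards [AEEqFun.coeFn_smul c (1 : Ω →ₘ[μ] ℂ),
    AEEqFun.coeFn_one (μ := μ) (β := ℂ)] with ω h1 h2
  rw [h1, Pi.smul_apply, h2]
  simp

theorem Linf_ext {f g : Linf μ} (h : (f : Ω →ₘ[μ] ℂ) =ᵐ[μ] (g : Ω →ₘ[μ] ℂ)) : f = g :=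
  Subtype.ext (AEEqFun.ext h)

/-- The class `1 / (1 + |h|)`. -/
noncomputable def damp (h : Ω →ₘ[μ] ℝ) : Linf μ :=
  mkLinf (fun ω => (((1 + |h ω|)⁻¹ : ℝ) : ℂ))
    (Complex.measurable_ofReal.comp_aemeasurable
      (h.aemeasurable.norm.const_add (1 : ℝ)).inv) 1 (by
      intro ω
      rw [Complex.norm_real, Real.norm_eq_abs, abs_inv]
      refine inv_le_one_of_one_le₀ ?_
      rw [abs_of_nonneg (by positivity)]
      linarith [abs_nonneg (h ω)])

theorem coeFn_damp (h : Ω →ₘ[μ] ℝ) :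
    (damp h : Ω →ₘ[μ] ℂ) =ᵐ[μ] fun ω => (((1 + |h ω|)⁻¹ : ℝ) : ℂ) :=
  coeFn_mkLinf _ _ _ _

theorem damp_ne_zero (h : Ω →ₘ[μ] ℝ) : ∀ᵐ ω ∂μ, (damp h : Ω →ₘ[μ] ℂ) ω ≠ 0 := by
  filter_upwards [coeFn_damp h] with ω hω
  rw [hω, Complex.ofReal_ne_zero]
  positivity

open Classical in
/-- The class of the indicator function of a measurable set. -/
noncomputable def ind (A : Set Ω) (hA : MeasurableSet A) : Linf μ :=
  mkLinf (fun ω => if ω ∈ A then 1 else 0)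
    (Measurable.ite hA measurable_const measurable_const).aemeasurable 1
    (fun ω => by split_ifs <;> simp)

open Classical in
theorem coeFn_ind (A : Set Ω) (hA : MeasurableSet A) :
    (ind A hA : Linf μ) =ᵐ[μ] fun ω => if ω ∈ A then (1 : ℂ) else 0 :=
  coeFn_mkLinf _ _ _ _

/-! ## Properties of liftings -/

namespace Lifting

variable (p : Lifting μ)

/-- The values of a lifting belong to the essential range. -/
theorem mem_of_ae_mem {K : Set ℂ} (hK : IsClosed K) (f : Linf μ)
    (h : ∀ᵐ ω ∂μ, (f : Ω →ₘ[μ] ℂ) ω ∈ K) (ω : Ω) : p.toHom f ω ∈ K := by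
  classical
  by_contra hz
  set z := p.toHom f ω with hzdef
  obtain ⟨ε, hε, hball⟩ := Metric.isOpen_iff.1 hK.isOpen_compl z hz
  have hdist : ∀ y ∈ K, ε ≤ ‖y - z‖ := by
    intro y hy
    by_contra hlt
    exact hball (by rw [Metric.mem_ball, dist_eq_norm]; linarith) hy
  -- If `z = p(f)(ω)` had distance at least `ε` from `K`, then `f - z` would be invertible in `L^∞`
  -- with inverse bounded by `1/ε`. A unital homomorphism cannot send an invertible element to `0`
  -- at `ω`.
  let g : Linf μ := mkLinf
    (fun x => if (f : Ω →ₘ[μ] ℂ) x ∈ K then ((f : Ω →ₘ[μ] ℂ) x - z)⁻¹ else 0)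
    (Measurable.ite ((f : Ω →ₘ[μ] ℂ).measurable hK.measurableSet)
      ((f : Ω →ₘ[μ] ℂ).measurable.sub_const z).inv measurable_const).aemeasurable ε⁻¹ (by
      intro x
      split_ifs with hx
      · rw [norm_inv]
        exact inv_anti₀ hε (hdist _ hx)
      · simpa using hε.le)
  have hg : g * (f - algebraMap ℂ (Linf μ) z) = 1 := by
    refine Linf_ext ?_
    filter_upwards [coeFn_Linf_mul g (f - algebraMap ℂ (Linf μ) z),
      coeFn_Linf_sub f (algebraMap ℂ (Linf μ) z), coeFn_Linf_algebraMap (μ := μ) z,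
      coeFn_Linf_one (μ := μ), coeFn_mkLinf (μ := μ) _ _ _ _, h] with x h1 h2 h3 h4 h5 h6
    rw [h1, h2, h3, h4]
    change (g : Ω →ₘ[μ] ℂ) x = _ at h5
    rw [h5, if_pos h6]
    refine inv_mul_cancel₀ fun h0 => ?_
    have := hdist _ h6
    rw [h0, norm_zero] at this
    linarith
  have h1 := congrFun (congrArg p.toHom hg) ω
  rw [map_mul, map_sub, map_one, AlgHom.commutes] at h1
  simp [← hzdef] at h1

/-- The lifting of a bounded real function. -/
noncomputable def re (f : Ω →ₘ[μ] ℝ) (ω : Ω) : ℝ :=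
  open Classical in if h : ofRealL f ∈ Linf μ then (p.toHom ⟨ofRealL f, h⟩ ω).re else 0

theorem ofReal_re {f : Ω →ₘ[μ] ℝ} (h : ofRealL f ∈ Linf μ) (ω : Ω) :
    (p.re f ω : ℂ) = p.toHom ⟨ofRealL f, h⟩ ω := by
  have h1 := p.mem_of_ae_mem (K := {z | z.im = 0})
    (isClosed_eq Complex.continuous_im continuous_const) ⟨ofRealL f, h⟩ (by
      filter_upwards [coeFn_ofRealL f] with x hx
      rw [hx, Complex.ofReal_im]) ω
  rw [re, dif_pos h]
  exact Complex.ext rfl h1.symm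

/-- The lifting of a function which is almost everywhere real. -/
theorem re_eq {f : Ω →ₘ[μ] ℝ} {g : Linf μ} (h : ∀ᵐ x ∂μ, (g : Ω →ₘ[μ] ℂ) x = (f x : ℂ)) (ω : Ω) :
    p.toHom g ω = (p.re f ω : ℂ) := by
  have e : (g : Ω →ₘ[μ] ℂ) = ofRealL f := by
    refine AEEqFun.ext ?_
    filter_upwards [h, coeFn_ofRealL f] with x h1 h2
    rw [h1, h2]
  have h' : ofRealL f ∈ Linf μ := e ▸ g.2
  rw [p.ofReal_re h', show g = ⟨ofRealL f, h'⟩ from Subtype.ext e]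

theorem re_ae_eq {f : Ω →ₘ[μ] ℝ} (h : ofRealL f ∈ Linf μ) : p.re f =ᵐ[μ] f := by
  filter_upwards [p.ae_eq ⟨ofRealL f, h⟩, coeFn_ofRealL f] with ω h1 h2
  rw [← p.ofReal_re h] at h1
  have h3 := h1.trans h2
  exact_mod_cast h3

theorem measurable_re (f : Ω →ₘ[μ] ℝ) : Measurable (p.re f) := by
  by_cases h : ofRealL f ∈ Linf μ
  · have e : p.re f = fun ω => (p.toHom ⟨ofRealL f, h⟩ ω).re := by
      funext ω
      rw [re, dif_pos h]
    rw [e]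
    exact Complex.measurable_re.comp (p.measurable _)
  · have e : p.re f = fun _ => 0 := by
      funext ω
      rw [re, dif_neg h]
    rw [e]
    exact measurable_const

theorem re_le {f : Ω →ₘ[μ] ℝ} (hf : ofRealL f ∈ Linf μ) {C : ℝ} (h : ∀ᵐ x ∂μ, f x ≤ C) (ω : Ω) :
    p.re f ω ≤ C := by
  have h1 := p.mem_of_ae_mem (K := {z | z.re ≤ C})
    (isClosed_le Complex.continuous_re continuous_const) ⟨ofRealL f, hf⟩ (by
      filter_upwards [coeFn_ofRealL f, h] with x hx h
      rwa [hx, Complex.ofReal_re]) ω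
  rw [← p.ofReal_re hf] at h1
  exact h1

theorem le_re {f : Ω →ₘ[μ] ℝ} (hf : ofRealL f ∈ Linf μ) {C : ℝ} (h : ∀ᵐ x ∂μ, C ≤ f x) (ω : Ω) :
    C ≤ p.re f ω := by
  have h1 := p.mem_of_ae_mem (K := {z | C ≤ z.re})
    (isClosed_le continuous_const Complex.continuous_re) ⟨ofRealL f, hf⟩ (by
      filter_upwards [coeFn_ofRealL f, h] with x hx h
      rwa [hx, Complex.ofReal_re]) ω
  rw [← p.ofReal_re hf] at h1
  exact h1

theorem re_add_of_ae {f g h : Ω →ₘ[μ] ℝ} (hf : ofRealL f ∈ Linf μ) (hg : ofRealL g ∈ Linf μ)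
    (e : ∀ᵐ x ∂μ, h x = f x + g x) (ω : Ω) : p.re h ω = p.re f ω + p.re g ω := by
  have h1 := p.re_eq (f := h) (g := ⟨ofRealL f, hf⟩ + ⟨ofRealL g, hg⟩) (by
    filter_upwards [e, coeFn_ofRealL f, coeFn_ofRealL g,
      coeFn_Linf_add (⟨ofRealL f, hf⟩ : Linf μ) ⟨ofRealL g, hg⟩] with x h1 h2 h3 h4
    rw [h4, h1, h2, h3, Complex.ofReal_add]) ω
  rw [map_add, Pi.add_apply, ← p.ofReal_re hf, ← p.ofReal_re hg] at h1
  exact_mod_cast h1.symm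

theorem re_mul_of_ae {f g h : Ω →ₘ[μ] ℝ} (hf : ofRealL f ∈ Linf μ) (hg : ofRealL g ∈ Linf μ)
    (e : ∀ᵐ x ∂μ, h x = f x * g x) (ω : Ω) : p.re h ω = p.re f ω * p.re g ω := by
  have h1 := p.re_eq (f := h) (g := ⟨ofRealL f, hf⟩ * ⟨ofRealL g, hg⟩) (by
    filter_upwards [e, coeFn_ofRealL f, coeFn_ofRealL g,
      coeFn_Linf_mul (⟨ofRealL f, hf⟩ : Linf μ) ⟨ofRealL g, hg⟩] with x h1 h2 h3 h4
    rw [h4, h1, h2, h3, Complex.ofReal_mul]) ω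
  rw [map_mul, Pi.mul_apply, ← p.ofReal_re hf, ← p.ofReal_re hg] at h1
  exact_mod_cast h1.symm

theorem re_mono {f g : Ω →ₘ[μ] ℝ} (hf : ofRealL f ∈ Linf μ) (hg : ofRealL g ∈ Linf μ)
    (h : ∀ᵐ x ∂μ, f x ≤ g x) (ω : Ω) : p.re f ω ≤ p.re g ω := by
  have hd : ofRealL (g - f) ∈ Linf μ := by
    obtain ⟨C, hC⟩ := ofRealL_mem_Linf.1 hf
    obtain ⟨D, hD⟩ := ofRealL_mem_Linf.1 hg
    refine ofRealL_mem_Linf.2 ⟨D + C, ?_⟩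
    filter_upwards [hC, hD, AEEqFun.coeFn_sub g f] with x h1 h2 h3
    rw [h3, Pi.sub_apply]
    exact (abs_sub _ _).trans (add_le_add h2 h1)
  have h1 := p.re_add_of_ae (h := g) hf hd (by
    filter_upwards [AEEqFun.coeFn_sub g f] with x hx
    rw [hx, Pi.sub_apply]
    ring) ω
  have h2 := p.le_re hd (C := 0) (by
    filter_upwards [AEEqFun.coeFn_sub g f, h] with x hx h
    rw [hx, Pi.sub_apply]
    linarith) ω
  linarith

theorem re_const_of_ae {f : Ω →ₘ[μ] ℝ} {c : ℝ} (h : ∀ᵐ x ∂μ, f x = c) (ω : Ω) :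
    p.re f ω = c := by
  have h1 := p.re_eq (f := f) (g := algebraMap ℂ (Linf μ) c) (by
    filter_upwards [h, coeFn_Linf_algebraMap (μ := μ) c] with x h1 h2
    rw [h1, h2]) ω
  rw [AlgHom.commutes, Pi.algebraMap_apply, Algebra.algebraMap_self, RingHom.id_apply] at h1
  exact_mod_cast h1.symm

theorem absL_mem (f : Linf μ) : ofRealL (absL (f : Ω →ₘ[μ] ℂ)) ∈ Linf μ := by
  obtain ⟨C, hC⟩ := f.2
  refine ofRealL_mem_Linf.2 ⟨C, ?_⟩
  filter_upwards [hC, coeFn_absL (f : Ω →ₘ[μ] ℂ)] with x h1 h2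
  rwa [h2, abs_norm]

/-- A lifting commutes with the modulus. -/
theorem re_absL (f : Linf μ) (ω : Ω) : p.re (absL (f : Ω →ₘ[μ] ℂ)) ω = ‖p.toHom f ω‖ := by
  set F : Ω →ₘ[μ] ℂ := (f : Ω →ₘ[μ] ℂ) with hF
  obtain ⟨C, hC⟩ := f.2
  have hb : ∀ g : ℂ →L[ℝ] ℝ, ‖g‖ ≤ 1 → ofRealL (AEEqFun.comp g g.continuous F) ∈ Linf μ := by
    intro g hg
    refine ofRealL_mem_Linf.2 ⟨C, ?_⟩
    filter_upwards [hC, AEEqFun.coeFn_comp g g.continuous F] with x h1 h2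
    rw [h2, Function.comp, ← Real.norm_eq_abs]
    refine (g.le_of_opNorm_le hg _).trans ?_
    rwa [one_mul]
  have hr := hb Complex.reCLM (by simp)
  have hi := hb Complex.imCLM (by simp)
  set R := AEEqFun.comp Complex.reCLM Complex.reCLM.continuous F
  set I := AEEqFun.comp Complex.imCLM Complex.imCLM.continuous F
  have hR : ∀ᵐ x ∂μ, R x = (F x).re := AEEqFun.coeFn_comp _ Complex.reCLM.continuous F
  have hI : ∀ᵐ x ∂μ, I x = (F x).im := AEEqFun.coeFn_comp _ Complex.imCLM.continuous F
  have e : f = ⟨ofRealL R, hr⟩ + algebraMap ℂ (Linf μ) Complex.I * ⟨ofRealL I, hi⟩ := by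
    refine Linf_ext ?_
    filter_upwards [hR, hI, coeFn_ofRealL R, coeFn_ofRealL I,
      coeFn_Linf_add (⟨ofRealL R, hr⟩ : Linf μ) (algebraMap ℂ (Linf μ) Complex.I * ⟨ofRealL I, hi⟩),
      coeFn_Linf_mul (algebraMap ℂ (Linf μ) Complex.I) ⟨ofRealL I, hi⟩,
      coeFn_Linf_algebraMap (μ := μ) Complex.I] with x h1 h2 h3 h4 h5 h6 h7
    rw [h5, h6, h7, h3, h4, h1, h2, mul_comm]
    exact (Complex.re_add_im _).symm
  have h1 : p.toHom f ω = (p.re R ω : ℂ) + Complex.I * p.re I ω := by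
    conv_lhs => rw [e]
    rw [map_add, map_mul, AlgHom.commutes, Pi.add_apply, Pi.mul_apply, ← p.ofReal_re hr,
      ← p.ofReal_re hi]
    rfl
  have hsqR : ofRealL (R * R) ∈ Linf μ := by
    convert (⟨ofRealL R, hr⟩ * ⟨ofRealL R, hr⟩ : Linf μ).2 using 1
    refine AEEqFun.ext ?_
    filter_upwards [coeFn_ofRealL (R * R), coeFn_ofRealL R, AEEqFun.coeFn_mul R R,
      coeFn_Linf_mul (⟨ofRealL R, hr⟩ : Linf μ) ⟨ofRealL R, hr⟩] with x h1 h2 h3 h4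
    rw [h1, h4, h2, h3, Pi.mul_apply, Complex.ofReal_mul]
  have hsqI : ofRealL (I * I) ∈ Linf μ := by
    convert (⟨ofRealL I, hi⟩ * ⟨ofRealL I, hi⟩ : Linf μ).2 using 1
    refine AEEqFun.ext ?_
    filter_upwards [coeFn_ofRealL (I * I), coeFn_ofRealL I, AEEqFun.coeFn_mul I I,
      coeFn_Linf_mul (⟨ofRealL I, hi⟩ : Linf μ) ⟨ofRealL I, hi⟩] with x h1 h2 h3 h4
    rw [h1, h4, h2, h3, Pi.mul_apply, Complex.ofReal_mul]
  -- Only sums and products are preserved a priori, so `|F|² = R² + I²` is lifted; nonnegativity of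
  -- the lift of `|F|` then selects the square root.
  have h2 : p.re (absL F) ω * p.re (absL F) ω = p.re R ω * p.re R ω + p.re I ω * p.re I ω := by
    rw [← p.re_mul_of_ae (h := absL F * absL F) (absL_mem f) (absL_mem f)
        (AEEqFun.coeFn_mul _ _) ω,
      ← p.re_mul_of_ae (h := R * R) hr hr (AEEqFun.coeFn_mul _ _) ω,
      ← p.re_mul_of_ae (h := I * I) hi hi (AEEqFun.coeFn_mul _ _) ω]
    refine p.re_add_of_ae hsqR hsqI ?_ ω
    filter_upwards [hR, hI, AEEqFun.coeFn_mul R R, AEEqFun.coeFn_mul I I,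
      AEEqFun.coeFn_mul (absL F) (absL F), coeFn_absL F] with x h1 h2 h3 h4 h5 h6
    rw [h3, h4, h5]
    simp only [Pi.mul_apply]
    rw [h1, h2, h6, Complex.norm_mul_self_eq_normSq, Complex.normSq_apply]
  have h3 : 0 ≤ p.re (absL F) ω := p.le_re (absL_mem f) (by
    filter_upwards [coeFn_absL F] with x hx
    rw [hx]
    exact norm_nonneg _) ω
  rw [← abs_of_nonneg h3, ← abs_of_nonneg (norm_nonneg (p.toHom f ω)), ← sq_eq_sq_iff_abs_eq_abs,
    sq, h2, sq, Complex.norm_mul_self_eq_normSq, h1, Complex.normSq_apply]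
  simp

end Lifting

end Scalars

/-! ## Banach–Kantorovich algebras: norms and sequential completeness -/

section BanachKantorovich

variable {Ω : Type u} [MeasurableSpace Ω] {μ : Measure Ω} {E : Subalgebra ℂ (Ω →ₘ[μ] ℂ)}
  {U : Type v} [NonUnitalRing U] [Module ℂ U] [Module E U] {N : U → (Ω →ₘ[μ] ℝ)}

namespace IsBanachKantorovichAlgebra

section Norm

variable (hU : IsBanachKantorovichAlgebra E N)

include hU

theorem ae_nonneg (x : U) : ∀ᵐ ω ∂μ, 0 ≤ N x ω := by
  filter_upwards [AEEqFun.coeFn_le.2 (hU.nonneg x), AEEqFun.coeFn_zero (μ := μ) (β := ℝ)]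
    with ω h1 h2
  rwa [h2] at h1

theorem ae_add_le (x y : U) : ∀ᵐ ω ∂μ, N (x + y) ω ≤ N x ω + N y ω := by
  filter_upwards [AEEqFun.coeFn_le.2 (hU.add_le x y), AEEqFun.coeFn_add (N x) (N y)]
    with ω h1 h2
  rwa [h2] at h1

theorem ae_mul_le (x y : U) : ∀ᵐ ω ∂μ, N (x * y) ω ≤ N x ω * N y ω := by
  filter_upwards [AEEqFun.coeFn_le.2 (hU.mul_le x y), AEEqFun.coeFn_mul (N x) (N y)]
    with ω h1 h2
  rwa [h2] at h1

theorem ae_smul (c : ℂ) (x : U) : ∀ᵐ ω ∂μ, N (c • x) ω = ‖c‖ * N x ω := by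
  rw [hU.smul]
  exact AEEqFun.coeFn_smul _ _

theorem ae_module_smul (a : E) (x : U) :
    ∀ᵐ ω ∂μ, N (a • x) ω = ‖(a : Ω →ₘ[μ] ℂ) ω‖ * N x ω := by
  rw [hU.module_smul]
  filter_upwards [AEEqFun.coeFn_mul (absL (a : Ω →ₘ[μ] ℂ)) (N x), coeFn_absL (a : Ω →ₘ[μ] ℂ)]
    with ω h1 h2
  rw [h1, Pi.mul_apply, h2]

theorem norm_zero : N 0 = 0 := (hU.eq_zero_iff 0).2 rfl

theorem ae_norm_zero : ∀ᵐ ω ∂μ, N 0 ω = 0 := by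
  rw [hU.norm_zero]
  exact AEEqFun.coeFn_zero

theorem norm_neg (x : U) : N (-x) = N x := by
  have h := hU.smul (-1) x
  rw [neg_one_smul] at h
  simpa using h

theorem ae_sub_le (x y : U) : ∀ᵐ ω ∂μ, N (x - y) ω ≤ N x ω + N y ω := by
  have h := hU.ae_add_le x (-y)
  rwa [← sub_eq_add_neg, hU.norm_neg] at h

/-- Sequential completeness: a sequence which is Cauchy with an explicit modulus `e` converges with
this modulus. -/
theorem exists_limit (x : ℕ → U) (e : ℕ → (Ω →ₘ[μ] ℝ)) (heE : ∀ k, ofRealL (e k) ∈ E)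
    (hanti : ∀ k n, k ≤ n → e n ≤ e k)
    (hlim : ∀ᵐ ω ∂μ, Tendsto (fun k => e k ω) atTop (𝓝 0))
    (h : ∀ k n m, k ≤ n → k ≤ m → ∀ᵐ ω ∂μ, N (x n - x m) ω ≤ e k ω) :
    ∃ y, ∀ k, ∀ᵐ ω ∂μ, N (y - x k) ω ≤ e k ω := by
  have htail : ∀ k, ∀ᶠ z in map x atTop, ∃ n ≥ k, z = x n := fun k =>
    eventually_map.2 ((eventually_ge_atTop k).mono fun n hn => ⟨n, hn, rfl⟩)
  have hpos : ∀ k, 0 ≤ e k := by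
    intro k
    refine AEEqFun.coeFn_le.1 ?_
    filter_upwards [h k k k le_rfl le_rfl, AEEqFun.coeFn_zero (μ := μ) (β := ℝ),
      hU.ae_nonneg (x k - x k)] with ω h1 h2 h3
    rw [h2]
    exact h3.trans h1
  have hdir : DirectedOn (fun a b => b ≤ a) (Set.range e) := by
    rintro _ ⟨k, rfl⟩ _ ⟨n, rfl⟩
    exact ⟨e (max k n), ⟨_, rfl⟩, hanti _ _ (le_max_left _ _), hanti _ _ (le_max_right _ _)⟩
  have hmem : ∀ d ∈ Set.range e, ofRealL d ∈ E := by
    rintro _ ⟨k, rfl⟩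
    exact heE k
  have hlow : (0 : Ω →ₘ[μ] ℝ) ∈ lowerBounds (Set.range e) := by
    rintro _ ⟨k, rfl⟩
    exact hpos k
  have hglb : (0 : Ω →ₘ[μ] ℝ) ∈ upperBounds (lowerBounds (Set.range e)) := by
    intro b hb
    have hb' : ∀ᵐ ω ∂μ, ∀ k, b ω ≤ e k ω :=
      ae_all_iff.2 fun k => AEEqFun.coeFn_le.2 (hb ⟨k, rfl⟩)
    refine AEEqFun.coeFn_le.1 ?_
    filter_upwards [hb', hlim, AEEqFun.coeFn_zero (μ := μ) (β := ℝ)] with ω h1 h2 h3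
    rw [h3]
    exact ge_of_tendsto' h2 h1
  have hev : ∀ d ∈ Set.range e, ∀ᶠ q in map x atTop ×ˢ map x atTop, N (q.1 - q.2) ≤ d := by
    rintro _ ⟨k, rfl⟩
    refine ((htail k).prod_mk (htail k)).mono ?_
    rintro ⟨_, _⟩ ⟨⟨n, hn, rfl⟩, ⟨m, hm, rfl⟩⟩
    exact AEEqFun.coeFn_le.1 (h k n m hn hm)
  obtain ⟨y, D, hDne, hDdir, hDE, hDglb, hD⟩ := hU.complete (map x atTop) inferInstance
    ⟨Set.range e, ⟨e 0, 0, rfl⟩, hdir, hmem, ⟨hlow, hglb⟩, hev⟩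
  refine ⟨y, fun k => ?_⟩
  -- Completeness controls the limit only through some unknown set `D` with infimum `0`. Comparing
  -- with a late `x n` bounds the excess over `e k` by each member of `D`, hence by `0`.
  have hlow' : N (y - x k) - e k ∈ lowerBounds D := by
    intro d hd
    obtain ⟨z, hz, n, hn, rfl⟩ := ((hD d hd).and (htail k)).exists
    refine AEEqFun.coeFn_le.1 ?_
    filter_upwards [AEEqFun.coeFn_le.2 hz, h k n k hn le_rfl,
      hU.ae_add_le (y - x n) (x n - x k), AEEqFun.coeFn_sub (N (y - x k)) (e k)]
      with ω h1 h2 h3 h4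
    rw [sub_add_sub_cancel] at h3
    rw [h4, Pi.sub_apply]
    linarith
  filter_upwards [AEEqFun.coeFn_le.2 (hDglb.2 hlow'), AEEqFun.coeFn_sub (N (y - x k)) (e k),
    AEEqFun.coeFn_zero (μ := μ) (β := ℝ)] with ω h1 h2 h3
  rw [h2, h3, Pi.sub_apply, Pi.zero_apply] at h1
  linarith

end Norm

/-- The subalgebra of elements with bounded norm. -/
def bounded (hU : IsBanachKantorovichAlgebra E N) : NonUnitalSubalgebra ℂ U where
  carrier := {x | ∃ C : ℝ, ∀ᵐ ω ∂μ, N x ω ≤ C}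
  zero_mem' := ⟨0, hU.ae_norm_zero.mono fun _ h => h.le⟩
  add_mem' := by
    rintro x y ⟨C, hC⟩ ⟨D, hD⟩
    refine ⟨C + D, ?_⟩
    filter_upwards [hC, hD, hU.ae_add_le x y] with ω h1 h2 h3
    linarith
  mul_mem' := by
    rintro x y ⟨C, hC⟩ ⟨D, hD⟩
    refine ⟨C * D, ?_⟩
    filter_upwards [hC, hD, hU.ae_mul_le x y, hU.ae_nonneg x, hU.ae_nonneg y] with ω h1 h2 h3 h4 h5
    exact h3.trans (mul_le_mul h1 h2 h5 (h4.trans h1))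
  smul_mem' := by
    rintro c x ⟨C, hC⟩
    refine ⟨‖c‖ * C, ?_⟩
    filter_upwards [hC, hU.ae_smul c x] with ω h1 h2
    rw [h2]
    exact mul_le_mul_of_nonneg_left h1 (norm_nonneg c)

variable (hU : IsBanachKantorovichAlgebra E N)

include hU in
theorem ofRealL_norm_mem {x : U} {C : ℝ} (h : ∀ᵐ ω ∂μ, N x ω ≤ C) : ofRealL (N x) ∈ Linf μ := by
  refine ofRealL_mem_Linf.2 ⟨C, ?_⟩
  filter_upwards [h, hU.ae_nonneg x] with ω h1 h2
  rwa [abs_of_nonneg h2]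

theorem mem_bounded_iff {x : U} : x ∈ hU.bounded ↔ ofRealL (N x) ∈ Linf μ := by
  refine ⟨fun ⟨C, hC⟩ => hU.ofRealL_norm_mem hC, fun h => ?_⟩
  obtain ⟨C, hC⟩ := ofRealL_mem_Linf.1 h
  exact ⟨C, hC.mono fun ω h => (le_abs_self _).trans h⟩

theorem Linf_smul_mem (hE : IsFaithfulSolid E) (a : Linf μ) {x : U} (hx : x ∈ hU.bounded) :
    Subalgebra.inclusion hE.Linf_le a • x ∈ hU.bounded := by
  obtain ⟨C, hC⟩ := hx
  obtain ⟨D, hD⟩ := a.2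
  refine ⟨D * C, ?_⟩
  filter_upwards [hC, hD, hU.ae_module_smul (Subalgebra.inclusion hE.Linf_le a) x,
    hU.ae_nonneg x] with ω h1 h2 h3 h4
  rw [h3]
  exact mul_le_mul h2 h1 h4 ((norm_nonneg _).trans h2)

/-- Since `t / (1 + t) ≤ 1`, a nowhere vanishing bounded factor moves any element into the bounded
part. This reduces questions about `U` to `hU.bounded`. -/
theorem damp_smul_mem (hE : IsFaithfulSolid E) (x : U) :
    Subalgebra.inclusion hE.Linf_le (damp (N x)) • x ∈ hU.bounded := by
  refine ⟨1, ?_⟩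
  filter_upwards [hU.ae_module_smul (Subalgebra.inclusion hE.Linf_le (damp (N x))) x,
    hU.ae_nonneg x, coeFn_damp (N x)] with ω h1 h2 h3
  rw [h1]
  change ‖(damp (N x) : Ω →ₘ[μ] ℂ) ω‖ * _ ≤ _
  rw [h3, Complex.norm_real, Real.norm_eq_abs, abs_of_nonneg (by positivity), abs_of_nonneg h2,
    inv_mul_le_iff₀ (by positivity)]
  linarith

/-! ## Fibres -/

/-- The bounded elements with the seminorm `x ↦ p(‖x‖)(ω)`. -/
@[nolint unusedArguments]
def PreFiber (hU : IsBanachKantorovichAlgebra E N) (_p : Lifting μ) (_ω : Ω) : Type v :=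
  hU.bounded

variable (p : Lifting μ) (ω : Ω)

namespace PreFiber

noncomputable instance : NonUnitalRing (PreFiber hU p ω) :=
  inferInstanceAs (NonUnitalRing hU.bounded)

noncomputable instance : Module ℂ (PreFiber hU p ω) := inferInstanceAs (Module ℂ hU.bounded)

instance [IsScalarTower ℂ U U] : IsScalarTower ℂ (PreFiber hU p ω) (PreFiber hU p ω) :=
  inferInstanceAs (IsScalarTower ℂ hU.bounded hU.bounded)

instance [SMulCommClass ℂ U U] : SMulCommClass ℂ (PreFiber hU p ω) (PreFiber hU p ω) :=
  inferInstanceAs (SMulCommClass ℂ hU.bounded hU.bounded)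

theorem norm_mem (x : PreFiber hU p ω) : ofRealL (N x.1) ∈ Linf μ := hU.mem_bounded_iff.1 x.2

/-- The seminorm `x ↦ p(‖x‖)(ω)`. -/
noncomputable def seminorm : AddGroupSeminorm (PreFiber hU p ω) where
  toFun x := p.re (N x.1) ω
  map_zero' := p.re_const_of_ae hU.ae_norm_zero ω
  add_le' x y := by
    have hxy : ofRealL (N x.1 + N y.1) ∈ Linf μ := by
      obtain ⟨C, hC⟩ := ofRealL_mem_Linf.1 (norm_mem hU p ω x)
      obtain ⟨D, hD⟩ := ofRealL_mem_Linf.1 (norm_mem hU p ω y)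
      refine ofRealL_mem_Linf.2 ⟨C + D, ?_⟩
      filter_upwards [hC, hD, AEEqFun.coeFn_add (N x.1) (N y.1)] with ω h1 h2 h3
      rw [h3, Pi.add_apply]
      exact (abs_add_le _ _).trans (add_le_add h1 h2)
    rw [← p.re_add_of_ae (h := N x.1 + N y.1) (norm_mem hU p ω x) (norm_mem hU p ω y)
      (AEEqFun.coeFn_add _ _) ω]
    exact p.re_mono (norm_mem hU p ω (x + y)) hxy
      (AEEqFun.coeFn_le.2 (hU.add_le x.1 y.1)) ω
  neg' x := by
    change p.re (N (-x.1)) ω = _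
    rw [hU.norm_neg]

noncomputable instance : SeminormedAddCommGroup (PreFiber hU p ω) :=
  (seminorm hU p ω).toSeminormedAddCommGroup

theorem norm_def (x : PreFiber hU p ω) : ‖x‖ = p.re (N x.1) ω := rfl

noncomputable instance : NonUnitalSeminormedRing (PreFiber hU p ω) :=
  { (inferInstance : SeminormedAddCommGroup (PreFiber hU p ω)),
    (inferInstance : NonUnitalRing (PreFiber hU p ω)) with
    norm_mul_le := by
      intro x y
      have hxy : ofRealL (N x.1 * N y.1) ∈ Linf μ := by
        obtain ⟨C, hC⟩ := ofRealL_mem_Linf.1 (norm_mem hU p ω x)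
        obtain ⟨D, hD⟩ := ofRealL_mem_Linf.1 (norm_mem hU p ω y)
        refine ofRealL_mem_Linf.2 ⟨C * D, ?_⟩
        filter_upwards [hC, hD, AEEqFun.coeFn_mul (N x.1) (N y.1)] with ω h1 h2 h3
        rw [h3, Pi.mul_apply, abs_mul]
        exact mul_le_mul h1 h2 (abs_nonneg _) ((abs_nonneg _).trans h1)
      rw [norm_def, norm_def, norm_def,
        ← p.re_mul_of_ae (h := N x.1 * N y.1) (norm_mem hU p ω x) (norm_mem hU p ω y)
        (AEEqFun.coeFn_mul _ _) ω]
      exact p.re_mono (norm_mem hU p ω (x * y)) hxy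
        (AEEqFun.coeFn_le.2 (hU.mul_le x.1 y.1)) ω }

noncomputable instance : NormedSpace ℂ (PreFiber hU p ω) where
  norm_smul_le c x := by
    have h1 : ∀ᵐ ω ∂μ, absL ((algebraMap ℂ (Linf μ) c : Linf μ) : Ω →ₘ[μ] ℂ) ω = ‖c‖ := by
      filter_upwards [coeFn_absL ((algebraMap ℂ (Linf μ) c : Linf μ) : Ω →ₘ[μ] ℂ),
        coeFn_Linf_algebraMap (μ := μ) c] with ω h1 h2
      rw [h1, h2]
    refine le_of_eq ?_
    rw [norm_def, norm_def, ← p.re_const_of_ae h1 ω]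
    refine p.re_mul_of_ae (Lifting.absL_mem _) (norm_mem hU p ω x) ?_ ω
    filter_upwards [h1, hU.ae_smul c x.1] with ω h1 h2
    rw [h1]
    exact h2

/-- Every element is equivalent to one whose norm is bounded by a given number which exceeds its
seminorm at `ω`. -/
theorem exists_equiv_norm_le (hE : IsFaithfulSolid E) (x : PreFiber hU p ω) {r : ℝ}
    (hr : ‖x‖ < r) : ∃ y : PreFiber hU p ω, ‖x - y‖ = 0 ∧ ∀ᵐ ω ∂μ, N y.1 ω ≤ r := by
  classical
  have hr0 : 0 < r := (norm_nonneg x).trans_lt hr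
  -- The witness is `x` cut off to the complement of this set. The lifted indicator is idempotent,
  -- so its value at `ω` is `0` or `1`; the value `1` would give `r ≤ p(‖x‖)(ω)`.
  have hA : MeasurableSet {ω | r < N x.1 ω} := measurableSet_lt measurable_const (N x.1).measurable
  set A := {ω | r < N x.1 ω} with hAdef
  set a : Linf μ := ind A hA with hadef
  set ι := Subalgebra.inclusion hE.Linf_le with hι
  let y : PreFiber hU p ω := ⟨ι (1 - a) • x.1, hU.Linf_smul_mem hE _ x.2⟩
  have ha := coeFn_ind (μ := μ) A hA
  have habs := coeFn_absL (a : Ω →ₘ[μ] ℂ)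
  refine ⟨y, ?_, ?_⟩
  · have hxy : (x - y).1 = ι a • x.1 := by
      change x.1 - ι (1 - a) • x.1 = _
      rw [map_sub, map_one, sub_smul, one_smul, sub_sub_cancel]
    have h1 : ‖x - y‖ = p.re (absL (a : Ω →ₘ[μ] ℂ)) ω * ‖x‖ := by
      rw [norm_def, norm_def, hxy]
      refine p.re_mul_of_ae (Lifting.absL_mem a) (norm_mem hU p ω x) ?_ ω
      filter_upwards [habs, hU.ae_module_smul (ι a) x.1] with z h1 h2
      rw [h2, h1]
      rfl
    have h2 : p.re (absL (a : Ω →ₘ[μ] ℂ)) ω * p.re (absL (a : Ω →ₘ[μ] ℂ)) ω =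
        p.re (absL (a : Ω →ₘ[μ] ℂ)) ω := by
      refine (p.re_mul_of_ae (Lifting.absL_mem a) (Lifting.absL_mem a) ?_ ω).symm
      filter_upwards [habs, ha] with z h1 h2
      rw [h1, h2]
      split_ifs <;> simp
    by_cases h0 : p.re (absL (a : Ω →ₘ[μ] ℂ)) ω = 0
    · rw [h1, h0, zero_mul]
    · exfalso
      have h3 : p.re (absL (a : Ω →ₘ[μ] ℂ)) ω = 1 := mul_left_cancel₀ h0 (by rw [h2, mul_one])
      have hra : ofRealL (r • absL (a : Ω →ₘ[μ] ℂ)) ∈ Linf μ := by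
        refine ofRealL_mem_Linf.2 ⟨r, ?_⟩
        filter_upwards [habs, ha, AEEqFun.coeFn_smul r (absL (a : Ω →ₘ[μ] ℂ))] with z h1 h2 h3
        rw [h3, Pi.smul_apply, h1, h2]
        split_ifs <;> simp [abs_of_pos hr0, hr0.le]
      have h4 : p.re (r • absL (a : Ω →ₘ[μ] ℂ)) ω ≤ p.re (N x.1) ω := by
        refine p.re_mono hra (norm_mem hU p ω x) ?_ ω
        filter_upwards [habs, ha, AEEqFun.coeFn_smul r (absL (a : Ω →ₘ[μ] ℂ)),
          hU.ae_nonneg x.1] with z h1 h2 h3 h5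
        rw [h3, Pi.smul_apply, h1, h2]
        split_ifs with hz
        · have : r < N x.1 z := hz
          simpa using this.le
        · simpa using h5
      have hrc : ∀ᵐ z ∂μ, absL ((algebraMap ℂ (Linf μ) r : Linf μ) : Ω →ₘ[μ] ℂ) z = r := by
        filter_upwards [coeFn_absL ((algebraMap ℂ (Linf μ) r : Linf μ) : Ω →ₘ[μ] ℂ),
          coeFn_Linf_algebraMap (μ := μ) (r : ℂ)] with z h1 h2
        rw [h1, h2, Complex.norm_real, Real.norm_eq_abs, abs_of_pos hr0]
      have h5 : p.re (r • absL (a : Ω →ₘ[μ] ℂ)) ω =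
          p.re (absL ((algebraMap ℂ (Linf μ) r : Linf μ) : Ω →ₘ[μ] ℂ)) ω *
            p.re (absL (a : Ω →ₘ[μ] ℂ)) ω := by
        refine p.re_mul_of_ae (Lifting.absL_mem _) (Lifting.absL_mem a) ?_ ω
        filter_upwards [hrc, AEEqFun.coeFn_smul r (absL (a : Ω →ₘ[μ] ℂ))] with z h1 h2
        rw [h2, h1]
        rfl
      rw [p.re_const_of_ae hrc ω] at h5
      rw [h5, h3, mul_one] at h4
      rw [norm_def] at hr
      linarith
  · filter_upwards [hU.ae_module_smul (ι (1 - a)) x.1, coeFn_Linf_sub 1 a,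
      coeFn_Linf_one (μ := μ), ha, hU.ae_nonneg x.1] with z h1 h2 h3 h4 h5
    change N (ι (1 - a) • x.1) z ≤ r
    rw [h1]
    change ‖((1 - a : Linf μ) : Ω →ₘ[μ] ℂ) z‖ * _ ≤ r
    rw [h2, h3, h4]
    split_ifs with hz
    · simpa using hr0.le
    · have : ¬ r < N x.1 z := hz
      simpa using not_lt.1 this

/-- A bound on the seminorm at `ω` says nothing about other points. Replacing the successive
differences by equivalent elements with small norm on all of `Ω` gives a series that converges in
`U`, and its sum is a limit in the fibre. -/
theorem completeSpace (hE : IsFaithfulSolid E) : CompleteSpace (PreFiber hU p ω) := by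
  refine Metric.complete_of_convergent_controlled_sequences (fun n => (1 / 2) ^ n)
    (fun n => by positivity) fun u hu => ?_
  have h1 : ∀ n, ∃ y : PreFiber hU p ω, ‖u (n + 1) - u n - y‖ = 0 ∧
      ∀ᵐ ω ∂μ, N y.1 ω ≤ (1 / 2) ^ n := fun n =>
    exists_equiv_norm_le hU p ω hE _ (by
      rw [← dist_eq_norm]
      exact hu n _ _ (Nat.le_succ n) le_rfl)
  choose y hy0 hy using h1
  let S : ℕ → PreFiber hU p ω := fun n => ∑ i ∈ Finset.range n, y i
  have hSsucc : ∀ n, S (n + 1) = S n + y n := fun n => Finset.sum_range_succ _ _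
  -- The exact geometric partial sum makes the induction close. Two such tails, compared through `S
  -- k`, give the modulus `4 * (1 / 2) ^ k` below.
  have hS : ∀ k n, k ≤ n → ∀ᵐ z ∂μ, N ((S n).1 - (S k).1) z ≤
      2 * (1 / 2) ^ k - 2 * (1 / 2) ^ n := by
    intro k n hkn
    induction n, hkn using Nat.le_induction with
    | base =>
      rw [sub_self, sub_self]
      exact hU.ae_norm_zero.mono fun _ h => h.le
    | succ n hkn ih =>
      filter_upwards [ih, hy n, hU.ae_add_le ((S n).1 - (S k).1) (y n).1] with z h1 h2 h3
      have e : (S (n + 1)).1 - (S k).1 = (S n).1 - (S k).1 + (y n).1 := by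
        rw [hSsucc]
        change (S n).1 + (y n).1 - (S k).1 = _
        abel
      rw [e]
      refine h3.trans ((add_le_add h1 h2).trans ?_)
      rw [pow_succ]
      linarith
  have hS' : ∀ k n m, k ≤ n → k ≤ m →
      ∀ᵐ z ∂μ, N ((S n).1 - (S m).1) z ≤ (AEEqFun.const Ω (4 * (1 / 2) ^ k : ℝ) : Ω →ₘ[μ] ℝ) z := by
    intro k n m hn hm
    filter_upwards [hS k n hn, hS k m hm, AEEqFun.coeFn_const (μ := μ) Ω (4 * (1 / 2) ^ k : ℝ),
      hU.ae_sub_le ((S n).1 - (S k).1) ((S m).1 - (S k).1)] with z h1 h2 h3 h4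
    rw [sub_sub_sub_cancel_right] at h4
    rw [h3, Function.const]
    have h5 : (0 : ℝ) ≤ (1 / 2) ^ n := by positivity
    have h6 : (0 : ℝ) ≤ (1 / 2) ^ m := by positivity
    linarith
  have hpow : Tendsto (fun k : ℕ => (4 * (1 / 2) ^ k : ℝ)) atTop (𝓝 0) := by
    simpa using (tendsto_pow_atTop_nhds_zero_of_lt_one (r := (1 / 2 : ℝ)) (by norm_num)
      (by norm_num)).const_mul 4
  obtain ⟨x, hx⟩ := hU.exists_limit (fun n => (S n).1)
    (fun k => AEEqFun.const Ω (4 * (1 / 2) ^ k : ℝ)) (fun k => hE.Linf_le (by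
      refine ofRealL_mem_Linf.2 ⟨|4 * (1 / 2) ^ k|, ?_⟩
      filter_upwards [AEEqFun.coeFn_const (μ := μ) Ω (4 * (1 / 2) ^ k : ℝ)] with z hz
      rw [hz, Function.const])) (fun k n hkn => by
      refine AEEqFun.coeFn_le.1 ?_
      filter_upwards [AEEqFun.coeFn_const (μ := μ) Ω (4 * (1 / 2) ^ k : ℝ),
        AEEqFun.coeFn_const (μ := μ) Ω (4 * (1 / 2) ^ n : ℝ)] with z h1 h2
      rw [h1, h2, Function.const, Function.const]
      exact mul_le_mul_of_nonneg_left
        (pow_le_pow_of_le_one (by norm_num) (by norm_num) hkn) (by norm_num)) (by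
      filter_upwards [ae_all_iff.2 fun k : ℕ =>
        AEEqFun.coeFn_const (μ := μ) Ω (4 * (1 / 2) ^ k : ℝ)] with z hz
      simpa only [hz, Function.const] using hpow) hS'
  have hx' : ∀ k, ∀ᵐ z ∂μ, N (x - (S k).1) z ≤ 4 * (1 / 2) ^ k := by
    intro k
    filter_upwards [hx k, AEEqFun.coeFn_const (μ := μ) Ω (4 * (1 / 2) ^ k : ℝ)] with z h1 h2
    rwa [h2] at h1
  have hxb : x ∈ hU.bounded := by
    refine ⟨4 * (1 / 2) ^ 0, ?_⟩
    have := hx' 0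
    rwa [show (S 0).1 = 0 from congrArg Subtype.val (Finset.sum_range_zero y), sub_zero] at this
  let x' : PreFiber hU p ω := ⟨x, hxb⟩
  -- At `ω` the partial sums telescope to `u n - u 0` up to seminorm zero, so the limit is the sum
  -- of the series plus `u 0`.
  have hu0 : ∀ n, ‖u n - u 0 - S n‖ = 0 := by
    intro n
    induction n with
    | zero => simp [S]
    | succ n ih =>
      have e : u (n + 1) - u 0 - S (n + 1) = (u (n + 1) - u n - y n) + (u n - u 0 - S n) := by
        rw [hSsucc]
        abel
      refine le_antisymm ?_ (norm_nonneg _)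
      rw [e]
      refine (norm_add_le _ _).trans ?_
      rw [ih, hy0, add_zero]
  refine ⟨x' + u 0, tendsto_iff_norm_sub_tendsto_zero.2
    (squeeze_zero (fun _ => norm_nonneg _) (fun n => ?_) hpow)⟩
  have e : u n - (x' + u 0) = (u n - u 0 - S n) - (x' - S n) := by abel
  rw [e]
  refine (norm_sub_le _ _).trans ?_
  rw [hu0, zero_add]
  exact p.re_le (norm_mem hU p ω (x' - S n)) (hx' n) ω

end PreFiber

end IsBanachKantorovichAlgebra

end BanachKantorovich

/-! ## Classes of sections and measurable sections -/

section Sections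

variable {Ω : Type u} [MeasurableSpace Ω] {μ : Measure Ω} {X : Ω → Type v}

theorem Sec.val_ofFun [∀ ω, Zero (X ω)] (f : ∀ ω, X ω) : (Sec.ofFun f : Sec μ X).val = f := by
  funext ω
  simp [Sec.val, Sec.ofFun]

theorem Sec.cls_ofFun_val [∀ ω, Zero (X ω)] (a : Sec μ X) :
    (Sec.ofFun a.val : Sec μ X).cls = a.cls := by
  refine Quotient.sound ?_
  change ∀ᵐ ω ∂μ, _
  filter_upwards [a.ae_dom] with ω h
  simp only [Sec.ofFun, Sec.val, dif_pos h]
  exact Part.some_get h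

theorem Sec.cls_ofFun_eq_iff {f g : ∀ ω, X ω} :
    (Sec.ofFun f : Sec μ X).cls = (Sec.ofFun g).cls ↔ ∀ᵐ ω ∂μ, f ω = g ω := by
  refine Quotient.eq.trans ?_
  change (∀ᵐ ω ∂μ, Part.some (f ω) = Part.some (g ω)) ↔ _
  simp only [Part.some_inj]

theorem SecClass.exists_ofFun [∀ ω, Zero (X ω)] (x : SecClass μ X) :
    ∃ f : ∀ ω, X ω, (Sec.ofFun f : Sec μ X).cls = x := by
  obtain ⟨a, rfl⟩ := Quotient.exists_rep x
  exact ⟨a.val, a.cls_ofFun_val⟩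

theorem Sec.cls_add [∀ ω, Add (X ω)] (f g : ∀ ω, X ω) :
    (Sec.ofFun f : Sec μ X).cls + (Sec.ofFun g).cls = (Sec.ofFun fun ω => f ω + g ω).cls := by
  refine Quotient.sound ?_
  change ∀ᵐ ω ∂μ, _
  refine Eventually.of_forall fun ω => ?_
  exact Part.ext' (by simp [Sec.ofFun, Sec.map₂]) fun _ _ => rfl

theorem Sec.cls_mul [∀ ω, Mul (X ω)] (f g : ∀ ω, X ω) :
    (Sec.ofFun f : Sec μ X).cls * (Sec.ofFun g).cls = (Sec.ofFun fun ω => f ω * g ω).cls := by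
  refine Quotient.sound ?_
  change ∀ᵐ ω ∂μ, _
  refine Eventually.of_forall fun ω => ?_
  exact Part.ext' (by simp [Sec.ofFun, Sec.map₂]) fun _ _ => rfl

theorem Sec.cls_smul [∀ ω, SMul ℂ (X ω)] (h : Ω →ₘ[μ] ℂ) (f : ∀ ω, X ω) :
    h • (Sec.ofFun f : Sec μ X).cls = (Sec.ofFun fun ω => h ω • f ω).cls := by
  refine Quotient.sound ?_
  change ∀ᵐ ω ∂μ, _
  exact Eventually.of_forall fun ω => Part.map_some _ _

end Sections

namespace MeasurableBundle

variable {Ω : Type u} [MeasurableSpace Ω] {μ : Measure Ω} (𝒳 : MeasurableBundle.{u, v} μ)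

/-- An everywhere defined section is measurable. -/
def Meas (f : ∀ ω, 𝒳.fiber ω) : Prop := (Sec.ofFun f : Sec μ 𝒳.fiber) ∈ 𝒳.measurableSections

variable {𝒳}

/-- Measurability depends only on `val`, so partially defined sections can be traded for everywhere
defined functions. -/
theorem mem_measurableSections_iff {a : Sec μ 𝒳.fiber} :
    a ∈ 𝒳.measurableSections ↔ 𝒳.Meas a.val := by
  simp only [Meas, measurableSections, Set.mem_ofPred_eq, Sec.val_ofFun]

theorem meas_iff {f : ∀ ω, 𝒳.fiber ω} :
    𝒳.Meas f ↔ ∃ s : ℕ → Sec μ 𝒳.fiber, (∀ n, 𝒳.IsSimple (s n)) ∧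
      ∀ᵐ ω ∂μ, Tendsto (fun n => (s n).val ω) atTop (𝓝 (f ω)) := by
  simp only [Meas, measurableSections, Set.mem_ofPred_eq, Sec.val_ofFun,
    ← tendsto_iff_norm_sub_tendsto_zero]

theorem Meas.congr {f g : ∀ ω, 𝒳.fiber ω} (hf : 𝒳.Meas f) (h : ∀ᵐ ω ∂μ, f ω = g ω) :
    𝒳.Meas g := by
  rw [meas_iff] at hf ⊢
  obtain ⟨s, hs, hlim⟩ := hf
  refine ⟨s, hs, ?_⟩
  filter_upwards [hlim, h] with ω h1 h2
  rwa [← h2]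

theorem mem_LZero_iff {f : ∀ ω, 𝒳.fiber ω} :
    (Sec.ofFun f : Sec μ 𝒳.fiber).cls ∈ 𝒳.LZero ↔ 𝒳.Meas f := by
  refine ⟨?_, fun h => ⟨_, h, rfl⟩⟩
  rintro ⟨a, ha, h⟩
  rw [← Sec.cls_ofFun_val, Sec.cls_ofFun_eq_iff] at h
  exact (mem_measurableSections_iff.1 ha).congr h

theorem Meas.norm_cls {f : ∀ ω, 𝒳.fiber ω} (hf : 𝒳.Meas f) :
    ∀ᵐ ω ∂μ, (Sec.ofFun f : Sec μ 𝒳.fiber).cls.norm ω = ‖f ω‖ := by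
  have h := MeasurableBundle.norm_cls (show Sec.ofFun f ∈ 𝒳.measurableSections from hf)
  rwa [Sec.val_ofFun] at h

theorem Meas.aemeasurable_norm {f : ∀ ω, 𝒳.fiber ω} (hf : 𝒳.Meas f) :
    AEMeasurable (fun ω => ‖f ω‖) μ := by
  have h := MeasurableBundle.aemeasurable_norm (show Sec.ofFun f ∈ 𝒳.measurableSections from hf)
  rwa [Sec.val_ofFun] at h

/-- The values of a simple section. -/
theorem simpleSec_val {n : ℕ} (A : Fin n → Set Ω) (c : Fin n → Sec μ 𝒳.fiber) :
    open Classical in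
    ∀ᵐ ω ∂μ, (𝒳.simpleSec A c).val ω = ∑ i, if ω ∈ A i then (c i).val ω else 0 := by
  filter_upwards [ae_all_iff.2 fun i => (c i).ae_dom] with ω h
  simp [Sec.val, simpleSec, h]

/-- Simple sections with an arbitrary finite index type. -/
theorem exists_isSimple {ι : Type*} [Fintype ι] (A : ι → Set Ω) (c : ι → Sec μ 𝒳.fiber)
    (hA : ∀ i, MeasurableSet (A i)) (hc : ∀ i, c i ∈ 𝒳.sections) :
    open Classical in
    ∃ s, 𝒳.IsSimple s ∧ ∀ᵐ ω ∂μ, s.val ω = ∑ i, if ω ∈ A i then (c i).val ω else 0 := by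
  classical
  let e := (Fintype.equivFin ι).symm
  refine ⟨𝒳.simpleSec (A ∘ e) (c ∘ e), ⟨_, _, _, fun i => hA _, fun i => hc _, rfl⟩, ?_⟩
  filter_upwards [𝒳.simpleSec_val (A ∘ e) (c ∘ e)] with ω h
  rw [h]
  exact Equiv.sum_comp e fun i => if ω ∈ A i then (c i).val ω else 0

theorem exists_smul_section (z : ℂ) {c : Sec μ 𝒳.fiber} (hc : c ∈ 𝒳.sections) :
    ∃ b ∈ 𝒳.sections, ∀ᵐ ω ∂μ, b.val ω = z • c.val ω := by
  refine ⟨_, 𝒳.lincomb_mem z 0 c hc c hc, ?_⟩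
  filter_upwards [c.ae_dom] with ω h
  simp [Sec.val, Sec.map₂, h]

/-- Each piece of `s` is split along the level sets of `g`; on a level set the factor is a constant,
and scalar multiples of sections are again sections. -/
theorem exists_isSimple_smul (g : SimpleFunc Ω ℂ) {s : Sec μ 𝒳.fiber} (hs : 𝒳.IsSimple s) :
    ∃ t, 𝒳.IsSimple t ∧ ∀ᵐ ω ∂μ, t.val ω = g ω • s.val ω := by
  classical
  obtain ⟨n, A, c, hA, hc, rfl⟩ := hs
  choose b hb hbval using fun (i : Fin n × g.range) =>
    exists_smul_section (i.2 : ℂ) (hc i.1)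
  obtain ⟨t, ht, htval⟩ := exists_isSimple (fun i : Fin n × g.range => A i.1 ∩ g ⁻¹' {(i.2 : ℂ)}) b
    (fun i => (hA i.1).inter (g.measurableSet_fiber _)) hb
  refine ⟨t, ht, ?_⟩
  filter_upwards [htval, ae_all_iff.2 hbval, 𝒳.simpleSec_val A c] with ω h1 h2 h3
  rw [h1, h3, Finset.smul_sum, Fintype.sum_prod_type]
  refine Finset.sum_congr rfl fun i _ => ?_
  rw [Finset.sum_eq_single (⟨g ω, g.mem_range_self ω⟩ : g.range)]
  · simp only [h2, Set.mem_inter_iff, Set.mem_preimage, Set.mem_singleton_iff, and_true]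
    split_ifs <;> simp
  · rintro ⟨z, hz⟩ - hne
    refine if_neg fun h => hne ?_
    exact Subtype.ext h.2.symm
  · simp

/-- Measurable sections are closed under multiplication by measurable functions. -/
theorem Meas.smul {f : ∀ ω, 𝒳.fiber ω} (hf : 𝒳.Meas f) {h : Ω → ℂ} (hh : AEMeasurable h μ) :
    𝒳.Meas fun ω => h ω • f ω := by
  rw [meas_iff] at hf ⊢
  obtain ⟨s, hs, hlim⟩ := hf
  choose t ht htval using fun n => exists_isSimple_smul
    (hh.measurable_mk.stronglyMeasurable.approx n) (hs n)
  refine ⟨t, ht, ?_⟩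
  filter_upwards [ae_all_iff.2 htval, hlim, hh.ae_eq_mk] with ω h1 h2 h3
  simp only [h1]
  rw [h3]
  exact (hh.measurable_mk.stronglyMeasurable.tendsto_approx ω).smul h2

theorem meas_of_mem_sections {c : Sec μ 𝒳.fiber} (hc : c ∈ 𝒳.sections) : 𝒳.Meas c.val := by
  classical
  obtain ⟨s, hs, hval⟩ := exists_isSimple (fun _ : Unit => Set.univ) (fun _ => c)
    (fun _ => MeasurableSet.univ) (fun _ => hc)
  refine meas_iff.2 ⟨fun _ => s, fun _ => hs, ?_⟩
  filter_upwards [hval] with ω h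
  rw [h]
  simp

/-- The function `1 / (1 + ‖f‖)` for a measurable section `f`. -/
theorem Meas.aemeasurable_damp {f : ∀ ω, 𝒳.fiber ω} (hf : 𝒳.Meas f) :
    AEMeasurable (fun ω => (((1 + ‖f ω‖)⁻¹ : ℝ) : ℂ)) μ :=
  Complex.measurable_ofReal.comp_aemeasurable (hf.aemeasurable_norm.const_add (1 : ℝ)).inv

theorem Meas.aemeasurable_undamp {f : ∀ ω, 𝒳.fiber ω} (hf : 𝒳.Meas f) :
    AEMeasurable (fun ω => ((1 + ‖f ω‖ : ℝ) : ℂ)) μ :=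
  Complex.measurable_ofReal.comp_aemeasurable (hf.aemeasurable_norm.const_add (1 : ℝ))

theorem norm_damp_smul_le {X : Type*} [NormedAddCommGroup X] [NormedSpace ℂ X] (x : X) :
    ‖(((1 + ‖x‖)⁻¹ : ℝ) : ℂ) • x‖ ≤ 1 := by
  rw [norm_smul, Complex.norm_real, Real.norm_eq_abs, abs_of_nonneg (by positivity),
    inv_mul_le_iff₀ (by positivity)]
  linarith

theorem undamp_smul_damp_smul {X : Type*} [NormedAddCommGroup X] [NormedSpace ℂ X] (x : X) :
    ((1 + ‖x‖ : ℝ) : ℂ) • (((1 + ‖x‖)⁻¹ : ℝ) : ℂ) • x = x := by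
  rw [smul_smul, ← Complex.ofReal_mul, mul_inv_cancel₀ (by positivity), Complex.ofReal_one,
    one_smul]

theorem cls_mem_bkSpace_Linf {f : ∀ ω, 𝒳.fiber ω} (hf : 𝒳.Meas f) {C : ℝ}
    (h : ∀ᵐ ω ∂μ, ‖f ω‖ ≤ C) : (Sec.ofFun f : Sec μ 𝒳.fiber).cls ∈ 𝒳.bkSpace (Linf μ) := by
  refine ⟨mem_LZero_iff.2 hf, ofRealL_mem_Linf.2 ⟨C, ?_⟩⟩
  filter_upwards [h, hf.norm_cls] with ω h1 h2
  rwa [h2, abs_norm]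

end MeasurableBundle

/-! ## The bundle of a Banach–Kantorovich algebra -/

namespace IsBanachKantorovichAlgebra

variable {Ω : Type u} [MeasurableSpace Ω] {μ : Measure Ω} {E : Subalgebra ℂ (Ω →ₘ[μ] ℂ)}
  {U : Type v} [NonUnitalRing U] [Module ℂ U] [Module E U] {N : U → (Ω →ₘ[μ] ℝ)}
  (hU : IsBanachKantorovichAlgebra E N) (p : Lifting μ)

/-- A bounded sequence which is almost everywhere a Cauchy sequence has an almost everywhere
limit. -/
theorem exists_ae_limit (hE : IsFaithfulSolid E) (y : ℕ → U) {D : ℝ}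
    (hyD : ∀ n, ∀ᵐ ω ∂μ, N (y n) ω ≤ D)
    (hcauchy : ∀ᵐ ω ∂μ, ∀ ε > 0, ∃ K, ∀ n ≥ K, ∀ m ≥ K, N (y n - y m) ω ≤ ε) :
    ∃ x ∈ hU.bounded, ∀ᵐ ω ∂μ, Tendsto (fun n => N (x - y n) ω) atTop (𝓝 0) := by
  -- Pointwise Cauchy convergence becomes order convergence with the supremum of the tail as
  -- modulus: it is measurable as a countable supremum and decreases to `0`. The bound `D + D` makes
  -- the real supremum meaningful almost everywhere and keeps it in `E`.
  let g : ℕ → Ω → ℝ := fun k ω => ⨆ q : ℕ × ℕ, N (y (k + q.1) - y (k + q.2)) ω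
  have hg : ∀ k, AEStronglyMeasurable (g k) μ := fun k =>
    (Measurable.iSup fun q : ℕ × ℕ =>
      (N (y (k + q.1) - y (k + q.2))).measurable).aestronglyMeasurable
  let e : ℕ → (Ω →ₘ[μ] ℝ) := fun k => AEEqFun.mk (g k) (hg k)
  have he : ∀ᵐ ω ∂μ, ∀ k, e k ω = g k ω := ae_all_iff.2 fun k => AEEqFun.coeFn_mk _ (hg k)
  have hpos : ∀ᵐ ω ∂μ, ∀ n m, 0 ≤ N (y n - y m) ω :=
    ae_all_iff.2 fun n => ae_all_iff.2 fun m => hU.ae_nonneg _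
  have hle : ∀ᵐ ω ∂μ, ∀ n m, N (y n - y m) ω ≤ D + D := by
    refine ae_all_iff.2 fun n => ae_all_iff.2 fun m => ?_
    filter_upwards [hyD n, hyD m, hU.ae_sub_le (y n) (y m)] with ω h1 h2 h3
    exact h3.trans (add_le_add h1 h2)
  have hbdd : ∀ᵐ ω ∂μ, ∀ k, BddAbove (Set.range fun q : ℕ × ℕ =>
      N (y (k + q.1) - y (k + q.2)) ω) := by
    filter_upwards [hle] with ω h k
    exact ⟨D + D, by rintro _ ⟨q, rfl⟩; exact h _ _⟩
  have hgle : ∀ᵐ ω ∂μ, ∀ k n m, k ≤ n → k ≤ m → N (y n - y m) ω ≤ g k ω := by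
    filter_upwards [hbdd] with ω h k n m hn hm
    obtain ⟨i, rfl⟩ := Nat.exists_eq_add_of_le hn
    obtain ⟨j, rfl⟩ := Nat.exists_eq_add_of_le hm
    exact le_ciSup (h k) (i, j)
  have hg0 : ∀ᵐ ω ∂μ, ∀ k, 0 ≤ g k ω := by
    filter_upwards [hgle, hpos] with ω h1 h2 k
    exact (h2 k k).trans (h1 k k k le_rfl le_rfl)
  have heE : ∀ k, ofRealL (e k) ∈ E := by
    intro k
    refine hE.Linf_le (ofRealL_mem_Linf.2 ⟨D + D, ?_⟩)
    filter_upwards [he, hg0, hle] with ω h1 h2 h3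
    rw [h1, abs_of_nonneg (h2 k)]
    exact ciSup_le fun q => h3 _ _
  have hanti : ∀ k n, k ≤ n → e n ≤ e k := by
    intro k n hkn
    refine AEEqFun.coeFn_le.1 ?_
    filter_upwards [he, hgle] with ω h1 h2
    rw [h1, h1]
    exact ciSup_le fun q => h2 k _ _ (by omega) (by omega)
  have hlim0 : ∀ᵐ ω ∂μ, Tendsto (fun k => e k ω) atTop (𝓝 0) := by
    filter_upwards [he, hg0, hcauchy] with ω h1 h2 h3
    simp only [h1]
    refine Metric.tendsto_atTop.2 fun ε hε => ?_
    obtain ⟨K, hK⟩ := h3 (ε / 2) (half_pos hε)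
    refine ⟨K, fun k hk => ?_⟩
    rw [Real.dist_0_eq_abs, abs_of_nonneg (h2 k)]
    refine (ciSup_le fun q => ?_ : g k ω ≤ ε / 2).trans_lt (half_lt_self hε)
    exact hK _ (by omega) _ (by omega)
  obtain ⟨x, hx⟩ := hU.exists_limit y e heE hanti hlim0 (by
    intro k n m hn hm
    filter_upwards [he, hgle] with ω h1 h2
    rw [h1]
    exact h2 k n m hn hm)
  have hxb : x ∈ hU.bounded := by
    refine ⟨D + D + D, ?_⟩
    filter_upwards [hx 0, he, hle, hU.ae_add_le (x - y 0) (y 0), hyD 0] with ω h1 h2 h3 h4 h5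
    rw [sub_add_cancel] at h4
    rw [h2] at h1
    have h6 : g 0 ω ≤ D + D := ciSup_le fun q => h3 _ _
    linarith
  refine ⟨x, hxb, ?_⟩
  filter_upwards [ae_all_iff.2 hx, hlim0,
    ae_all_iff.2 fun n => hU.ae_nonneg (x - y n)] with ω h1 h2 h3
  exact squeeze_zero h3 h1 h2

/-- The value of a bounded element in the fibre over `ω`. -/
noncomputable def germ (x : hU.bounded) (ω : Ω) : SeparationQuotient (PreFiber hU p ω) :=
  SeparationQuotient.mk (x : PreFiber hU p ω)

theorem germ_surjective (ω : Ω) (z : SeparationQuotient (PreFiber hU p ω)) :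
    ∃ x, hU.germ p x ω = z := SeparationQuotient.surjective_mk z

theorem germ_sub (x y : hU.bounded) (ω : Ω) :
    hU.germ p (x - y) ω = hU.germ p x ω - hU.germ p y ω := rfl

theorem germ_smul (c : ℂ) (x : hU.bounded) (ω : Ω) :
    hU.germ p (c • x) ω = c • hU.germ p x ω := rfl

theorem norm_germ (x : hU.bounded) (ω : Ω) : ‖hU.germ p x ω‖ = p.re (N x.1) ω := rfl

theorem ae_norm_germ (x : hU.bounded) : ∀ᵐ ω ∂μ, ‖hU.germ p x ω‖ = N x.1 ω :=
  p.re_ae_eq (hU.mem_bounded_iff.1 x.2)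

/-- Multiplication of a bounded element by a bounded function. -/
noncomputable def bsmul (hE : IsFaithfulSolid E) (a : Linf μ) (x : hU.bounded) : hU.bounded :=
  ⟨Subalgebra.inclusion hE.Linf_le a • x.1, hU.Linf_smul_mem hE a x.2⟩

theorem inclusion_algebraMap_smul [IsScalarTower ℂ E U] (hE : IsFaithfulSolid E) (c : ℂ) (x : U) :
    Subalgebra.inclusion hE.Linf_le (algebraMap ℂ (Linf μ) c) • x = c • x := by
  rw [AlgHom.commutes]
  exact _root_.algebraMap_smul E c x

/-- The lift of `a - p(a)(ω)` vanishes at `ω`, and so does the lift of its modulus. Multiplication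
by this function therefore has seminorm zero at `ω`. -/
theorem germ_bsmul [IsScalarTower ℂ E U] (hE : IsFaithfulSolid E) (a : Linf μ) (x : hU.bounded) (ω : Ω) :
    hU.germ p (hU.bsmul hE a x) ω = p.toHom a ω • hU.germ p x ω := by
  set c := p.toHom a ω with hc
  rw [← sub_eq_zero, ← germ_smul, ← germ_sub, ← norm_eq_zero, norm_germ]
  have e : (hU.bsmul hE a x - c • x).1 =
      Subalgebra.inclusion hE.Linf_le (a - algebraMap ℂ (Linf μ) c) • x.1 := by
    rw [map_sub, sub_smul, inclusion_algebraMap_smul hE]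
    rfl
  rw [e, p.re_mul_of_ae (f := absL ((a - algebraMap ℂ (Linf μ) c : Linf μ) : Ω →ₘ[μ] ℂ))
    (Lifting.absL_mem _) (hU.mem_bounded_iff.1 x.2) ?_ ω, p.re_absL, map_sub, AlgHom.commutes,
    Pi.sub_apply, ← hc, Pi.algebraMap_apply, Algebra.algebraMap_self, RingHom.id_apply, sub_self,
    _root_.norm_zero, zero_mul]
  filter_upwards [hU.ae_module_smul
    (Subalgebra.inclusion hE.Linf_le (a - algebraMap ℂ (Linf μ) c)) x.1,
    coeFn_absL ((a - algebraMap ℂ (Linf μ) c : Linf μ) : Ω →ₘ[μ] ℂ)] with z h1 h2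
  rw [h1, h2]
  rfl

theorem ae_germ_bsmul [IsScalarTower ℂ E U] (hE : IsFaithfulSolid E) (a : Linf μ) (x : hU.bounded) :
    ∀ᵐ ω ∂μ, hU.germ p (hU.bsmul hE a x) ω = (a : Ω →ₘ[μ] ℂ) ω • hU.germ p x ω := by
  filter_upwards [p.ae_eq a] with ω h
  rw [germ_bsmul, h]

variable [IsScalarTower ℂ U U] [SMulCommClass ℂ U U]

/-- The measurable bundle of Banach algebras of a Banach–Kantorovich algebra. -/
noncomputable def bundle (hE : IsFaithfulSolid E) : MeasurableBundle.{u, v} μ where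
  fiber ω := SeparationQuotient (PreFiber hU p ω)
  tower ω := ⟨fun c x y => by
    obtain ⟨x, rfl⟩ := SeparationQuotient.surjective_mk x
    obtain ⟨y, rfl⟩ := SeparationQuotient.surjective_mk y
    exact congrArg SeparationQuotient.mk (smul_assoc c x y)⟩
  comm ω := ⟨fun c x y => by
    obtain ⟨x, rfl⟩ := SeparationQuotient.surjective_mk x
    obtain ⟨y, rfl⟩ := SeparationQuotient.surjective_mk y
    exact congrArg SeparationQuotient.mk (smul_comm c x y)⟩
  complete ω := by
    have := PreFiber.completeSpace hU p ω hE
    infer_instance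
  -- Every vector of a fibre is a germ, since the quotient needs no completion; the density
  -- condition is then immediate.
  sections := Set.range fun x => Sec.ofFun (hU.germ p x)
  lincomb_mem := by
    rintro r s _ ⟨x, rfl⟩ _ ⟨y, rfl⟩
    refine ⟨r • x + s • y, ?_⟩
    simp only [Sec.ofFun, Sec.map₂, Sec.mk.injEq]
    funext ω
    exact Part.ext' (by simp) fun _ _ => rfl
  norm_measurable := by
    rintro _ ⟨x, rfl⟩
    simp only [Sec.val_ofFun, norm_germ]
    exact (p.measurable_re _).aemeasurable
  dense ω := by
    refine dense_iff_closure_eq.2 (Set.eq_univ_of_forall fun z => subset_closure ?_)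
    obtain ⟨x, rfl⟩ := hU.germ_surjective p ω z
    exact ⟨Sec.ofFun (hU.germ p x), ⟨x, rfl⟩, Part.mem_some _⟩
  mul_mem := by
    rintro _ ⟨x, rfl⟩ _ ⟨y, rfl⟩
    refine ⟨x * y, ?_⟩
    simp only [Sec.ofFun, Sec.map₂, Sec.mk.injEq]
    funext ω
    exact Part.ext' (by simp) fun _ _ => rfl

variable (hE : IsFaithfulSolid E)

/-- The section of the bundle defined by a bounded element. -/
noncomputable def sec (x : hU.bounded) : ∀ ω, (hU.bundle p hE).fiber ω := hU.germ p x

variable {hE}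

theorem mem_sections_iff {c : Sec μ (hU.bundle p hE).fiber} :
    c ∈ (hU.bundle p hE).sections ↔ ∃ x, Sec.ofFun (hU.sec p hE x) = c := Iff.rfl

theorem sec_surjective (ω : Ω) (z : (hU.bundle p hE).fiber ω) : ∃ x, hU.sec p hE x ω = z :=
  hU.germ_surjective p ω z

theorem sec_add (x y : hU.bounded) (ω : Ω) :
    hU.sec p hE (x + y) ω = hU.sec p hE x ω + hU.sec p hE y ω := rfl

theorem sec_sub (x y : hU.bounded) (ω : Ω) :
    hU.sec p hE (x - y) ω = hU.sec p hE x ω - hU.sec p hE y ω := rfl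

theorem sec_mul (x y : hU.bounded) (ω : Ω) :
    hU.sec p hE (x * y) ω = hU.sec p hE x ω * hU.sec p hE y ω := rfl

theorem sec_smul (c : ℂ) (x : hU.bounded) (ω : Ω) :
    hU.sec p hE (c • x) ω = c • hU.sec p hE x ω := rfl

theorem sec_zero (ω : Ω) : hU.sec p hE 0 ω = 0 := rfl

theorem norm_sec (x : hU.bounded) (ω : Ω) : ‖hU.sec p hE x ω‖ = p.re (N x.1) ω := rfl

theorem ae_norm_sec (x : hU.bounded) : ∀ᵐ ω ∂μ, ‖hU.sec p hE x ω‖ = N x.1 ω :=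
  hU.ae_norm_germ p x

theorem sec_sum {ι : Type*} (S : Finset ι) (x : ι → hU.bounded) (ω : Ω) :
    hU.sec p hE (∑ i ∈ S, x i) ω = ∑ i ∈ S, hU.sec p hE (x i) ω := by
  induction S using Finset.cons_induction with
  | empty => rfl
  | cons i S hi ih => rw [Finset.sum_cons, Finset.sum_cons, sec_add, ih]

theorem meas_sec (x : hU.bounded) : (hU.bundle p hE).Meas (hU.sec p hE x) := by
  have h := MeasurableBundle.meas_of_mem_sections
    ((hU.mem_sections_iff p (hE := hE)).2 ⟨x, rfl⟩)
  rwa [Sec.val_ofFun] at h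

variable [IsScalarTower ℂ E U]

theorem sec_bsmul (a : Linf μ) (x : hU.bounded) (ω : Ω) :
    hU.sec p hE (hU.bsmul hE a x) ω = p.toHom a ω • hU.sec p hE x ω :=
  hU.germ_bsmul p hE a x ω

theorem ae_sec_bsmul (a : Linf μ) (x : hU.bounded) :
    ∀ᵐ ω ∂μ, hU.sec p hE (hU.bsmul hE a x) ω = (a : Ω →ₘ[μ] ℂ) ω • hU.sec p hE x ω :=
  hU.ae_germ_bsmul p hE a x

/-- The module structure absorbs indicator functions into `U`, so cutting and pasting of germ
sections is done by elements of the algebra. -/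
theorem exists_sec_of_isSimple {s : Sec μ (hU.bundle p hE).fiber}
    (hs : (hU.bundle p hE).IsSimple s) :
    ∃ x, ∀ᵐ ω ∂μ, s.val ω = hU.sec p hE x ω := by
  classical
  obtain ⟨n, A, c, hA, hc, rfl⟩ := hs
  choose x hx using fun i => (hU.mem_sections_iff p).1 (hc i)
  refine ⟨∑ i, hU.bsmul hE (ind (A i) (hA i)) (x i), ?_⟩
  filter_upwards [MeasurableBundle.simpleSec_val A c,
    ae_all_iff.2 fun i => hU.ae_sec_bsmul p (hE := hE) (ind (A i) (hA i)) (x i),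
    ae_all_iff.2 fun i => coeFn_ind (μ := μ) (A i) (hA i)] with ω h1 h2 h3
  rw [h1, sec_sum]
  refine Finset.sum_congr rfl fun i _ => ?_
  rw [h2, h3, ← hx i, Sec.val_ofFun]
  split_ifs
  · rw [one_smul]
  · rw [zero_smul]

/-- A bounded measurable section is the almost everywhere limit of a bounded sequence of sections
of bounded elements. -/
theorem exists_seq_of_meas {f : ∀ ω, (hU.bundle p hE).fiber ω} (hf : (hU.bundle p hE).Meas f)
    {C : ℝ} (hC : ∀ᵐ ω ∂μ, ‖f ω‖ ≤ C) : ∃ x : ℕ → hU.bounded,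
      (∀ n, ∀ᵐ ω ∂μ, N (x n).1 ω ≤ |C| + 1) ∧
      ∀ᵐ ω ∂μ, Tendsto (fun n => hU.sec p hE (x n) ω) atTop (𝓝 (f ω)) := by
  classical
  obtain ⟨s, hs, hlim⟩ := MeasurableBundle.meas_iff.1 hf
  choose y hy using fun n => hU.exists_sec_of_isSimple p (hs n)
  -- The approximants are truncated to have a common bound. The margin `1` leaves the limit
  -- unchanged: near it the norms stay below `|C| + 1`, so the truncation is eventually inactive at
  -- almost every point.
  have hA : ∀ n, MeasurableSet {ω | N (y n).1 ω ≤ |C| + 1} := fun n =>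
    measurableSet_le (N (y n).1).measurable measurable_const
  have hind := fun n => coeFn_ind (μ := μ) _ (hA n)
  refine ⟨fun n => hU.bsmul hE (ind _ (hA n)) (y n), fun n => ?_, ?_⟩
  · filter_upwards [hind n, hU.ae_module_smul
      (Subalgebra.inclusion hE.Linf_le (ind _ (hA n))) (y n).1] with ω h1 h2
    change N (Subalgebra.inclusion hE.Linf_le (ind _ (hA n)) • (y n).1) ω ≤ _
    rw [h2]
    change ‖(ind _ (hA n) : Linf μ).1 ω‖ * _ ≤ _
    rw [h1]
    split_ifs with h
    · rw [norm_one, one_mul]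
      exact h
    · rw [_root_.norm_zero, zero_mul]
      positivity
  · filter_upwards [ae_all_iff.2 hind, hlim, hC, ae_all_iff.2 hy,
      ae_all_iff.2 fun n => hU.ae_sec_bsmul p (hE := hE) (ind _ (hA n)) (y n),
      ae_all_iff.2 fun n => hU.ae_norm_sec p (hE := hE) (y n)] with ω h1 h2 h3 h4 h5 h6
    simp only [h4] at h2
    refine h2.congr' ?_
    have h7 : ‖f ω‖ < |C| + 1 := by linarith [le_abs_self C]
    filter_upwards [h2.norm.eventually (gt_mem_nhds h7)] with n hn
    have h8 : N (y n).1 ω ≤ |C| + 1 := by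
      rw [← h6]
      exact hn.le
    rw [h5, h1, if_pos h8, one_smul]

/-- Every bounded measurable section is the section of a bounded element. -/
theorem exists_sec_of_meas {f : ∀ ω, (hU.bundle p hE).fiber ω} (hf : (hU.bundle p hE).Meas f)
    {C : ℝ} (hC : ∀ᵐ ω ∂μ, ‖f ω‖ ≤ C) : ∃ x, ∀ᵐ ω ∂μ, hU.sec p hE x ω = f ω := by
  obtain ⟨y, hyC, hlim⟩ := hU.exists_seq_of_meas p hf hC
  have hnorm : ∀ x : hU.bounded, ∀ᵐ ω ∂μ, ∀ n, N (x - y n : hU.bounded).1 ω =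
      ‖hU.sec p hE x ω - hU.sec p hE (y n) ω‖ := fun x => ae_all_iff.2 fun n => by
    filter_upwards [hU.ae_norm_sec p (hE := hE) (x - y n)] with ω h
    rw [← sec_sub, h]
  -- Fibre norms of differences equal the norms in `U` almost everywhere, so pointwise convergence
  -- of the sections is the Cauchy condition for the elements. Uniqueness of limits identifies the
  -- section of the limit with `f`.
  obtain ⟨x, hxb, hx⟩ := hU.exists_ae_limit hE (fun n => (y n).1) hyC (by
    filter_upwards [hlim, ae_all_iff.2 fun n => hnorm (y n)] with ω h1 h2 ε hε
    obtain ⟨K, hK⟩ := Metric.cauchySeq_iff.1 h1.cauchySeq ε hε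
    refine ⟨K, fun n hn m hm => ?_⟩
    have h3 := hK n hn m hm
    rw [dist_eq_norm, ← h2] at h3
    exact h3.le)
  refine ⟨⟨x, hxb⟩, ?_⟩
  filter_upwards [hx, hlim, hnorm ⟨x, hxb⟩] with ω h1 h2 h3
  refine tendsto_nhds_unique (tendsto_iff_norm_sub_tendsto_zero.2 ?_) h2
  refine h1.congr fun n => ?_
  rw [norm_sub_rev]
  exact h3 n

end IsBanachKantorovichAlgebra

/-! ## The isomorphism onto the space of sections -/

namespace IsBanachKantorovichAlgebra

variable {Ω : Type u} [MeasurableSpace Ω] {μ : Measure Ω} {E : Subalgebra ℂ (Ω →ₘ[μ] ℂ)}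
  {U : Type v} [NonUnitalRing U] [Module ℂ U] [IsScalarTower ℂ U U] [SMulCommClass ℂ U U]
  [Module E U] {N : U → (Ω →ₘ[μ] ℝ)}
  (hU : IsBanachKantorovichAlgebra E N) (p : Lifting μ) (hE : IsFaithfulSolid E)

/-- The section `f` represents the element `x`: there is a nonvanishing bounded function `a` for
which `a • x` is bounded and `a • f` is the section of `a • x`. -/
def IsRep (x : U) (f : ∀ ω, (hU.bundle p hE).fiber ω) : Prop :=
  ∃ (a : Linf μ) (y : hU.bounded), (∀ᵐ ω ∂μ, (a : Ω →ₘ[μ] ℂ) ω ≠ 0) ∧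
    Subalgebra.inclusion hE.Linf_le a • x = y.1 ∧
    ∀ᵐ ω ∂μ, hU.sec p hE y ω = (a : Ω →ₘ[μ] ℂ) ω • f ω

variable {p hE}

theorem isRep_sec (x : hU.bounded) : hU.IsRep p hE x.1 (hU.sec p hE x) := by
  refine ⟨1, x, coeFn_Linf_one.mono fun ω h => by rw [h]; exact one_ne_zero, ?_, ?_⟩
  · rw [map_one, one_smul]
  · filter_upwards [coeFn_Linf_one (μ := μ)] with ω h
    rw [h, one_smul]

theorem IsRep.congr {x : U} {f g : ∀ ω, (hU.bundle p hE).fiber ω} (hf : hU.IsRep p hE x f)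
    (h : ∀ᵐ ω ∂μ, f ω = g ω) : hU.IsRep p hE x g := by
  obtain ⟨a, y, ha, hy, hval⟩ := hf
  refine ⟨a, y, ha, hy, ?_⟩
  filter_upwards [hval, h] with ω h1 h2
  rw [h1, h2]

theorem IsRep.meas {x : U} {f : ∀ ω, (hU.bundle p hE).fiber ω} (hf : hU.IsRep p hE x f) :
    (hU.bundle p hE).Meas f := by
  obtain ⟨a, y, ha, hy, hval⟩ := hf
  refine ((hU.meas_sec p y).smul (a : Ω →ₘ[μ] ℂ).aemeasurable.inv).congr ?_
  filter_upwards [ha, hval] with ω h1 h2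
  rw [h2, smul_smul, Pi.inv_apply, inv_mul_cancel₀ h1, one_smul]

theorem IsRep.norm_eq {x : U} {f : ∀ ω, (hU.bundle p hE).fiber ω} (hf : hU.IsRep p hE x f) :
    ∀ᵐ ω ∂μ, ‖f ω‖ = N x ω := by
  obtain ⟨a, y, ha, hy, hval⟩ := hf
  filter_upwards [ha, hval, hU.ae_norm_sec p (hE := hE) y,
    hU.ae_module_smul (Subalgebra.inclusion hE.Linf_le a) x] with ω h1 h2 h3 h4
  rw [h2, norm_smul, ← hy, h4] at h3
  exact mul_left_cancel₀ (norm_ne_zero_iff.2 h1) h3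

/-- The damped element is bounded and has a germ section; the damping is undone by dividing values
in the fibres. -/
theorem exists_isRep (x : U) : ∃ f, hU.IsRep p hE x f := by
  let y : hU.bounded := ⟨_, hU.damp_smul_mem hE x⟩
  refine ⟨fun ω => ((damp (N x) : Ω →ₘ[μ] ℂ) ω)⁻¹ • hU.sec p hE y ω, damp (N x), y,
    damp_ne_zero _, rfl, ?_⟩
  filter_upwards [damp_ne_zero (N x)] with ω h
  rw [smul_smul, mul_inv_cancel₀ h, one_smul]

theorem IsRep.mul [IsScalarTower E U U] [SMulCommClass E U U]
    {x x' : U} {f f' : ∀ ω, (hU.bundle p hE).fiber ω} (hf : hU.IsRep p hE x f)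
    (hf' : hU.IsRep p hE x' f') : hU.IsRep p hE (x * x') fun ω => f ω * f' ω := by
  obtain ⟨a, y, ha, hy, hval⟩ := hf
  obtain ⟨a', y', ha', hy', hval'⟩ := hf'
  refine ⟨a * a', y * y', ?_, ?_, ?_⟩
  · filter_upwards [ha, ha', coeFn_Linf_mul a a'] with ω h1 h2 h3
    rw [h3]
    exact mul_ne_zero h1 h2
  · change _ = y.1 * y'.1
    rw [← hy, ← hy', map_mul, smul_mul_smul_comm]
  · filter_upwards [hval, hval', coeFn_Linf_mul a a'] with ω h1 h2 h3
    rw [sec_mul, h1, h2, h3, smul_mul_smul_comm]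

theorem IsRep.norm_cls {x : U} {f : ∀ ω, (hU.bundle p hE).fiber ω} (hf : hU.IsRep p hE x f) :
    (Sec.ofFun f : Sec μ (hU.bundle p hE).fiber).cls.norm = N x := by
  refine AEEqFun.ext ?_
  filter_upwards [(hf.meas hU).norm_cls, hf.norm_eq hU] with ω h1 h2
  rw [h1, h2]

variable (p hE) in
theorem cls_sec_mem (x : hU.bounded) :
    (Sec.ofFun (hU.sec p hE x) : Sec μ (hU.bundle p hE).fiber).cls ∈ (hU.bundle p hE).bkSpace (Linf μ) := by
  obtain ⟨C, hC⟩ := x.2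
  refine MeasurableBundle.cls_mem_bkSpace_Linf (hU.meas_sec p x) (C := C) ?_
  filter_upwards [hC, hU.ae_norm_sec p (hE := hE) x] with ω h1 h2
  rwa [h2]

variable [IsScalarTower ℂ E U]

/-- This gives surjectivity onto `E(Ω, 𝒳)`. The damped section comes from a bounded element, and the
damping can be undone inside the module exactly because `1 + h` lies in `E`. -/
theorem isRep_of_norm_mem {f : ∀ ω, (hU.bundle p hE).fiber ω} {h : Ω →ₘ[μ] ℝ}
    (hh : ofRealL h ∈ E) (hf : (hU.bundle p hE).Meas f) (hfh : ∀ᵐ ω ∂μ, h ω = ‖f ω‖) :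
    ∃ x, hU.IsRep p hE x f := by
  have hd := coeFn_damp h
  obtain ⟨y, hy⟩ := hU.exists_sec_of_meas p (hf.smul (damp h : Ω →ₘ[μ] ℂ).aemeasurable) (C := 1) (by
    filter_upwards [hfh, hd] with ω h1 h2
    rw [h2, h1, abs_norm]
    exact MeasurableBundle.norm_damp_smul_le _)
  let b : E := 1 + ⟨ofRealL h, hh⟩
  have hb : ∀ᵐ ω ∂μ, (b : Ω →ₘ[μ] ℂ) ω = 1 + (h ω : ℂ) := by
    filter_upwards [AEEqFun.coeFn_add (1 : Ω →ₘ[μ] ℂ) (ofRealL h), coeFn_ofRealL h,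
      AEEqFun.coeFn_one (μ := μ) (β := ℂ)] with ω h1 h2 h3
    change ((1 : Ω →ₘ[μ] ℂ) + ofRealL h) ω = _
    rw [h1, Pi.add_apply, h2, h3, Pi.one_apply]
  have e : Subalgebra.inclusion hE.Linf_le (damp h) * b = 1 := by
    refine Subtype.ext (AEEqFun.ext ?_)
    filter_upwards [AEEqFun.coeFn_mul (damp h : Ω →ₘ[μ] ℂ) (b : Ω →ₘ[μ] ℂ), hb, hd, hfh,
      AEEqFun.coeFn_one (μ := μ) (β := ℂ)] with ω h1 h2 h3 h4 h5
    change ((damp h : Ω →ₘ[μ] ℂ) * (b : Ω →ₘ[μ] ℂ)) ω = (1 : Ω →ₘ[μ] ℂ) ω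
    rw [h1, h5, Pi.mul_apply, h3, h2, h4, abs_norm, ← Complex.ofReal_one, ← Complex.ofReal_add,
      ← Complex.ofReal_mul, inv_mul_cancel₀ (by positivity)]
    rfl
  refine ⟨b • y.1, damp h, y, damp_ne_zero h, ?_, hy⟩
  rw [smul_smul, e, one_smul]

theorem IsRep.add {x x' : U} {f f' : ∀ ω, (hU.bundle p hE).fiber ω} (hf : hU.IsRep p hE x f)
    (hf' : hU.IsRep p hE x' f') : hU.IsRep p hE (x + x') fun ω => f ω + f' ω := by
  obtain ⟨a, y, ha, hy, hval⟩ := hf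
  obtain ⟨a', y', ha', hy', hval'⟩ := hf'
  -- Common denominator of two fractions.
  refine ⟨a * a', hU.bsmul hE a' y + hU.bsmul hE a y', ?_, ?_, ?_⟩
  · filter_upwards [ha, ha', coeFn_Linf_mul a a'] with ω h1 h2 h3
    rw [h3]
    exact mul_ne_zero h1 h2
  · change _ = Subalgebra.inclusion hE.Linf_le a' • y.1 + Subalgebra.inclusion hE.Linf_le a • y'.1
    rw [← hy, ← hy', smul_smul, smul_smul, ← map_mul, ← map_mul, smul_add, mul_comm a' a]
  · filter_upwards [hval, hval', coeFn_Linf_mul a a', hU.ae_sec_bsmul p (hE := hE) a' y,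
      hU.ae_sec_bsmul p (hE := hE) a y'] with ω h1 h2 h3 h4 h5
    rw [sec_add, h4, h5, h1, h2, h3, smul_add, smul_smul, smul_smul, mul_comm]

theorem IsRep.smul {x : U} {f : ∀ ω, (hU.bundle p hE).fiber ω} (hf : hU.IsRep p hE x f) (c : E) :
    hU.IsRep p hE (c • x) fun ω => (c : Ω →ₘ[μ] ℂ) ω • f ω := by
  obtain ⟨a, y, ha, hy, hval⟩ := hf
  -- The scalar `c` may be unbounded; the extra factor `d` makes `d * c` bounded by `1`.
  set d := damp (absL (c : Ω →ₘ[μ] ℂ)) with hd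
  have hdv : ∀ᵐ ω ∂μ, (d : Ω →ₘ[μ] ℂ) ω = (((1 + ‖(c : Ω →ₘ[μ] ℂ) ω‖)⁻¹ : ℝ) : ℂ) := by
    filter_upwards [coeFn_damp (absL (c : Ω →ₘ[μ] ℂ)), coeFn_absL (c : Ω →ₘ[μ] ℂ)] with ω h1 h2
    rw [h1, h2, abs_norm]
  have hmul := AEEqFun.coeFn_mul (d : Ω →ₘ[μ] ℂ) (c : Ω →ₘ[μ] ℂ)
  let b : Linf μ := ⟨(d : Ω →ₘ[μ] ℂ) * (c : Ω →ₘ[μ] ℂ), 1, by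
    filter_upwards [hdv, hmul] with ω h1 h2
    rw [h2, Pi.mul_apply, h1]
    exact MeasurableBundle.norm_damp_smul_le _⟩
  have hb : Subalgebra.inclusion hE.Linf_le b = Subalgebra.inclusion hE.Linf_le d * c := rfl
  refine ⟨a * d, hU.bsmul hE b y, ?_, ?_, ?_⟩
  · filter_upwards [ha, damp_ne_zero (absL (c : Ω →ₘ[μ] ℂ)), coeFn_Linf_mul a d] with ω h1 h2 h3
    rw [h3]
    exact mul_ne_zero h1 h2
  · change _ = Subalgebra.inclusion hE.Linf_le b • y.1
    rw [← hy, smul_smul, smul_smul, hb, map_mul]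
    congr 1
    ring
  · filter_upwards [hval, hmul, coeFn_Linf_mul a d, hU.ae_sec_bsmul p (hE := hE) b y]
      with ω h1 h2 h3 h4
    have h5 : (b : Ω →ₘ[μ] ℂ) ω = (d : Ω →ₘ[μ] ℂ) ω * (c : Ω →ₘ[μ] ℂ) ω := h2
    rw [h4, h1, h3, h5, smul_smul, smul_smul]
    congr 1
    ring

/-- Isometry on differences gives uniqueness in both directions: of the section up to null sets, and
of the element. -/
theorem IsRep.sub_ae_eq {x x' : U} {f f' : ∀ ω, (hU.bundle p hE).fiber ω}
    (hf : hU.IsRep p hE x f) (hf' : hU.IsRep p hE x' f') :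
    ∀ᵐ ω ∂μ, ‖f ω - f' ω‖ = N (x - x') ω := by
  have h := (hf.add hU (hf'.smul hU (-1))).norm_eq hU
  rw [neg_one_smul, ← sub_eq_add_neg] at h
  filter_upwards [h, AEEqFun.coeFn_neg (1 : Ω →ₘ[μ] ℂ), AEEqFun.coeFn_one (μ := μ) (β := ℂ)]
    with ω h1 h2 h3
  have h4 : ((-1 : E) : Ω →ₘ[μ] ℂ) ω = -1 := by
    change (-1 : Ω →ₘ[μ] ℂ) ω = -1
    rw [h2, Pi.neg_apply, h3, Pi.one_apply]
  rw [h4, neg_one_smul, ← sub_eq_add_neg] at h1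
  exact h1

variable (p hE)

theorem IsRep.ae_unique {x : U} {f f' : ∀ ω, (hU.bundle p hE).fiber ω}
    (hf : hU.IsRep p hE x f) (hf' : hU.IsRep p hE x f') : ∀ᵐ ω ∂μ, f ω = f' ω := by
  have h := hf.sub_ae_eq hU hf'
  rw [sub_self] at h
  filter_upwards [h, hU.ae_norm_zero] with ω h1 h2
  rw [h2, norm_eq_zero, sub_eq_zero] at h1
  exact h1

theorem IsRep.unique {x x' : U} {f : ∀ ω, (hU.bundle p hE).fiber ω}
    (hf : hU.IsRep p hE x f) (hf' : hU.IsRep p hE x' f) : x = x' := by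
  rw [← sub_eq_zero, ← hU.eq_zero_iff]
  refine AEEqFun.ext ?_
  filter_upwards [hf.sub_ae_eq hU hf', AEEqFun.coeFn_zero (μ := μ) (β := ℝ)] with ω h1 h2
  rw [← h1, sub_self, h2, _root_.norm_zero, Pi.zero_apply]

/-- The isometric isomorphism of a Banach–Kantorovich algebra onto the sections of its bundle. -/
theorem nonempty_isometricIso [IsScalarTower E U U] [SMulCommClass E U U] :
    Nonempty (IsometricIso E N (hU.bundle p hE)) := by
  choose f hf using fun x => hU.exists_isRep (p := p) (hE := hE) x
  refine ⟨{ toFun := fun x => (Sec.ofFun (f x)).cls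
            bijOn := ⟨fun x _ => ⟨MeasurableBundle.mem_LZero_iff.2 ((hf x).meas hU), ?_⟩, ?_, ?_⟩
            map_add := fun x y => ?_
            map_smul := fun a x => ?_
            map_mul := fun x y => ?_
            norm_eq := fun x => (hf x).norm_cls hU }⟩
  · rw [(hf x).norm_cls hU]
    exact hU.mem x
  · intro x _ y _ hxy
    have h := Sec.cls_ofFun_eq_iff.1 hxy
    exact ((hf x).congr hU h).unique hU p hE (hf y)
  · rintro s ⟨hs1, hs2⟩
    obtain ⟨g, rfl⟩ := SecClass.exists_ofFun s
    have hg := MeasurableBundle.mem_LZero_iff.1 hs1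
    obtain ⟨x, hx⟩ := hU.isRep_of_norm_mem hs2 hg hg.norm_cls
    exact ⟨x, trivial, Sec.cls_ofFun_eq_iff.2 ((hf x).ae_unique hU p hE hx)⟩
  · rw [Sec.cls_add]
    exact Sec.cls_ofFun_eq_iff.2 ((hf _).ae_unique hU p hE ((hf x).add hU (hf y)))
  · rw [Sec.cls_smul]
    exact Sec.cls_ofFun_eq_iff.2 ((hf _).ae_unique hU p hE ((hf x).smul hU a))
  · rw [Sec.cls_mul]
    exact Sec.cls_ofFun_eq_iff.2 ((hf _).ae_unique hU p hE ((hf x).mul hU (hf y)))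

/-! ## The vector-valued lifting -/

theorem sec_injective {x y : hU.bounded} (h : ∀ᵐ ω ∂μ, hU.sec p hE x ω = hU.sec p hE y ω) :
    x = y :=
  Subtype.ext (((hU.isRep_sec x).congr hU h).unique hU p hE (hU.isRep_sec y))

theorem exists_cls_sec {s : SecClass μ (hU.bundle p hE).fiber}
    (hs : s ∈ (hU.bundle p hE).bkSpace (Linf μ)) :
    ∃ x : hU.bounded, (Sec.ofFun (hU.sec p hE x)).cls = s := by
  obtain ⟨hs1, hs2⟩ := hs
  obtain ⟨f, rfl⟩ := SecClass.exists_ofFun s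
  have hf := MeasurableBundle.mem_LZero_iff.1 hs1
  obtain ⟨C, hC⟩ := ofRealL_mem_Linf.1 hs2
  obtain ⟨x, hx⟩ := hU.exists_sec_of_meas p hf (C := C) (by
    filter_upwards [hC, hf.norm_cls] with ω h1 h2
    rwa [h2, abs_norm] at h1)
  exact ⟨x, Sec.cls_ofFun_eq_iff.2 hx⟩

/-- The bundle of a Banach–Kantorovich algebra has a vector-valued lifting which attains every
value. -/
theorem exists_vectorLifting : ∃ l : VectorLifting p (hU.bundle p hE),
    ∀ (x : hU.bounded) ω, l.toFun (Sec.ofFun (hU.sec p hE x)).cls ω = hU.sec p hE x ω := by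
  classical
  -- A bounded class is lifted to its germ section. The chosen element is the only one by
  -- `sec_injective`; the value `0` is used only for classes that are no germ sections.
  let L : SecClass μ (hU.bundle p hE).fiber → ∀ ω, (hU.bundle p hE).fiber ω := fun s =>
    if h : ∃ x : hU.bounded, (Sec.ofFun (hU.sec p hE x)).cls = s then hU.sec p hE h.choose
    else fun _ => 0
  have hL : ∀ x : hU.bounded, L (Sec.ofFun (hU.sec p hE x)).cls = hU.sec p hE x := by
    intro x
    have h : ∃ y : hU.bounded, (Sec.ofFun (hU.sec p hE y) : Sec μ (hU.bundle p hE).fiber).cls =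
      (Sec.ofFun (hU.sec p hE x)).cls := ⟨x, rfl⟩
    refine (dif_pos h).trans ?_
    rw [hU.sec_injective p hE (Sec.cls_ofFun_eq_iff.1 h.choose_spec)]
  refine ⟨{ toFun := L
            cls_eq := ?_
            norm_eq := ?_
            map_add := ?_
            map_smul := ?_
            map_mul := ?_
            dense := ?_ }, fun x ω => congrFun (hL x) ω⟩
  · intro s hs
    obtain ⟨x, rfl⟩ := hU.exists_cls_sec p hE hs
    rw [hL]
  · intro s hs ω
    obtain ⟨x, rfl⟩ := hU.exists_cls_sec p hE hs
    rw [hL, norm_sec]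
    refine (p.re_eq ?_ ω).symm
    filter_upwards [coeFn_ofRealL
      (Sec.ofFun (hU.sec p hE x) : Sec μ (hU.bundle p hE).fiber).cls.norm] with z hz
    rw [hz, (hU.isRep_sec x).norm_cls hU]
  · intro s hs t ht ω
    obtain ⟨x, rfl⟩ := hU.exists_cls_sec p hE hs
    obtain ⟨y, rfl⟩ := hU.exists_cls_sec p hE ht
    have e : (Sec.ofFun (hU.sec p hE x)).cls + (Sec.ofFun (hU.sec p hE y)).cls =
      (Sec.ofFun (hU.sec p hE (x + y)) : Sec μ (hU.bundle p hE).fiber).cls := Sec.cls_add _ _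
    rw [e, hL, hL, hL, sec_add]
  · intro a s hs ω
    obtain ⟨x, rfl⟩ := hU.exists_cls_sec p hE hs
    have e : (a : Ω →ₘ[μ] ℂ) • (Sec.ofFun (hU.sec p hE x)).cls =
        (Sec.ofFun (hU.sec p hE (hU.bsmul hE a x)) : Sec μ (hU.bundle p hE).fiber).cls := by
      rw [Sec.cls_smul]
      refine Sec.cls_ofFun_eq_iff.2 ?_
      filter_upwards [hU.ae_sec_bsmul p (hE := hE) a x] with z hz
      rw [hz]
    rw [e, hL, hL, sec_bsmul]
  · intro s hs t ht ω
    obtain ⟨x, rfl⟩ := hU.exists_cls_sec p hE hs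
    obtain ⟨y, rfl⟩ := hU.exists_cls_sec p hE ht
    have e : (Sec.ofFun (hU.sec p hE x)).cls * (Sec.ofFun (hU.sec p hE y)).cls =
      (Sec.ofFun (hU.sec p hE (x * y)) : Sec μ (hU.bundle p hE).fiber).cls := Sec.cls_mul _ _
    rw [e, hL, hL, hL, sec_mul]
  · intro ω
    refine dense_iff_closure_eq.2 (Set.eq_univ_of_forall fun z => subset_closure ?_)
    obtain ⟨x, rfl⟩ := hU.sec_surjective p ω z
    exact ⟨_, hU.cls_sec_mem p hE x, congrFun (hL x) ω⟩

end IsBanachKantorovichAlgebra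

/-! ## Elements of norm one in full algebras -/

namespace IsBanachKantorovichAlgebra

variable {Ω : Type u} [MeasurableSpace Ω] {μ : Measure Ω} {E : Subalgebra ℂ (Ω →ₘ[μ] ℂ)}
  {U : Type v} [NonUnitalRing U] [Module ℂ U] [Module E U] {N : U → (Ω →ₘ[μ] ℝ)}
  (hU : IsBanachKantorovichAlgebra E N) (hE : IsFaithfulSolid E)

include hU hE

/-- Cutting `y` to `B \ A` makes the supports disjoint, and the triangle inequality in both
directions determines the norm of the sum. Agreement with `x` on `A` lets countable iterations
stabilise. -/
theorem exists_norm_eq_indicator_union {A B : Set Ω} (hA : MeasurableSet A) (hB : MeasurableSet B)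
    {x y : U} (hx : ∀ᵐ ω ∂μ, N x ω = A.indicator 1 ω) (hy : ∀ᵐ ω ∂μ, N y ω = B.indicator 1 ω) :
    ∃ z, (∀ᵐ ω ∂μ, N z ω = (A ∪ B).indicator 1 ω) ∧ ∀ᵐ ω ∂μ, ω ∈ A → N (z - x) ω = 0 := by
  classical
  set d := Subalgebra.inclusion hE.Linf_le (ind (μ := μ) (B \ A) (hB.diff hA))
  have hd : ∀ᵐ ω ∂μ, N (d • y) ω = (B \ A).indicator 1 ω := by
    filter_upwards [hU.ae_module_smul d y, hy, coeFn_ind (μ := μ) (B \ A) (hB.diff hA)]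
      with ω h1 h2 h3
    rw [h1, h2]
    change ‖(ind (μ := μ) (B \ A) (hB.diff hA) : Ω →ₘ[μ] ℂ) ω‖ * _ = _
    rw [h3]
    by_cases h4 : ω ∈ B <;> by_cases h5 : ω ∈ A <;> simp [h4, h5]
  refine ⟨x + d • y, ?_, ?_⟩
  · filter_upwards [hx, hd, hU.ae_add_le x (d • y), hU.ae_sub_le (x + d • y) (d • y),
      hU.ae_sub_le (x + d • y) x] with ω h1 h2 h3 h4 h5
    rw [add_sub_cancel_right] at h4
    rw [add_sub_cancel_left] at h5
    rw [h1, h2] at h3 h4 h5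
    by_cases h6 : ω ∈ A <;> by_cases h7 : ω ∈ B <;> simp [h6, h7] at h3 h4 h5 ⊢ <;> linarith
  · filter_upwards [hd] with ω h1 h2
    rw [add_sub_cancel_left, h1]
    simp [h2]

/-- The successive finite unions carry elements that no longer change on earlier sets and vanish off
the union. The sequence is Cauchy at almost every point, and norms pass to the limit. -/
theorem exists_norm_eq_indicator_iUnion {A : ℕ → Set Ω} (hA : ∀ n, MeasurableSet (A n))
    {y : ℕ → U} (hy : ∀ n, ∀ᵐ ω ∂μ, N (y n) ω = (A n).indicator 1 ω) :
    ∃ z, ∀ᵐ ω ∂μ, N z ω = (⋃ n, A n).indicator 1 ω := by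
  classical
  have hstep : ∀ (n : ℕ) (q : {q : Set Ω × U // MeasurableSet q.1 ∧
      ∀ᵐ ω ∂μ, N q.2 ω = q.1.indicator 1 ω}), ∃ r : {q : Set Ω × U // MeasurableSet q.1 ∧
      ∀ᵐ ω ∂μ, N q.2 ω = q.1.indicator 1 ω}, r.1.1 = q.1.1 ∪ A n ∧
      ∀ᵐ ω ∂μ, ω ∈ q.1.1 → N (r.1.2 - q.1.2) ω = 0 := by
    rintro n ⟨⟨B, x⟩, hB, hx⟩
    obtain ⟨z, hz1, hz2⟩ := hU.exists_norm_eq_indicator_union hE hB (hA n) hx (hy n)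
    exact ⟨⟨⟨B ∪ A n, z⟩, hB.union (hA n), hz1⟩, rfl, hz2⟩
  choose g hg1 hg2 using hstep
  let Q : ℕ → {q : Set Ω × U // MeasurableSet q.1 ∧
      ∀ᵐ ω ∂μ, N q.2 ω = q.1.indicator 1 ω} := fun n =>
    Nat.rec ⟨⟨A 0, y 0⟩, hA 0, hy 0⟩ (fun k q => g (k + 1) q) n
  let B : ℕ → Set Ω := fun n => (Q n).1.1
  let x : ℕ → U := fun n => (Q n).1.2
  have hx : ∀ n, ∀ᵐ ω ∂μ, N (x n) ω = (B n).indicator 1 ω := fun n => (Q n).2.2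
  have hB : ∀ n, B (n + 1) = B n ∪ A (n + 1) := fun n => hg1 (n + 1) (Q n)
  have hxs : ∀ᵐ ω ∂μ, ∀ n, ω ∈ B n → N (x (n + 1) - x n) ω = 0 :=
    ae_all_iff.2 fun n => hg2 (n + 1) (Q n)
  have hmono : Monotone B := monotone_nat_of_le_succ fun n => by
    rw [hB]
    exact Set.subset_union_left
  have hAB : ⋃ n, B n = ⋃ n, A n := by
    refine Set.Subset.antisymm (Set.iUnion_subset fun n => ?_) (Set.iUnion_subset fun n => ?_)
    · induction n with
      | zero => exact Set.subset_iUnion A 0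
      | succ n ih =>
        rw [hB]
        exact Set.union_subset ih (Set.subset_iUnion A (n + 1))
    · refine Set.Subset.trans ?_ (Set.subset_iUnion B n)
      cases n with
      | zero => exact Set.Subset.rfl
      | succ n =>
        rw [hB]
        exact Set.subset_union_right
  rw [← hAB]
  have htri : ∀ᵐ ω ∂μ, ∀ n m, N (x n - x m) ω ≤ N (x n) ω + N (x m) ω :=
    ae_all_iff.2 fun n => ae_all_iff.2 fun m => hU.ae_sub_le _ _
  have htri' : ∀ᵐ ω ∂μ, ∀ n k, N (x (n + 1) - x k) ω ≤ N (x (n + 1) - x n) ω + N (x n - x k) ω := by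
    refine ae_all_iff.2 fun n => ae_all_iff.2 fun k => ?_
    have h := hU.ae_add_le (x (n + 1) - x n) (x n - x k)
    rwa [sub_add_sub_cancel] at h
  have htri'' : ∀ᵐ ω ∂μ, ∀ n m k, N (x n - x m) ω ≤ N (x n - x k) ω + N (x m - x k) ω := by
    refine ae_all_iff.2 fun n => ae_all_iff.2 fun m => ae_all_iff.2 fun k => ?_
    have h := hU.ae_sub_le (x n - x k) (x m - x k)
    rwa [sub_sub_sub_cancel_right] at h
  have hself : ∀ᵐ ω ∂μ, ∀ n, N (x n - x n) ω = 0 := ae_all_iff.2 fun n => by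
    rw [sub_self]
    exact hU.ae_norm_zero
  obtain ⟨z, -, hz⟩ := hU.exists_ae_limit hE x (D := 1) (fun n => by
    filter_upwards [hx n] with ω h
    rw [h]
    exact Set.indicator_le_self' (fun _ _ => zero_le_one) ω) (by
    filter_upwards [ae_all_iff.2 hx, hxs, htri, htri', htri'', hself] with ω h1 h2 h3 h4 h5 h6 ε hε
    by_cases hω : ∃ K, ω ∈ B K
    · obtain ⟨K, hK⟩ := hω
      have h7 : ∀ n ≥ K, N (x n - x K) ω ≤ 0 := by
        intro n hn
        induction n, hn using Nat.le_induction with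
        | base => exact (h6 K).le
        | succ n hn ih =>
          refine (h4 n K).trans ?_
          rw [h2 n (hmono hn hK), zero_add]
          exact ih
      refine ⟨K, fun n hn m hm => ?_⟩
      linarith [h5 n m K, h7 n hn, h7 m hm]
    · push Not at hω
      refine ⟨0, fun n _ m _ => ?_⟩
      have h7 := h3 n m
      rw [h1, h1, Set.indicator_of_notMem (hω n), Set.indicator_of_notMem (hω m)] at h7
      linarith)
  refine ⟨z, ?_⟩
  filter_upwards [hz, ae_all_iff.2 hx, ae_all_iff.2 fun n => hU.ae_add_le (z - x n) (x n),
    ae_all_iff.2 fun n => hU.ae_sub_le z (z - x n)] with ω h1 h2 h3 h4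
  simp only [sub_add_cancel] at h3
  simp only [sub_sub_cancel] at h4
  have h5 : Tendsto (fun n => N (x n) ω) atTop (𝓝 (N z ω)) := by
    refine tendsto_iff_norm_sub_tendsto_zero.2 (squeeze_zero (fun _ => norm_nonneg _) ?_ h1)
    intro n
    rw [Real.norm_eq_abs, abs_le]
    constructor <;> linarith [h3 n, h4 n]
  refine tendsto_nhds_unique h5 ?_
  simp only [h2]
  exact (hmono.tendsto_indicator B 1 ω).mono_right (pure_le_nhds _)

/-- If `D` is a set on which the norm of `x` is bounded from below, then some element has the norm
`χ_D`. -/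
theorem exists_norm_eq_indicator {D : Set Ω} (hD : MeasurableSet D) {x : U} {ε : ℝ} (hε : 0 < ε)
    (h : ∀ ω ∈ D, ε ≤ N x ω) : ∃ y, ∀ᵐ ω ∂μ, N y ω = D.indicator 1 ω := by
  classical
  have hm : AEMeasurable (fun ω => if ω ∈ D then (((N x ω)⁻¹ : ℝ) : ℂ) else 0) μ :=
    (Measurable.ite hD (Complex.measurable_ofReal.comp (N x).measurable.inv)
      measurable_const).aemeasurable
  have hb : ∀ ω, ‖(if ω ∈ D then (((N x ω)⁻¹ : ℝ) : ℂ) else 0)‖ ≤ ε⁻¹ := by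
    intro ω
    split_ifs with hω
    · rw [Complex.norm_real, Real.norm_eq_abs, abs_inv, abs_of_pos (hε.trans_le (h ω hω))]
      exact inv_anti₀ hε (h ω hω)
    · simpa using hε.le
  refine ⟨Subalgebra.inclusion hE.Linf_le (mkLinf _ hm _ hb) • x, ?_⟩
  filter_upwards [hU.ae_module_smul (Subalgebra.inclusion hE.Linf_le (mkLinf _ hm _ hb)) x,
    coeFn_mkLinf _ hm _ hb] with ω h1 h2
  rw [h1]
  change ‖(mkLinf _ hm _ hb : Ω →ₘ[μ] ℂ) ω‖ * _ = _
  rw [h2]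
  by_cases hω : ω ∈ D
  · have h3 : 0 < N x ω := hε.trans_le (h ω hω)
    rw [if_pos hω, Complex.norm_real, Real.norm_eq_abs, abs_inv, abs_of_pos h3,
      inv_mul_cancel₀ h3.ne', Set.indicator_of_mem hω, Pi.one_apply]
  · rw [if_neg hω, _root_.norm_zero, zero_mul, Set.indicator_of_notMem hω]

/-- A full algebra over a finite measure space has an element of norm one. -/
theorem exists_norm_eq_one [IsFiniteMeasure μ] (hfull : IsFull N) :
    ∃ x, ∀ᵐ ω ∂μ, N x ω = 1 := by
  -- Exhaustion: a countable union attains the supremum of the measures of such supports. If its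
  -- complement had positive measure, fullness would supply a set of positive measure there by which
  -- it could be enlarged.
  let 𝒮 : Set (Set Ω) := {A | MeasurableSet A ∧ ∃ x, ∀ᵐ ω ∂μ, N x ω = A.indicator 1 ω}
  have h0 : ∅ ∈ 𝒮 := ⟨MeasurableSet.empty, 0, by simpa using hU.ae_norm_zero⟩
  obtain ⟨m, -, hm, hm𝒮⟩ := exists_seq_tendsto_sSup (S := μ '' 𝒮) ⟨_, ∅, h0, rfl⟩ (OrderTop.bddAbove _)
  choose A hA𝒮 hAm using hm𝒮
  choose hA x hx using hA𝒮
  obtain ⟨z, hz⟩ := hU.exists_norm_eq_indicator_iUnion hE hA hx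
  set B := ⋃ n, A n with hB
  have hBm : MeasurableSet B := MeasurableSet.iUnion hA
  have hmax : ∀ D ∈ 𝒮, μ D ≤ μ B := fun D hD =>
    (le_sSup (Set.mem_image_of_mem μ hD)).trans (le_of_tendsto' hm fun n => by
      rw [← hAm]
      exact measure_mono (Set.subset_iUnion A n))
  have hBc : μ Bᶜ = 0 := by
    by_contra hne
    obtain ⟨y, hy⟩ := hfull Bᶜ hBm.compl hne
    let D : ℕ → Set Ω := fun k => Bᶜ ∩ {ω | 1 / ((k : ℝ) + 1) ≤ N y ω}
    have hD : ∀ k, MeasurableSet (D k) := fun k =>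
      hBm.compl.inter (measurableSet_le measurable_const (N y).measurable)
    have hk : ∃ k, μ (D k) ≠ 0 := by
      by_contra! hall
      refine hy ?_
      filter_upwards [ae_all_iff.2 fun k => measure_eq_zero_iff_ae_notMem.1 (hall k),
        hU.ae_nonneg y] with ω h1 h2 h3
      by_contra h4
      obtain ⟨k, hk⟩ := exists_nat_one_div_lt (lt_of_le_of_ne h2 (Ne.symm h4))
      exact h1 k ⟨h3, hk.le⟩
    obtain ⟨k, hk⟩ := hk
    obtain ⟨y', hy'⟩ := hU.exists_norm_eq_indicator hE (hD k) (x := y)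
      (ε := 1 / ((k : ℝ) + 1)) (by positivity) fun ω hω => hω.2
    obtain ⟨w, hw, -⟩ := hU.exists_norm_eq_indicator_union hE hBm (hD k) hz hy'
    have h1 := hmax (B ∪ D k) ⟨hBm.union (hD k), w, hw⟩
    rw [measure_union (Set.disjoint_left.2 fun ω h1 h2 => h2.1 h1) (hD k)] at h1
    refine hk (nonpos_iff_eq_zero.1 ((ENNReal.add_le_add_iff_left (measure_ne_top μ B)).1 ?_))
    rwa [add_zero]
  refine ⟨z, ?_⟩
  filter_upwards [hz, measure_eq_zero_iff_ae_notMem.1 hBc] with ω h1 h2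
  rw [h1, Set.indicator_of_mem (not_not.1 h2), Pi.one_apply]

end IsBanachKantorovichAlgebra

/-! ## Uniqueness of the bundle -/

section Sections

variable {Ω : Type u} [MeasurableSpace Ω] {μ : Measure Ω} {X : Ω → Type v} {Y : Ω → Type w}

theorem Sec.ae_val_map [∀ ω, Zero (X ω)] [∀ ω, Zero (Y ω)] (h : ∀ ω, X ω → Y ω) (a : Sec μ X) :
    ∀ᵐ ω ∂μ, (Sec.map h a).val ω = h ω (a.val ω) := by
  filter_upwards [a.ae_dom] with ω hω
  have hd : ((Sec.map h a).toFun ω).Dom := hω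
  simp only [Sec.val, dif_pos hω, dif_pos hd]
  rfl

theorem Sec.map_map_of_rightInverse (h : ∀ ω, X ω → Y ω) (k : ∀ ω, Y ω → X ω)
    (hk : ∀ ω y, h ω (k ω y) = y) (b : Sec μ Y) : Sec.map h (Sec.map k b) = b := by
  cases b with
  | mk f hf =>
    simp only [Sec.map, Sec.mk.injEq]
    funext ω
    rw [Part.map_map]
    exact (congrArg (fun g => Part.map g (f ω)) (funext (hk ω))).trans (Part.map_id' (fun _ => rfl) _)

end Sections

namespace IsBanachKantorovichAlgebra

variable {Ω : Type u} [MeasurableSpace Ω] {μ : Measure Ω} {E : Subalgebra ℂ (Ω →ₘ[μ] ℂ)}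
  {U : Type v} [NonUnitalRing U] [Module ℂ U] [Module E U] {N : U → (Ω →ₘ[μ] ℝ)}
  (hU : IsBanachKantorovichAlgebra E N) {p : Lifting μ}
  {𝒴 : MeasurableBundle.{u, w} μ} (m : VectorLifting p 𝒴) (S : IsometricIso E N 𝒴)

/-- The lifted section of a bundle isomorphic to the algebra which belongs to a bounded element. -/
def lift (x : hU.bounded) (ω : Ω) : 𝒴.fiber ω := m.toFun (S.toFun x.1) ω

theorem iso_mem (x : hU.bounded) : S.toFun x.1 ∈ 𝒴.bkSpace (Linf μ) := by
  refine ⟨(S.bijOn.mapsTo (Set.mem_univ x.1)).1, ?_⟩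
  rw [S.norm_eq]
  exact hU.mem_bounded_iff.1 x.2

theorem lift_add (x y : hU.bounded) (ω : Ω) :
    hU.lift m S (x + y) ω = hU.lift m S x ω + hU.lift m S y ω := by
  refine Eq.trans ?_ (m.map_add _ (hU.iso_mem S x) _ (hU.iso_mem S y) ω)
  rw [← S.map_add]
  rfl

theorem lift_sub (x y : hU.bounded) (ω : Ω) :
    hU.lift m S (x - y) ω = hU.lift m S x ω - hU.lift m S y ω := by
  rw [eq_sub_iff_add_eq, ← lift_add, sub_add_cancel]

theorem lift_mul (x y : hU.bounded) (ω : Ω) :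
    hU.lift m S (x * y) ω = hU.lift m S x ω * hU.lift m S y ω := by
  refine Eq.trans ?_ (m.map_mul _ (hU.iso_mem S x) _ (hU.iso_mem S y) ω)
  rw [← S.map_mul]
  rfl

/-- Both the isomorphism and the lifting are linear only over function algebras, so a complex scalar
is passed through them as a constant function. -/
theorem lift_smul [IsScalarTower ℂ E U] (hE : IsFaithfulSolid E) (c : ℂ) (x : hU.bounded) (ω : Ω) :
    hU.lift m S (c • x) ω = c • hU.lift m S x ω := by
  have h := m.map_smul (algebraMap ℂ (Linf μ) c) _ (hU.iso_mem S x) ω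
  rw [AlgHom.commutes, Pi.algebraMap_apply, Algebra.algebraMap_self, RingHom.id_apply] at h
  refine Eq.trans ?_ h
  have h2 := S.map_smul (Subalgebra.inclusion hE.Linf_le (algebraMap ℂ (Linf μ) c)) x.1
  rw [inclusion_algebraMap_smul hE] at h2
  exact congrArg (fun s => m.toFun s ω) h2

/-- This is the value found in `norm_sec`. It is the reason why germs determine lifted values and
why the induced map of fibres is isometric. -/
theorem norm_lift (x : hU.bounded) (ω : Ω) : ‖hU.lift m S x ω‖ = p.re (N x.1) ω := by
  have h := m.norm_eq _ (hU.iso_mem S x) ω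
  rw [← p.ofReal_re, S.norm_eq] at h
  exact_mod_cast h

theorem cls_lift (x : hU.bounded) :
    (Sec.ofFun (hU.lift m S x) : Sec μ 𝒴.fiber).cls = S.toFun x.1 :=
  m.cls_eq _ (hU.iso_mem S x)

theorem meas_lift (x : hU.bounded) : 𝒴.Meas (hU.lift m S x) := by
  rw [← MeasurableBundle.mem_LZero_iff, cls_lift]
  exact (hU.iso_mem S x).1

theorem exists_of_mem_bkSpace (hE : IsFaithfulSolid E) {s : SecClass μ 𝒴.fiber}
    (hs : s ∈ 𝒴.bkSpace (Linf μ)) : ∃ x : hU.bounded, S.toFun x.1 = s := by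
  obtain ⟨x, -, rfl⟩ := S.bijOn.surjOn ⟨hs.1, hE.Linf_le hs.2⟩
  have h := hs.2
  rw [S.norm_eq] at h
  exact ⟨⟨x, hU.mem_bounded_iff.2 h⟩, rfl⟩

/-- A measurable section is a scalar multiple of the lifted section of a bounded element. -/
theorem exists_lift_of_meas (hE : IsFaithfulSolid E) {f : ∀ ω, 𝒴.fiber ω} (hf : 𝒴.Meas f) :
    ∃ x : hU.bounded, ∃ h : Ω → ℂ, AEMeasurable h μ ∧
      ∀ᵐ ω ∂μ, f ω = h ω • hU.lift m S x ω := by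
  obtain ⟨x, hx⟩ := hU.exists_of_mem_bkSpace S hE (MeasurableBundle.cls_mem_bkSpace_Linf
    (hf.smul hf.aemeasurable_damp)
    (Eventually.of_forall fun ω => MeasurableBundle.norm_damp_smul_le (f ω)))
  rw [← hU.cls_lift m S, Sec.cls_ofFun_eq_iff] at hx
  refine ⟨x, _, hf.aemeasurable_undamp, ?_⟩
  filter_upwards [hx] with ω h
  rw [h, MeasurableBundle.undamp_smul_damp_smul]

variable [IsScalarTower ℂ U U] [SMulCommClass ℂ U U] [IsScalarTower ℂ E U]
  (hE : IsFaithfulSolid E)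

theorem exists_sec_smul_of_meas {f : ∀ ω, (hU.bundle p hE).fiber ω}
    (hf : (hU.bundle p hE).Meas f) :
    ∃ x : hU.bounded, ∃ h : Ω → ℂ, AEMeasurable h μ ∧
      ∀ᵐ ω ∂μ, f ω = h ω • hU.sec p hE x ω := by
  obtain ⟨x, hx⟩ := hU.exists_sec_of_meas p (hf.smul hf.aemeasurable_damp)
    (Eventually.of_forall fun ω => MeasurableBundle.norm_damp_smul_le (f ω))
  refine ⟨x, _, hf.aemeasurable_undamp, ?_⟩
  filter_upwards [hx] with ω h
  rw [h, MeasurableBundle.undamp_smul_damp_smul]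

/-- The isometric homomorphism between the fibres which is induced by the vector-valued
lifting. -/
theorem exists_fiberHom (ω : Ω) : ∃ H : (hU.bundle p hE).fiber ω →ₙₐ[ℂ] 𝒴.fiber ω,
    (∀ x, H (hU.sec p hE x ω) = hU.lift m S x ω) ∧ Isometry H := by
  have key : ∀ x y : hU.bounded, hU.sec p hE x ω = hU.sec p hE y ω →
      hU.lift m S x ω = hU.lift m S y ω := by
    intro x y h
    rw [← sub_eq_zero, ← lift_sub, ← norm_eq_zero, norm_lift, ← hU.norm_sec p (hE := hE), sec_sub,
      h, sub_self, _root_.norm_zero]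
  choose r hr using hU.sec_surjective p (hE := hE) ω
  have hval : ∀ x, hU.lift m S (r (hU.sec p hE x ω)) ω = hU.lift m S x ω :=
    fun x => key _ _ (hr _)
  let H : (hU.bundle p hE).fiber ω →ₙₐ[ℂ] 𝒴.fiber ω :=
    { toFun := fun z => hU.lift m S (r z) ω
      map_smul' := fun c z => by
        obtain ⟨x, rfl⟩ := hU.sec_surjective p ω z
        simp only [MonoidHom.id_apply]
        rw [← sec_smul, hval, hval, hU.lift_smul m S hE]
      map_zero' := by
        rw [← hU.sec_zero p (hE := hE) ω, hval, ← sub_self (0 : hU.bounded), lift_sub, sub_self]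
      map_add' := fun z w => by
        obtain ⟨x, rfl⟩ := hU.sec_surjective p ω z
        obtain ⟨y, rfl⟩ := hU.sec_surjective p ω w
        rw [← sec_add, hval, hval, hval, lift_add]
      map_mul' := fun z w => by
        obtain ⟨x, rfl⟩ := hU.sec_surjective p ω z
        obtain ⟨y, rfl⟩ := hU.sec_surjective p ω w
        rw [← sec_mul, hval, hval, hval, lift_mul] }
  have hH : ∀ x, H (hU.sec p hE x ω) = hU.lift m S x ω := hval
  refine ⟨H, hH, Isometry.of_dist_eq fun z w => ?_⟩
  obtain ⟨x, rfl⟩ := hU.sec_surjective p ω z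
  obtain ⟨y, rfl⟩ := hU.sec_surjective p ω w
  rw [hH, hH, dist_eq_norm, dist_eq_norm, ← lift_sub, ← sec_sub, norm_lift, norm_sec]

include m S in
/-- A bundle with a vector-valued lifting whose space of sections is isomorphic to the algebra is
isometrically isomorphic to the bundle of the algebra. -/
theorem exists_bundleIsomorphism : ∃ H : ∀ ω, (hU.bundle p hE).fiber ω →ₙₐ[ℂ] 𝒴.fiber ω,
    IsBundleIsomorphism H ∧ ∀ ω, Isometry (H ω) := by
  choose H hH hiso using hU.exists_fiberHom m S hE
  have hsurj : ∀ ω, Function.Surjective (H ω) := by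
    intro ω
    -- An isometry from a complete fibre has closed range, and the range contains the dense set of
    -- lifted values.
    rw [← Set.range_eq_univ, ← (hiso ω).isClosedEmbedding.isClosed_range.closure_eq]
    refine ((m.dense ω).mono ?_).closure_eq
    rintro z ⟨s, hs, rfl⟩
    obtain ⟨x, rfl⟩ := hU.exists_of_mem_bkSpace S hE hs
    exact ⟨_, hH ω x⟩
  choose K hK using hsurj
  refine ⟨H, ⟨fun ω => (hiso ω).injective, Set.Subset.antisymm ?_ ?_⟩, hiso⟩
  · rintro _ ⟨a, ha, rfl⟩
    rw [MeasurableBundle.mem_measurableSections_iff] at ha ⊢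
    obtain ⟨x, h, hh, hx⟩ := hU.exists_sec_smul_of_meas hE ha
    refine ((hU.meas_lift m S x).smul hh).congr ?_
    filter_upwards [hx, Sec.ae_val_map (fun ω => H ω) a] with ω h1 h2
    rw [h2, h1, map_smul, hH]
  · intro b hb
    -- The preimage is formed fibrewise. It is measurable because `b` is a scalar function times a
    -- lifted section, whose preimage is the germ section of the same element.
    refine ⟨Sec.map K b, ?_, Sec.map_map_of_rightInverse _ _ hK b⟩
    rw [MeasurableBundle.mem_measurableSections_iff] at hb ⊢
    obtain ⟨x, h, hh, hx⟩ := hU.exists_lift_of_meas m S hE hb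
    refine ((hU.meas_sec p (hE := hE) x).smul hh).congr ?_
    filter_upwards [hx, Sec.ae_val_map K b] with ω h1 h2
    refine (hiso ω).injective ?_
    rw [h2, hK, h1, map_smul, hH]

end IsBanachKantorovichAlgebra

end BKAlg

/-! ### Assembly of the theorem -/

theorem theorem2p2 {Ω : Type u} [MeasurableSpace Ω] (μ : Measure Ω) [IsFiniteMeasure μ]
    (E : Subalgebra ℂ (Ω →ₘ[μ] ℂ)) (hE : BKAlg.IsFaithfulSolid E)
    {U : Type v} [NonUnitalRing U] [Module ℂ U] [IsScalarTower ℂ U U] [SMulCommClass ℂ U U]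
    [Module E U] [IsScalarTower ℂ E U] [IsScalarTower E U U] [SMulCommClass E U U]
    (N : U → (Ω →ₘ[μ] ℝ)) (hU : BKAlg.IsBanachKantorovichAlgebra E N) :
    (μ.IsComplete → μ ≠ 0 → Nonempty (BKAlg.Lifting μ)) ∧
    ∀ p : BKAlg.Lifting μ,
      ∃ (𝒳 : BKAlg.MeasurableBundle.{u, v} μ) (l : BKAlg.VectorLifting p 𝒳),
        Nonempty (BKAlg.IsometricIso E N 𝒳) ∧
        (∀ (ω : Ω) (z : 𝒳.fiber ω), ∃ x ∈ 𝒳.bkSpace (BKAlg.Linf μ), l.toFun x ω = z) ∧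
        (∀ 𝒴 : BKAlg.MeasurableBundle.{u, w} μ, Nonempty (BKAlg.VectorLifting p 𝒴) →
          Nonempty (BKAlg.IsometricIso E N 𝒴) →
          ∃ H : ∀ ω, 𝒳.fiber ω →ₙₐ[ℂ] 𝒴.fiber ω,
            BKAlg.IsBundleIsomorphism H ∧ ∀ ω, Isometry (H ω)) ∧
        (BKAlg.IsFull N → ∀ ω, Nontrivial (𝒳.fiber ω)) ∧
        (BKAlg.IsUnital N →
          ∀ ω, ∃ e : 𝒳.fiber ω, (∀ z, e * z = z ∧ z * e = z) ∧ ‖e‖ = 1) := by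
  refine ⟨fun _ h0 => BKAlg.nonempty_lifting h0, fun p => ?_⟩
  obtain ⟨l, hl⟩ := hU.exists_vectorLifting p hE
  -- The lifting turns a norm that is `1` almost everywhere into fibre norms equal to `1` at every
  -- point; this settles both nontriviality and the norm of the units.
  have hnorm : ∀ x : U, (∀ᵐ ω ∂μ, N x ω = 1) → ∃ y : hU.bounded, y.1 = x ∧
      ∀ ω, ‖hU.sec p hE y ω‖ = 1 := fun x hx =>
    ⟨⟨x, 1, hx.mono fun _ h => h.le⟩, rfl, fun ω => p.re_const_of_ae hx ω⟩
  refine ⟨hU.bundle p hE, l, hU.nonempty_isometricIso p hE, fun ω z => ?_, ?_, fun hfull ω => ?_,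
    ?_⟩
  · obtain ⟨x, rfl⟩ := hU.sec_surjective p ω z
    exact ⟨_, hU.cls_sec_mem p hE x, hl x ω⟩
  · rintro 𝒴 ⟨m⟩ ⟨S⟩
    exact hU.exists_bundleIsomorphism m S hE
  · obtain ⟨x, hx⟩ := hU.exists_norm_eq_one hE hfull
    obtain ⟨y, -, hy⟩ := hnorm x hx
    refine ⟨hU.sec p hE y ω, 0, fun h => ?_⟩
    have := hy ω
    rw [h, norm_zero] at this
    exact zero_ne_one this
  · rintro ⟨e, he, hNe⟩ ω
    obtain ⟨y, rfl, hy⟩ := hnorm e (by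
      rw [hNe]
      exact AEEqFun.coeFn_one)
    refine ⟨hU.sec p hE y ω, fun z => ?_, hy ω⟩
    obtain ⟨x, rfl⟩ := hU.sec_surjective p ω z
    rw [← BKAlg.IsBanachKantorovichAlgebra.sec_mul, ← BKAlg.IsBanachKantorovichAlgebra.sec_mul,
      show y * x = x from Subtype.ext (he x.1).1, show x * y = x from Subtype.ext (he x.1).2]
    exact ⟨rfl, rfl⟩
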